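/- **Conventions.** All objects are smooth. A *Weyl structure* $(\mathsf c,D)$ on a $3$-manifold $B$ is a (positive definite) conformal structure with a torsion-free connection $D$ such that $D\mathsf c=0$; in a compatible metric $g$ it is given by a $1$-form $\omega$ with $Dg=-2\omega\otimes g$, and $(g,\omega)$ and $(e^{2f}g,\omega-df)$ describe the same structure. It is *Einstein–Weyl* if the symmetric traceless part of the Ricci tensor of $D$ vanishes. With $L$ the bundle of $1$-densities, an Einstein–Weyl structure is *hyperCR* if there are an orthonormal frame $\chi_1,\chi_2,\chi_3$ of $L^{-1}TB\cong L\,T^*B$ and a section $\kappa$ of $L^{-1}$ with $D\chi_i=\kappa\,{*\chi_i}$ for $i=1,2,3$. A *spinor-vortex space* is a connected Riemann surface $N$ with a complex line bundle $\mathcal W$, a Hermitian metric on $\mathcal W^{-1}TN$, a holomorphic structure $\bar\partial^a$ on $\mathcal W$, and sections $\mathcal C$ of $\mathcal W^{-2}TN$ and $\psi$ of $\mathcal W^{-1}$ satisfying $$\bar\partial^a\mathcal C=0,\qquad \bar\partial^a\psi=-3\,\mathcal C\bar\psi,\qquad s_{\mathcal W^{-1}TN}=\psi\bar\psi-2\,\mathcal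 C\bar{\mathcal C},$$ where $s$ is the normalized scalar curvature of the Chern connection. In a holomorphic coordinate $z$ and a frame $e$ of $\mathcal W$ for which $e^{-1}\otimes\partial_z$ has length one, write $\bar\partial^a e=a\,d\bar z\otimes e$, $\mathcal C(e,e)=C\,\partial_z$ and $\psi(e)=\psi$; the equations are $$C_{\bar z}=2aC,\qquad \psi_{\bar z}-a\psi=-3C\bar\psi,\qquad -2(a_z+\bar a_{\bar z})=4\bigl(|\psi|^2-2|C|^2\bigr).$$ The space is *trivial* if $\mathcal C=\psi=0$ and, locally, $\mathcal W\cong TN$ holomorphically and isometrically. It is *spherical* if $\mathcal C=0$, the (then holomorphic) section $\psi$ is nonvanishing on a dense open set, and the metric $|\psi|^2dz\,d\bar z$ has constant Gaussian curvature $4$ there. A *generalized symmetry* of $(B,\mathsf c,D)$ over a spinor-vortex space $N$ is a surjection $\pi\colon B\to N$ such that around each point of $B$ there are coordinates $(z,t)$ with $\pi(z,t)=z$, a frame $e$ of $\mathcal W$ as above, and complex functions $\alpha$ and $\Phi\neq0$ of $(z,t)$ with the following properties. They solve the generalized Hitchin equations with gauge algebra the vector fields on a $1$-manifold, $$[\partial_z-\alpha\partial_t,\partial_{\bar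 z}-\bar\alpha\partial_t]-[\Phi\partial_t,\bar\Phi\partial_t]=(\psi\bar\Phi-\bar\psi\Phi)\partial_t,\qquad [\partial_{\bar z}-\bar\alpha\partial_t,\Phi\partial_t]-a\Phi\partial_t=C\bar\Phi\,\partial_t ;$$ with $\theta=dt+\alpha\,dz+\bar\alpha\,d\bar z$, the Weyl structure is given, up to change of gauge, by $$g=4\Phi\bar\Phi\,dz\,d\bar z+\theta^2,\qquad \omega=\Bigl(\dot\alpha-\frac{2\bar C\Phi}{\bar\Phi}\Bigr)dz+\Bigl(\dot{\bar\alpha}-\frac{2C\bar\Phi}{\Phi}\Bigr)d\bar z-\frac12\Bigl(\frac{\psi+\dot\Phi}{\Phi}+\frac{\bar\psi+\dot{\bar\Phi}}{\bar\Phi}\Bigr)\theta ;$$ and the local Higgs fields $e^{-1}\otimes\Phi\,\partial_t$ agree on overlaps. It is *geodesic* if the fibres of $\pi$ are geodesics of $D$, i.e. $D_VV$ is a multiple of $V$ for every local vector field $V$ tangent to the fibres. **Theorem.** Let $(B,\mathsf c,D)$ be an Einstein–Weyl $3$-manifold with a geodesic generalized symmetry over a spinor-vortex space $N$. Then $(B,\mathsf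 c,D)$ is hyperCR on every simply connected open subset of $B$ (in particular it is locally hyperCR, and it is hyperCR if $B$ is simply connected). Moreover, the spinor-vortex space $N$ is trivial or spherical. -/

import Mathlib

open scoped Manifold ContDiff Topology

noncomputable section

namespace EinsteinWeyl

/-- The model space of a 3-manifold. -/
abbrev E3 : Type := EuclideanSpace ℝ (Fin 3)

/-! ### Weyl structures on 3-manifolds -/

section Weyl

variable {B : Type*} [TopologicalSpace B] [ChartedSpace E3 B]

/-- The derivative at `x` of a real function on `B` in the direction `v`. -/
def deriv1 (f : B → ℝ) (x : B) (v : TangentSpace 𝓘(ℝ, E3) x) : ℝ :=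
  mfderiv 𝓘(ℝ, E3) 𝓘(ℝ) f x v

variable [IsManifold 𝓘(ℝ, E3) ∞ B]

/-- The vector field `Y` is differentiable at `x`. -/
def DiffFieldAt (Y : ∀ y : B, TangentSpace 𝓘(ℝ, E3) y) (x : B) : Prop :=
  MDifferentiableAt 𝓘(ℝ, E3) (𝓘(ℝ, E3).prod 𝓘(ℝ, E3))
    (fun y ↦ (⟨y, Y y⟩ : TangentBundle 𝓘(ℝ, E3) B)) x

/-- The vector field `Y` is smooth on `U`. -/
def SmoothFieldOn (Y : ∀ y : B, TangentSpace 𝓘(ℝ, E3) y) (U : Set B) : Prop :=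
  ContMDiffOn 𝓘(ℝ, E3) (𝓘(ℝ, E3).prod 𝓘(ℝ, E3)) ∞
    (fun y ↦ (⟨y, Y y⟩ : TangentBundle 𝓘(ℝ, E3) B)) U

variable (B)

/-- A Weyl structure `(c, D)` on a 3-manifold, described in a gauge (length scale) `μ`:
`metric` is the compatible metric `g = μ⁻² c`, `form` is the Weyl 1-form `ω`, given by `D μ = ω μ`,
and `conn` is the Weyl connection: it is torsion-free and `D c = 0`, that is `D g = -2 ω ⊗ g`.
For a connection, `conn Y x v` is `D_v Y` at `x`. -/
structure WeylStructure where
  metric : Bundle.ContMDiffRiemannianMetric 𝓘(ℝ, E3) ∞ E3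
    (TangentSpace 𝓘(ℝ, E3) : B → Type _)
  form : ∀ x : B, TangentSpace 𝓘(ℝ, E3) x →L[ℝ] ℝ
  form_smooth : ContMDiff 𝓘(ℝ, E3) (𝓘(ℝ, E3).prod 𝓘(ℝ, E3 →L[ℝ] ℝ)) ∞
    (fun x ↦ Bundle.TotalSpace.mk' (E3 →L[ℝ] ℝ)
      (E := fun x : B ↦ TangentSpace 𝓘(ℝ, E3) x →L[ℝ] ℝ) x (form x))
  conn : CovariantDerivative 𝓘(ℝ, E3) E3 (TangentSpace 𝓘(ℝ, E3) : B → Type _)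
  torsion_free : conn.torsion = 0
  conformal : ∀ (x : B) (Y Z : ∀ y : B, TangentSpace 𝓘(ℝ, E3) y),
    DiffFieldAt Y x → DiffFieldAt Z x → ∀ v : TangentSpace 𝓘(ℝ, E3) x,
      deriv1 (fun y ↦ metric.inner y (Y y) (Z y)) x v =
        metric.inner x (conn Y x v) (Z x) + metric.inner x (Y x) (conn Z x v)
          - 2 * form x v * metric.inner x (Y x) (Z x)

variable {B}

namespace WeylStructure

variable (w : WeylStructure B)

/-- `e` is a smooth frame on `U` that is orthonormal for the metric of the gauge. In terms of the
conformal structure, `μ⁻¹ e₀, μ⁻¹ e₁, μ⁻¹ e₂` is an orthonormal frame of the weightless tangent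
bundle `L⁻¹ TB`. -/
def IsOrthonormalFrameOn (e : Fin 3 → ∀ x : B, TangentSpace 𝓘(ℝ, E3) x) (U : Set B) : Prop :=
  (∀ i, SmoothFieldOn (e i) U) ∧
    ∀ x ∈ U, ∀ i j, w.metric.inner x (e i x) (e j x) = if i = j then 1 else 0

/-- The curvature `R^D_{X,Y} Z = D_X D_Y Z - D_Y D_X Z - D_{[X,Y]} Z` of the Weyl connection. -/
def curvature (X Y Z : ∀ x : B, TangentSpace 𝓘(ℝ, E3) x) (x : B) : TangentSpace 𝓘(ℝ, E3) x :=
  w.conn (fun y ↦ w.conn Z y (Y y)) x (X x) - w.conn (fun y ↦ w.conn Z y (X y)) x (Y x)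
    - w.conn Z x (VectorField.mlieBracket 𝓘(ℝ, E3) X Y x)

/-- The Ricci tensor of the Weyl connection in an orthonormal frame `e`: its value on
`(e j, e k)`, namely the trace of `X ↦ R^D_{X, e j} (e k)`. -/
def ricci (e : Fin 3 → ∀ x : B, TangentSpace 𝓘(ℝ, E3) x) (j k : Fin 3) (x : B) : ℝ :=
  ∑ i, w.metric.inner x (w.curvature (e i) (e j) (e k) x) (e i x)

/-- The Einstein–Weyl equation: the symmetric traceless part of the Ricci tensor of the Weyl
connection vanishes. -/
def IsEinsteinWeyl : Prop :=
  ∀ (U : Set B) (e : Fin 3 → ∀ x : B, TangentSpace 𝓘(ℝ, E3) x),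
    IsOpen U → w.IsOrthonormalFrameOn e U → ∀ x ∈ U, ∀ j k,
      (w.ricci e j k x + w.ricci e k j x) / 2 =
        if j = k then (∑ i, w.ricci e i i x) / 3 else 0

/-- The Einstein–Weyl structure is hyperCR on the open set `V`: there are, on `V`, an orthonormal
frame `χ₀, χ₁, χ₂` of the weightless tangent bundle and a section `κ` of `L⁻¹` with
`D χᵢ = κ * χᵢ`. Here `χᵢ = μ⁻¹ Xᵢ` with `X` orthonormal in the gauge, so that
`D_v χᵢ = μ⁻¹ (D_v Xᵢ - ω(v) Xᵢ)`, the section `κ` is written as `μ⁻¹` times a function, and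
`* χᵢ = χᵢ₊₁ ∧ χᵢ₊₂` with indices mod 3. -/
def IsHyperCROn (V : Set B) : Prop :=
  ∃ (X : Fin 3 → ∀ x : B, TangentSpace 𝓘(ℝ, E3) x) (κ : B → ℝ),
    w.IsOrthonormalFrameOn X V ∧ ContMDiffOn 𝓘(ℝ, E3) 𝓘(ℝ) ∞ κ V ∧
      ∀ x ∈ V, ∀ (i : Fin 3) (v : TangentSpace 𝓘(ℝ, E3) x),
        w.conn (X i) x v - w.form x v • X i x =
          κ x • (w.metric.inner x v (X (i + 1) x) • X (i + 2) x
            - w.metric.inner x v (X (i + 2) x) • X (i + 1) x)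

end WeylStructure

end Weyl

/-! ### Spinor-vortex spaces -/

/-- `∂f/∂z` for a (real-differentiable) function on an open subset of `ℂ`. -/
def dz (f : ℂ → ℂ) (z : ℂ) : ℂ :=
  (fderiv ℝ f z 1 - Complex.I * fderiv ℝ f z Complex.I) / 2

/-- `∂f/∂z̄`. -/
def dzbar (f : ℂ → ℂ) (z : ℂ) : ℂ :=
  (fderiv ℝ f z 1 + Complex.I * fderiv ℝ f z Complex.I) / 2

section SpinorVortex

variable (ι : Type*) (N : Type*) [TopologicalSpace N] [ChartedSpace ℂ N]

/-- A spinor-vortex space `(N, W)`: a complex line bundle `W` over a Riemann surface `N` with a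
Hermitian metric on `W⁻¹ ⊗ TN`, a holomorphic structure `∂̄` on `W`, a section `C` of
`W⁻² ⊗ TN` and a section `ψ` of `W⁻¹`.

The bundle is given by gauges indexed by `ι`. The gauge `i` consists of a holomorphic coordinate
`z = chart i` and a smooth frame `e i` of `W` over its domain, normalized so that
`(e i)⁻¹ ⊗ ∂_z` has length one. The frames are related by `e i = trans i j • e j`.
In the gauge `i`, as functions of `z`,
`∂̄ (e i) = a i • dz̄ ⊗ e i`, `C (e i, e i) = C i • ∂_z` and `ψ (e i) = ψ i`. -/
structure SpinorVortexSpace where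
  chart : ι → OpenPartialHomeomorph N ℂ
  chart_mem : ∀ i, chart i ∈ IsManifold.maximalAtlas 𝓘(ℂ) ω N
  cover : ∀ p : N, ∃ i, p ∈ (chart i).source
  trans : ι → ι → N → ℂ
  a : ι → ℂ → ℂ
  C : ι → ℂ → ℂ
  ψ : ι → ℂ → ℂ
  trans_smooth : ∀ i j, ContDiffOn ℝ ∞ (fun z ↦ trans i j ((chart i).symm z))
    ((chart i).target ∩ (chart i).symm ⁻¹' (chart j).source)
  a_smooth : ∀ i, ContDiffOn ℝ ∞ (a i) (chart i).target
  C_smooth : ∀ i, ContDiffOn ℝ ∞ (C i) (chart i).target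
  ψ_smooth : ∀ i, ContDiffOn ℝ ∞ (ψ i) (chart i).target
  trans_mul : ∀ i j k, ∀ p ∈ (chart i).source ∩ (chart j).source ∩ (chart k).source,
    trans i k p = trans i j p * trans j k p
  trans_norm : ∀ i j, ∀ p ∈ (chart i).source ∩ (chart j).source,
    ‖trans i j p‖ = ‖deriv (fun z ↦ chart j ((chart i).symm z)) (chart i p)‖
  a_trans : ∀ i j, ∀ p ∈ (chart i).source ∩ (chart j).source,
    a i (chart i p) * trans i j p =
      dzbar (fun z ↦ trans i j ((chart i).symm z)) (chart i p)
        + trans i j p * a j (chart j p) *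
          (starRingEnd ℂ) (deriv (fun z ↦ chart j ((chart i).symm z)) (chart i p))
  C_trans : ∀ i j, ∀ p ∈ (chart i).source ∩ (chart j).source,
    C i (chart i p) * deriv (fun z ↦ chart j ((chart i).symm z)) (chart i p) =
      trans i j p ^ 2 * C j (chart j p)
  ψ_trans : ∀ i j, ∀ p ∈ (chart i).source ∩ (chart j).source,
    ψ i (chart i p) = trans i j p * ψ j (chart j p)
  /-- `∂̄ C = 0`. -/
  dbar_C : ∀ i, ∀ z ∈ (chart i).target, dzbar (C i) z - 2 * a i z * C i z = 0
  /-- `∂̄ ψ = -3 C ψ̄`. -/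
  dbar_ψ : ∀ i, ∀ z ∈ (chart i).target,
    dzbar (ψ i) z - a i z * ψ i z = -3 * C i z * (starRingEnd ℂ) (ψ i z)
  /-- `s = ψ ψ̄ - 2 C C̄`, where `s` is the normalized scalar curvature of the Chern connection of
  `W⁻¹ ⊗ TN`. In the unit frame `(e i)⁻¹ ⊗ ∂_z` this connection is `-a dz̄ + ā dz`, with curvature
  `-i s dx ∧ dy`, so that `s = -2 (a_z + ā_z̄)` relative to the metric `dz dz̄`, whose contravariant
  form is `4 ∂_z ∂_z̄`; this is the source of the factor 4. -/
  curvature_eq : ∀ i, ∀ z ∈ (chart i).target,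
    -2 * (dz (a i) z + dzbar (fun u ↦ (starRingEnd ℂ) (a i u)) z) =
      4 * (ψ i z * (starRingEnd ℂ) (ψ i z) - 2 * (C i z * (starRingEnd ℂ) (C i z)))

namespace SpinorVortexSpace

variable {ι N} (S : SpinorVortexSpace ι N)

/-- `S` is (locally) a trivial spinor-vortex space: `C = ψ = 0`, and near each point there is a
holomorphic isometry `W ≅ TN`; it sends the frame `u • e i` to `∂_z`, where `|u| = 1` and
`∂̄ (u • e i) = 0`. -/
def IsTrivial : Prop :=
  ∀ i, ∀ z₀ ∈ (S.chart i).target, S.C i z₀ = 0 ∧ S.ψ i z₀ = 0 ∧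
    ∃ U : Set ℂ, IsOpen U ∧ z₀ ∈ U ∧ U ⊆ (S.chart i).target ∧
      ∃ u : ℂ → ℂ, ContDiffOn ℝ ∞ u U ∧ ∀ z ∈ U, ‖u z‖ = 1 ∧ dzbar u z + u z * S.a i z = 0

/-- `S` is a spherical spinor-vortex space: `C = 0`, so that `ψ` is a holomorphic section of `W⁻¹`;
it is nonvanishing, and so trivializes `W`, on a dense open set, and there the metric `|ψ|² dz dz̄`
has constant Gaussian curvature `4`, that is `-Δ log |ψ| = 4 |ψ|²`. -/
def IsSpherical : Prop :=
  (∀ i, ∀ z ∈ (S.chart i).target, S.C i z = 0 ∧ dzbar (S.ψ i) z - S.a i z * S.ψ i z = 0) ∧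
    Dense {p : N | ∀ i, p ∈ (S.chart i).source → S.ψ i (S.chart i p) ≠ 0} ∧
    ∀ i, ∀ z ∈ (S.chart i).target, S.ψ i z ≠ 0 →
      -(Laplacian.laplacian (fun u ↦ Real.log ‖S.ψ i u‖) z) = 4 * ‖S.ψ i z‖ ^ 2

end SpinorVortexSpace

end SpinorVortex

/-! ### Generalized symmetries -/

/-- The complex coordinate `z = x + i y` of a point `(x, y, t)`. -/
def zOf (y : E3) : ℂ := ⟨y 0, y 1⟩

/-- `∂f/∂t` on (an open subset of) `ℝ³` with coordinates `(x, y, t)`. -/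
def dt3 (f : E3 → ℂ) (y : E3) : ℂ := fderiv ℝ f y (EuclideanSpace.single 2 1)

/-- `∂f/∂z` on `ℝ³`, where `z = x + i y`. -/
def dz3 (f : E3 → ℂ) (y : E3) : ℂ :=
  (fderiv ℝ f y (EuclideanSpace.single 0 1)
    - Complex.I * fderiv ℝ f y (EuclideanSpace.single 1 1)) / 2

/-- `∂f/∂z̄` on `ℝ³`. -/
def dzbar3 (f : E3 → ℂ) (y : E3) : ℂ :=
  (fderiv ℝ f y (EuclideanSpace.single 0 1)
    + Complex.I * fderiv ℝ f y (EuclideanSpace.single 1 1)) / 2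

/-- The complex conjugate of a function. -/
def conjFun (f : E3 → ℂ) : E3 → ℂ := fun y ↦ (starRingEnd ℂ) (f y)

section Reduction

variable {ι N : Type*} [TopologicalSpace N] [ChartedSpace ℂ N]

/-- The generalized Hitchin equations
`F^A - [Φ, Φ̄] = ψ ∧ Φ̄ + ψ̄ ∧ Φ`, `∂̄^{a,A} Φ = C Φ̄`
on a spinor-vortex space, in the gauge `i`, for the gauge algebra of vector fields on a 1-manifold
with coordinate `t`. The connection is `d - (α dz + ᾱ dz̄) ∂_t`, the Higgs field is `Φ ∂_t`, both
are given on an open set `Ω` of points `(x, y, t)`, and the equations are the `∂_t` components of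
`[∂_z - α ∂_t, ∂_z̄ - ᾱ ∂_t] - [Φ ∂_t, Φ̄ ∂_t] = (ψ Φ̄ - ψ̄ Φ) ∂_t` and
`[∂_z̄ - ᾱ ∂_t, Φ ∂_t] - a Φ ∂_t = C Φ̄ ∂_t`. -/
def IsHitchinField (S : SpinorVortexSpace ι N) (i : ι) (Φ α : E3 → ℂ) (Ω : Set E3) : Prop :=
  ContDiffOn ℝ ∞ Φ Ω ∧ ContDiffOn ℝ ∞ α Ω ∧
    ∀ y ∈ Ω,
      (dzbar3 α y - dz3 (conjFun α) y + α y * dt3 (conjFun α) y - conjFun α y * dt3 α y)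
          - (Φ y * dt3 (conjFun Φ) y - conjFun Φ y * dt3 Φ y) =
        S.ψ i (zOf y) * conjFun Φ y - (starRingEnd ℂ) (S.ψ i (zOf y)) * Φ y ∧
      dzbar3 Φ y - (conjFun α y * dt3 Φ y - Φ y * dt3 (conjFun α) y) - S.a i (zOf y) * Φ y =
        S.C i (zOf y) * conjFun Φ y

/-- The vertical 1-form `θ = dt + α dz + ᾱ dz̄` at `y`. -/
def thetaForm (α : E3 → ℂ) (y v : E3) : ℝ := v 2 + 2 * (α y * zOf v).re

/-- The quadratic form of the metric
`4 Φ Φ̄ dz dz̄ + (dt + α dz + ᾱ dz̄)²`. -/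
def hitchinMetric (Φ α : E3 → ℂ) (y v : E3) : ℝ :=
  4 * ‖Φ y‖ ^ 2 * ‖zOf v‖ ^ 2 + thetaForm α y v ^ 2

/-- The Weyl 1-form
`(α̇ - 2 C̄ Φ / Φ̄) dz + (ᾱ̇ - 2 C Φ̄ / Φ) dz̄ - ½ ((ψ + Φ̇)/Φ + (ψ̄ + Φ̄̇)/Φ̄) (dt + α dz + ᾱ dz̄)`
in the gauge of `hitchinMetric`, where the dot is `∂_t`. -/
def hitchinForm (S : SpinorVortexSpace ι N) (i : ι) (Φ α : E3 → ℂ) (y v : E3) : ℝ :=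
  2 * ((dt3 α y - 2 * (starRingEnd ℂ) (S.C i (zOf y)) * Φ y / conjFun Φ y) * zOf v).re
    - ((S.ψ i (zOf y) + dt3 Φ y) / Φ y).re * thetaForm α y v

variable {B : Type*} [TopologicalSpace B] [ChartedSpace E3 B] [IsManifold 𝓘(ℝ, E3) ∞ B]

/-- The differential at `x` of a chart of `B`, as a map from `T_x B` to `ℝ³`. -/
def chartDeriv (φ : OpenPartialHomeomorph B E3) (x : B) (v : TangentSpace 𝓘(ℝ, E3) x) : E3 :=
  mfderiv 𝓘(ℝ, E3) 𝓘(ℝ, E3) φ x v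

/-- A generalized symmetry (generalized dimensional reduction with one-dimensional fibres) of a
Weyl 3-manifold `B` over a spinor-vortex space `N`: a projection of `B` onto `N` for which `B` with
its Weyl structure is constructed from a generalized Hitchin field on `N` with values in the vector
fields on a 1-manifold.

Around each point there are coordinates `(z, t)` such that the projection is `(z, t) ↦ z`, with `z`
the coordinate of a gauge of `N`, and a solution `(Φ, α)` of the generalized Hitchin equations with
`Φ ≠ 0` such that the Weyl structure of `B` is the one given by `hitchinMetric` and `hitchinForm`,
up to a change of gauge `(g, ω) ↦ (e^{2f} g, ω - df)`. The local Higgs fields agree on overlaps: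
`Φ ∂_t` is a global section of `W⁻¹` with values in vertical vector fields. (The connections agree
automatically, since the kernel of `dt + α dz + ᾱ dz̄` is orthogonal to the fibres.) -/
structure GeneralizedSymmetry (K : Type*) (w : WeylStructure B) (S : SpinorVortexSpace ι N) where
  proj : B → N
  proj_surjective : Function.Surjective proj
  gauge : K → ι
  chart : K → OpenPartialHomeomorph B E3
  chart_mem : ∀ k, chart k ∈ IsManifold.maximalAtlas 𝓘(ℝ, E3) ∞ B
  cover : ∀ x : B, ∃ k, x ∈ (chart k).source
  proj_mem : ∀ k, ∀ x ∈ (chart k).source, proj x ∈ (S.chart (gauge k)).source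
  proj_eq : ∀ k, ∀ x ∈ (chart k).source, S.chart (gauge k) (proj x) = zOf (chart k x)
  Φ : K → E3 → ℂ
  α : K → E3 → ℂ
  hitchin : ∀ k, IsHitchinField S (gauge k) (Φ k) (α k) (chart k).target
  Φ_ne_zero : ∀ k, ∀ y ∈ (chart k).target, Φ k y ≠ 0
  /-- `Φ_k ∂_{t_k} = trans • Φ_l ∂_{t_l}`, evaluated on vertical vectors `v`, for which
  `v = dt_k(v) ∂_{t_k} = dt_l(v) ∂_{t_l}`. -/
  Φ_trans : ∀ k l, ∀ x ∈ (chart k).source ∩ (chart l).source,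
    ∀ v : TangentSpace 𝓘(ℝ, E3) x, zOf (chartDeriv (chart k) x v) = 0 →
      Φ k (chart k x) * (chartDeriv (chart l) x v 2 : ℝ) =
        S.trans (gauge k) (gauge l) (proj x) * Φ l (chart l x) *
          (chartDeriv (chart k) x v 2 : ℝ)
  scale : K → B → ℝ
  scale_smooth : ∀ k, ContMDiffOn 𝓘(ℝ, E3) 𝓘(ℝ) ∞ (scale k) (chart k).source
  metric_eq : ∀ k, ∀ x ∈ (chart k).source, ∀ v : TangentSpace 𝓘(ℝ, E3) x,
    w.metric.inner x v v = Real.exp (2 * scale k x) *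
      hitchinMetric (Φ k) (α k) (chart k x) (chartDeriv (chart k) x v)
  form_eq : ∀ k, ∀ x ∈ (chart k).source, ∀ v : TangentSpace 𝓘(ℝ, E3) x,
    w.form x v =
      hitchinForm S (gauge k) (Φ k) (α k) (chart k x) (chartDeriv (chart k) x v)
        - deriv1 (scale k) x v

/-- The generalized symmetry is geodesic: the fibres of the projection are (unparametrized)
geodesics of the Weyl connection, that is `D_V V` is a multiple of `V` for every locally defined
vector field `V` tangent to the fibres. -/
def GeneralizedSymmetry.IsGeodesic {K : Type*} {w : WeylStructure B}
    {S : SpinorVortexSpace ι N} (R : GeneralizedSymmetry K w S) : Prop :=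
  ∀ (U : Set B) (V : ∀ x : B, TangentSpace 𝓘(ℝ, E3) x), IsOpen U →
    SmoothFieldOn V U →
    (∀ x ∈ U, mfderiv 𝓘(ℝ, E3) 𝓘(ℝ, ℂ) R.proj x (V x) = 0) →
    ∀ x ∈ U, ∃ c : ℝ, w.conn V x (V x) = c • V x

end Reduction

end EinsteinWeyl

end

set_option maxSynthPendingDepth 3
open scoped Manifold ContDiff Topology

noncomputable section

namespace EinsteinWeyl

section

/-! ### Flat linear systems -/

section FlatSystem

open Set Metric

variable {E F : Type*} [NormedAddCommGroup E] [NormedSpace ℝ E]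
  [NormedAddCommGroup F] [NormedSpace ℝ F]

/-! The geodesic condition kills `C`. In a chart let `V = ∂_t` and let `H` be a constant combination
of `∂_x` and `∂_y`. These fields commute, so torsion-freeness and `D g = -2 ω ⊗ g` express the inner
products of `D_V V` with `H` and with `V` through `ω` and derivatives of `g`. If `D_V V` is a
multiple of `V`, everything cancels except the real part of `(C̄ Φ / Φ̄) dz(H)`, which therefore
vanishes for every `H` (`IsGeodesic.re_eq_zero`, `IsGeodesic.cVanishes`).

When `C = 0`, the equations `∂̄ψ = a ψ` and `s = |ψ|²` make a metric connection on the Euclidean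
bundle `W⁻¹TN ⊕ ℝ` of rank 3 flat (`connForm`, `CVanishes.isFlatAt`), so parallel orthonormal
triples exist locally (`exists_parallel`). The rescaled coframe `(2Φ dz, θ)` identifies `TB`
isometrically with the pullback of this bundle, and the Hitchin equations become structure equations
for it (`coframe_structure`). Parallel triples thus lift to orthonormal frames of `B` with `[X_i,
X_{i+1}] = ω(X_i) X_{i+1} - ω(X_{i+1}) X_i - 2κ X_{i+2}`, and a Koszul argument turns these brackets
into the hyperCR equation (`koszul_frame`).

To globalize, the agreement of the Higgs fields on overlaps makes the coframes of two charts differ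
only by the change of gauge and a locally constant sign (`exists_cof_change`). Inner products of
parallel sections are locally constant, so two lifted frames differ by a locally constant matrix in
`O(3)`. On a simply connected open set such a cocycle is a coboundary
(`exists_locallyConstant_splitting`), and the local frames can be corrected to a single one.

For the dichotomy, `ψ` divided by the `W⁻¹TN` component of a parallel section is holomorphic, so on
the connected surface `N` either `ψ` vanishes identically or its zeros are isolated. In the first
case parallel sections of `W⁻¹TN` give the local isometry `W ≅ TN`. In the second the curvature
equation is the Gauss equation of `|ψ|² dz dz̄`. -/

theorem gronwallBound_half_le {δ ε t : ℝ} (hδ : 0 ≤ δ) (hε : 0 ≤ ε) (ht : t ∈ Icc (0 : ℝ) 1) :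
    gronwallBound δ (1 / 2) ε (t - 0) ≤ 2 * δ + 2 * ε := by
  have hexp : Real.exp (1 / 2 * (t - 0)) ≤ 2 := by
    have h1 : Real.exp (1 / 2 * (t - 0)) ≤ Real.exp (1 / 2) := by
      apply Real.exp_le_exp.2; linarith [ht.2]
    have h2 : Real.exp (1 / 2) ^ 2 ≤ 2 ^ 2 := by
      rw [← Real.exp_nat_mul]
      norm_num
      linarith [Real.exp_one_lt_d9]
    exact h1.trans (abs_le_of_sq_le_sq' h2 (by norm_num)).2
  rw [gronwallBound_of_K_ne_0 (by norm_num)]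
  have h3 : ε / (1 / 2) = 2 * ε := by ring
  rw [h3]
  nlinarith

/-- Gronwall's inequality at rate `1/2` on the unit interval; the constants come from `e^{1/2} ≤ 2`.
-/
theorem norm_le_of_norm_deriv_le {y y' : ℝ → F} {δ ε : ℝ} (hε : 0 ≤ ε)
    (hy : ∀ t ∈ Icc (0 : ℝ) 1, HasDerivWithinAt y (y' t) (Icc 0 1) t) (h0 : ‖y 0‖ ≤ δ)
    (hb : ∀ t ∈ Icc (0 : ℝ) 1, ‖y' t‖ ≤ 1 / 2 * ‖y t‖ + ε) {t : ℝ} (ht : t ∈ Icc (0 : ℝ) 1) :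
    ‖y t‖ ≤ 2 * δ + 2 * ε := by
  refine (norm_le_gronwallBound_of_norm_deriv_right_le
    (fun t ht ↦ (hy t ht).continuousWithinAt) (fun t ht ↦ ?_) h0
    (fun t ht ↦ hb t (Ico_subset_Icc_self ht)) t ht).trans
    (gronwallBound_half_le ((norm_nonneg _).trans h0) hε ht)
  exact (hy t (Ico_subset_Icc_self ht)).mono_of_mem_nhdsWithin (Icc_mem_nhdsGE_of_mem ht)

theorem exists_linear_ode_solution [CompleteSpace F] {B : ℝ → F →L[ℝ] F}
    (hB : ContinuousOn B (Icc 0 1)) (hB' : ∀ t ∈ Icc (0 : ℝ) 1, ‖B t‖ ≤ 1 / 2) (y₀ : F) :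
    ∃ y : ℝ → F, y 0 = y₀ ∧
      ∀ t ∈ Icc (0 : ℝ) 1, HasDerivWithinAt y (B t (y t)) (Icc 0 1) t := by
  -- On the ball of radius `‖y₀‖ + 1` about `y₀` the field has norm at most `(2‖y₀‖ + 1)/2 ≤ ‖y₀‖ +
  -- 1`, so the solution cannot leave the ball before time `1`.
  have h : IsPicardLindelof (fun t y ↦ B t y) (⟨0, by simp⟩ : Icc (0 : ℝ) 1) y₀
      (‖y₀‖₊ + 1) 0 (‖y₀‖₊ + 1) 1 := by
    refine ⟨fun t ht ↦ ?_, fun x _ ↦ hB.clm_apply continuousOn_const, fun t ht x hx ↦ ?_, ?_⟩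
    · refine ((B t).lipschitz.weaken ?_).lipschitzOnWith
      rw [← NNReal.coe_le_coe]
      exact (hB' t ht).trans (by norm_num)
    · have h1 := (B t).le_of_opNorm_le (hB' t ht) x
      have h2 : ‖x‖ ≤ ‖y₀‖ + (‖y₀‖ + 1) := by
        have := mem_closedBall_iff_norm.1 hx
        simp only [NNReal.coe_add, coe_nnnorm, NNReal.coe_one] at this
        linarith [norm_le_norm_add_norm_sub' x y₀]
      simp only [NNReal.coe_add, coe_nnnorm, NNReal.coe_one]
      linarith
    · simp
  exact h.exists_eq_forall_mem_Icc_hasDerivWithinAt₀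

/-- The bounds on a coefficient `A` of a linear system that are used to solve it on a ball. -/
structure BoundsOn (A : E → E →L[ℝ] F →L[ℝ] F) (z₀ : E) (r K : ℝ) : Prop where
  r_pos : 0 < r
  diff : ∀ p ∈ ball z₀ r, DifferentiableAt ℝ A p
  norm_le : ∀ p ∈ ball z₀ r, ‖A p‖ ≤ K
  norm_fderiv_le : ∀ p ∈ ball z₀ r, ‖fderiv ℝ A p‖ ≤ K
  lipschitz : ∀ p ∈ ball z₀ r, ∀ q ∈ ball z₀ r, ‖fderiv ℝ A p - fderiv ℝ A q‖ ≤ K * ‖p - q‖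
  mul_le : K * r ≤ 1 / 2

theorem BoundsOn.nonneg {A : E → E →L[ℝ] F →L[ℝ] F} {z₀ : E} {r K : ℝ} (h : BoundsOn A z₀ r K) :
    0 ≤ K :=
  (norm_nonneg _).trans (h.norm_le z₀ (mem_ball_self h.r_pos))

theorem exists_boundsOn {A : E → E →L[ℝ] F →L[ℝ] F} {z₀ : E} {O : Set E} (hO : IsOpen O)
    (hz₀ : z₀ ∈ O) (hA : ContDiffOn ℝ 2 A O) :
    ∃ r K, ball z₀ r ⊆ O ∧ BoundsOn A z₀ r K := by
  have hA0 : ContDiffAt ℝ 2 A z₀ := hA.contDiffAt (hO.mem_nhds hz₀)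
  have hA1 : ContDiffAt ℝ 1 (fderiv ℝ A) z₀ := hA0.fderiv_right (by norm_num)
  obtain ⟨L, t, ht, hL⟩ := hA1.exists_lipschitzOnWith
  have e1 : ∀ᶠ p in 𝓝 z₀, ‖A p‖ < ‖A z₀‖ + 1 :=
    hA0.continuousAt.norm.eventually_lt_const (lt_add_one _)
  have e2 : ∀ᶠ p in 𝓝 z₀, ‖fderiv ℝ A p‖ < ‖fderiv ℝ A z₀‖ + 1 :=
    hA1.continuousAt.norm.eventually_lt_const (lt_add_one _)
  obtain ⟨r, hr, hball⟩ := Metric.eventually_nhds_iff_ball.1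
    (e1.and (e2.and ((Filter.eventually_mem_set.2 ht).and
      (Filter.eventually_mem_set.2 (hO.mem_nhds hz₀)))))
  set K : ℝ := max (max (‖A z₀‖ + 1) (‖fderiv ℝ A z₀‖ + 1)) L with hK
  have hK1 : ‖A z₀‖ + 1 ≤ K := (le_max_left _ _).trans (le_max_left _ _)
  have hKpos : 0 < K := lt_of_lt_of_le (by positivity) hK1
  have hsub : ball z₀ (min r (1 / (2 * K))) ⊆ ball z₀ r := ball_subset_ball (min_le_left _ _)
  -- Radius at most `1/(2K)` bounds the coefficient of every radial ODE by `1/2`, as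
  -- `exists_linear_ode_solution` and the Gronwall estimates require.
  refine ⟨min r (1 / (2 * K)), K, fun p hp ↦ (hball p (hsub hp)).2.2.2, ?_⟩
  refine ⟨lt_min hr (by positivity), fun p hp ↦ ?_, fun p hp ↦ ?_, fun p hp ↦ ?_,
    fun p hp q hq ↦ ?_, ?_⟩
  · exact (hA.contDiffAt (hO.mem_nhds (hball p (hsub hp)).2.2.2)).differentiableAt (by norm_num)
  · exact (hball p (hsub hp)).1.le.trans hK1
  · exact (hball p (hsub hp)).2.1.le.trans ((le_max_right _ _).trans (le_max_left _ _))
  · have := hL.norm_sub_le (hball p (hsub hp)).2.2.1 (hball q (hsub hq)).2.2.1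
    exact this.trans (by gcongr; exact le_max_right _ _)
  · calc K * min r (1 / (2 * K)) ≤ K * (1 / (2 * K)) := by gcongr; exact min_le_right _ _
      _ = 1 / 2 := by field_simp

variable {A : E → E →L[ℝ] F →L[ℝ] F} {z₀ : E} {r K : ℝ}

theorem add_smul_mem_ball {h : E} (hh : ‖h‖ < r) {t : ℝ} (ht : t ∈ Icc (0 : ℝ) 1) :
    z₀ + t • h ∈ ball z₀ r := by
  rw [mem_ball_iff_norm, add_sub_cancel_left, norm_smul, Real.norm_of_nonneg ht.1]
  nlinarith [ht.2, norm_nonneg h]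

theorem BoundsOn.norm_radial_le (b : BoundsOn A z₀ r K) {h : E} (hh : ‖h‖ < r) {t : ℝ}
    (ht : t ∈ Icc (0 : ℝ) 1) : ‖A (z₀ + t • h) h‖ ≤ 1 / 2 := by
  refine ((A (z₀ + t • h)).le_of_opNorm_le (b.norm_le _ (add_smul_mem_ball hh ht)) h).trans ?_
  exact (mul_le_mul_of_nonneg_left hh.le b.nonneg).trans b.mul_le

theorem hasDerivAt_radial (z₀ h : E) (t : ℝ) : HasDerivAt (fun t : ℝ ↦ z₀ + t • h) h t := by
  simpa using! ((hasDerivAt_id t).smul_const h).const_add z₀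

theorem BoundsOn.hasDerivAt_coeff (b : BoundsOn A z₀ r K) {h : E} (hh : ‖h‖ < r) {t : ℝ}
    (ht : t ∈ Icc (0 : ℝ) 1) :
    HasDerivAt (fun t : ℝ ↦ A (z₀ + t • h)) (fderiv ℝ A (z₀ + t • h) h) t :=
  (b.diff _ (add_smul_mem_ball hh ht)).hasFDerivAt.comp_hasDerivAt t (hasDerivAt_radial z₀ h t)

theorem BoundsOn.continuousOn_radial (b : BoundsOn A z₀ r K) {h : E} (hh : ‖h‖ < r) :
    ContinuousOn (fun t : ℝ ↦ A (z₀ + t • h) h) (Icc 0 1) := fun _ ht ↦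
  ((b.hasDerivAt_coeff hh ht).continuousAt.clm_apply continuousAt_const).continuousWithinAt

/-- `y` solves the restriction of the linear system `A` to the segment from `z₀` to `z₀ + h`. -/
def IsRadialSolution (A : E → E →L[ℝ] F →L[ℝ] F) (z₀ h : E) (y : ℝ → F) : Prop :=
  ∀ t ∈ Icc (0 : ℝ) 1, HasDerivWithinAt y (A (z₀ + t • h) h (y t)) (Icc 0 1) t

theorem BoundsOn.norm_solution_le (b : BoundsOn A z₀ r K) {h : E} (hh : ‖h‖ < r) {y : ℝ → F}
    (hy : IsRadialSolution A z₀ h y) {t : ℝ} (ht : t ∈ Icc (0 : ℝ) 1) : ‖y t‖ ≤ 2 * ‖y 0‖ := by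
  have := norm_le_of_norm_deriv_le le_rfl hy le_rfl (fun t ht ↦ ?_) ht
  · linarith
  · simpa using! (A (z₀ + t • h) h).le_of_opNorm_le (b.norm_radial_le hh ht) (y t)

theorem BoundsOn.solution_unique (b : BoundsOn A z₀ r K) {h : E} (hh : ‖h‖ < r) {y y' : ℝ → F}
    (hy : IsRadialSolution A z₀ h y) (hy' : IsRadialSolution A z₀ h y') (h0 : y 0 = y' 0)
    {t : ℝ} (ht : t ∈ Icc (0 : ℝ) 1) : y t = y' t := by
  have hd : IsRadialSolution A z₀ h (fun t ↦ y t - y' t) := fun t ht ↦ by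
    simpa using! (hy t ht).sub (hy' t ht)
  have := b.norm_solution_le hh hd ht
  rw [h0] at this
  exact sub_eq_zero.1 (norm_le_zero_iff.1 (by simpa using this))

/-- Solutions along nearby segments are close. -/
theorem BoundsOn.norm_sub_solution_le (b : BoundsOn A z₀ r K) {h k : E} (hh : ‖h‖ < r)
    (hk : ‖h + k‖ < r) {y y' : ℝ → F} (hy : IsRadialSolution A z₀ h y)
    (hy' : IsRadialSolution A z₀ (h + k) y') (h0 : y' 0 = y 0) {t : ℝ} (ht : t ∈ Icc (0 : ℝ) 1) :
    ‖y' t - y t‖ ≤ 4 * (K * r + K) * ‖y 0‖ * ‖k‖ := by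
  have hK := b.nonneg
  have hr := b.r_pos
  have key := norm_le_of_norm_deriv_le (y := fun t ↦ y' t - y t) (δ := 0)
    (ε := 2 * (K * r + K) * ‖y 0‖ * ‖k‖) (by positivity)
    (fun t ht ↦ (hy' t ht).sub (hy t ht)) (by simp [h0]) (fun t ht ↦ ?_) ht
  · linarith
  have hp := add_smul_mem_ball (z₀ := z₀) hh ht
  have hp' := add_smul_mem_ball (z₀ := z₀) hk ht
  set p := z₀ + t • h
  set p' := z₀ + t • (h + k) with hp'_def
  have hpp : p' - p = t • k := by simp [p, p', smul_add]
  have hnpp : ‖p' - p‖ ≤ ‖k‖ := by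
    rw [hpp, norm_smul, Real.norm_of_nonneg ht.1]
    nlinarith [ht.2, norm_nonneg k]
  have e : A p' (h + k) (y' t) - A p h (y t) =
      A p h (y' t - y t) + ((A p' - A p) (h + k) (y' t) + A p k (y' t)) := by
    simp only [map_sub, map_add, add_apply, sub_apply]
    abel
  have h1 : ‖A p h (y' t - y t)‖ ≤ 1 / 2 * ‖y' t - y t‖ :=
    (A p h).le_of_opNorm_le (b.norm_radial_le hh ht) _
  have hy't : ‖y' t‖ ≤ 2 * ‖y 0‖ := h0 ▸ b.norm_solution_le hk hy' ht
  have hAA : ‖A p' - A p‖ ≤ K * ‖k‖ :=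
    ((convex_ball z₀ r).norm_image_sub_le_of_norm_fderiv_le b.diff b.norm_fderiv_le hp hp').trans
      (by gcongr)
  have h2 : ‖(A p' - A p) (h + k) (y' t)‖ ≤ K * ‖k‖ * r * (2 * ‖y 0‖) := by
    refine (ContinuousLinearMap.le_opNorm₂ _ _ _).trans ?_
    gcongr
  have h3 : ‖A p k (y' t)‖ ≤ K * ‖k‖ * (2 * ‖y 0‖) := by
    refine (ContinuousLinearMap.le_opNorm₂ _ _ _).trans ?_
    gcongr
    exact b.norm_le p hp
  rw [e]
  refine (norm_add_le _ _).trans (add_le_add h1 ((norm_add_le _ _).trans ?_))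
  linarith

/-- Flatness of the linear system `ds = A s`. -/
def IsFlatAt (A : E → E →L[ℝ] F →L[ℝ] F) (p : E) : Prop :=
  ∀ (u v : E) (y : F), fderiv ℝ A p u v y + A p v (A p u y) = fderiv ℝ A p v u y + A p u (A p v y)

/-- This makes radial transport differentiable with the right derivative at the endpoint. The
candidate variation of `y` in the direction `k` is `t • A(z₀ + t h) k y`. Flatness makes it solve
the linearized radial equation up to terms quadratic in `k`, and Gronwall carries this to `t = 1`.
-/
theorem BoundsOn.norm_sub_sub_le (b : BoundsOn A z₀ r K) (hflat : ∀ p ∈ ball z₀ r, IsFlatAt A p)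
    {h k : E} (hh : ‖h‖ < r) (hk : ‖h + k‖ < r) {y y' : ℝ → F} (hy : IsRadialSolution A z₀ h y)
    (hy' : IsRadialSolution A z₀ (h + k) y') (h0 : y' 0 = y 0) :
    ‖y' 1 - y 1 - A (z₀ + h) k (y 1)‖ ≤
      (4 * K * (r + 1) + 8 * (K * r + K) ^ 2) * ‖y 0‖ * ‖k‖ ^ 2 := by
  have hK := b.nonneg
  have hr := b.r_pos
  have hW : ∀ t ∈ Icc (0 : ℝ) 1, HasDerivWithinAt
      (fun t ↦ y' t - y t - t • A (z₀ + t • h) k (y t))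
      (A (z₀ + t • (h + k)) (h + k) (y' t) - A (z₀ + t • h) h (y t)
        - (t • (fderiv ℝ A (z₀ + t • h) h k (y t) + A (z₀ + t • h) k (A (z₀ + t • h) h (y t)))
          + A (z₀ + t • h) k (y t))) (Icc 0 1) t := by
    intro t ht
    have hA := (b.hasDerivAt_coeff hh ht).hasDerivWithinAt (s := Icc 0 1)
    have h1 := (hA.clm_apply (hasDerivWithinAt_const t _ k)).clm_apply (hy t ht)
    have h2 := (hasDerivWithinAt_id t (Icc (0 : ℝ) 1)).smul h1
    refine (((hy' t ht).sub (hy t ht)).sub h2).congr_deriv ?_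
    simp
  have key := norm_le_of_norm_deriv_le (δ := 0)
    (ε := (2 * K * (r + 1) + 4 * (K * r + K) ^ 2) * ‖y 0‖ * ‖k‖ ^ 2) (by positivity)
    hW (by simp [h0]) (fun t ht ↦ ?_) (t := 1) (by simp)
  · simp only [one_smul] at key
    linarith
  have hp := add_smul_mem_ball (z₀ := z₀) hh ht
  have hp' := add_smul_mem_ball (z₀ := z₀) hk ht
  have hfl := hflat _ hp h k (y t)
  have hsub := b.norm_sub_solution_le hh hk hy hy' h0 ht
  have hrad := b.norm_radial_le hh ht
  set p := z₀ + t • h with hp_def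
  set p' := z₀ + t • (h + k) with hp'_def
  have hpp : p' - p = t • k := by simp [p, p', smul_add]
  have hnpp : ‖p' - p‖ ≤ ‖k‖ := by
    rw [hpp, norm_smul, Real.norm_of_nonneg ht.1]
    nlinarith [ht.2, norm_nonneg k]
  have hy't : ‖y' t‖ ≤ 2 * ‖y 0‖ := h0 ▸ b.norm_solution_le hk hy' ht
  set T := A p' - A p - fderiv ℝ A p (t • k) with hT
  -- After flatness exchanges `h` and `k`, the error term itself appears under `A p h`; every other
  -- summand is quadratic in `k`.
  have e : A p' (h + k) (y' t) - A p h (y t)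
        - (t • (fderiv ℝ A p h k (y t) + A p k (A p h (y t))) + A p k (y t)) =
      A p h (y' t - y t - t • A p k (y t)) + (T (h + k) (y' t)
        + (t • fderiv ℝ A p k h (y' t - y t) + (t • fderiv ℝ A p k k (y' t)
          + A p k (y' t - y t)))) := by
    rw [hfl, hT]
    simp only [map_sub, map_add, map_smul, add_apply,
      sub_apply, smul_apply, smul_add, smul_sub]
    abel
  have hd := b.norm_fderiv_le p hp
  have hTn : ‖T‖ ≤ K * ‖k‖ * ‖k‖ := by
    have hseg : segment ℝ p p' ⊆ ball z₀ r := (convex_ball z₀ r).segment_subset hp hp'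
    have := (convex_segment p p').norm_image_sub_le_of_norm_fderiv_le' (f := A)
      (φ := fderiv ℝ A p) (C := K * ‖k‖) (fun x hx ↦ b.diff x (hseg hx)) (fun x hx ↦ ?_)
      (left_mem_segment ℝ p p') (right_mem_segment ℝ p p')
    · rw [hpp] at this
      refine this.trans ?_
      gcongr
      rw [← hpp]; exact hnpp
    · refine (b.lipschitz x (hseg hx) p hp).trans ?_
      gcongr
      exact (norm_sub_le_of_mem_segment hx).trans hnpp
  have ht1 : ‖t‖ ≤ 1 := by rw [Real.norm_of_nonneg ht.1]; exact ht.2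
  have n1 : ‖A p h (y' t - y t - t • A p k (y t))‖ ≤ 1 / 2 * ‖y' t - y t - t • A p k (y t)‖ :=
    (A p h).le_of_opNorm_le hrad _
  have n2 : ‖T (h + k) (y' t)‖ ≤ K * ‖k‖ * ‖k‖ * r * (2 * ‖y 0‖) := by
    refine (ContinuousLinearMap.le_opNorm₂ _ _ _).trans ?_
    gcongr
  have n3 : ‖t • fderiv ℝ A p k h (y' t - y t)‖ ≤
      1 * (K * ‖k‖ * r * (4 * (K * r + K) * ‖y 0‖ * ‖k‖)) := by
    rw [norm_smul]
    gcongr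
    refine (ContinuousLinearMap.le_opNorm₂ _ _ _).trans ?_
    gcongr
    exact (fderiv ℝ A p).le_of_opNorm_le hd k
  have n4 : ‖t • fderiv ℝ A p k k (y' t)‖ ≤ 1 * (K * ‖k‖ * ‖k‖ * (2 * ‖y 0‖)) := by
    rw [norm_smul]
    gcongr
    refine (ContinuousLinearMap.le_opNorm₂ _ _ _).trans ?_
    gcongr
    exact (fderiv ℝ A p).le_of_opNorm_le hd k
  have n5 : ‖A p k (y' t - y t)‖ ≤ K * ‖k‖ * (4 * (K * r + K) * ‖y 0‖ * ‖k‖) := by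
    refine (ContinuousLinearMap.le_opNorm₂ _ _ _).trans ?_
    gcongr
    exact b.norm_le p hp
  rw [e]
  refine (norm_add_le _ _).trans (add_le_add n1 ?_)
  refine (norm_add_le _ _).trans ((add_le_add n2 ((norm_add_le _ _).trans
    (add_le_add n3 ((norm_add_le _ _).trans (add_le_add n4 n5))))).trans (le_of_eq ?_))
  ring

/-- A flat linear system has local solutions with arbitrary initial values. -/
theorem exists_parallel [CompleteSpace F] {O : Set E} (hO : IsOpen O) (hz₀ : z₀ ∈ O)
    (hA : ContDiffOn ℝ 2 A O) (hflat : ∀ p ∈ O, IsFlatAt A p) :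
    ∃ r > 0, ball z₀ r ⊆ O ∧ ∀ s₀ : F, ∃ s : E → F, s z₀ = s₀ ∧
      ∀ z ∈ ball z₀ r, HasFDerivAt s ((A z).flip (s z)) z := by
  obtain ⟨r, K, hsub, b⟩ := exists_boundsOn hO hz₀ hA
  refine ⟨r, b.r_pos, hsub, fun s₀ ↦ ?_⟩
  -- Outside the ball a constant function serves as a default; only its initial value is ever used
  -- there.
  have hex : ∀ h : E, ∃ y : ℝ → F, y 0 = s₀ ∧ (‖h‖ < r → IsRadialSolution A z₀ h y) := by
    intro h
    by_cases hh : ‖h‖ < r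
    · obtain ⟨y, hy0, hy⟩ := exists_linear_ode_solution (b.continuousOn_radial hh)
        (fun t ht ↦ b.norm_radial_le hh ht) s₀
      exact ⟨y, hy0, fun _ ↦ hy⟩
    · exact ⟨fun _ ↦ s₀, rfl, fun h ↦ absurd h hh⟩
  choose y hy0 hy using hex
  refine ⟨fun z ↦ y (z - z₀) 1, ?_, fun z hz ↦ ?_⟩
  · have h0 : ‖(0 : E)‖ < r := by simpa using b.r_pos
    have hconst : IsRadialSolution A z₀ 0 (fun _ ↦ s₀) := fun t _ ↦ by
      simpa using hasDerivWithinAt_const t _ s₀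
    simp only [sub_self]
    exact b.solution_unique h0 (hy 0 h0) hconst (hy0 0) (by simp)
  · have hh : ‖z - z₀‖ < r := mem_ball_iff_norm.1 hz
    rw [hasFDerivAt_iff_isLittleO_nhds_zero]
    set C := (4 * K * (r + 1) + 8 * (K * r + K) ^ 2) * ‖s₀‖ with hC
    have hO : (fun k : E ↦ y (z + k - z₀) 1 - y (z - z₀) 1
        - (A z).flip (y (z - z₀) 1) k) =O[𝓝 0] fun k : E ↦ ‖k‖ ^ 2 := by
      refine Asymptotics.IsBigO.of_bound C ?_
      have hev : ∀ᶠ k : E in 𝓝 0, z + k ∈ ball z₀ r := by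
        have hc : ContinuousAt (fun k : E ↦ z + k) 0 := by fun_prop
        exact hc.eventually_mem (isOpen_ball.mem_nhds (by simpa using hz))
      filter_upwards [hev] with k hk
      have e : z + k - z₀ = z - z₀ + k := by abel
      have hk' : ‖z - z₀ + k‖ < r := by rw [← e]; exact mem_ball_iff_norm.1 hk
      have := b.norm_sub_sub_le (fun p hp ↦ hflat p (hsub hp)) hh hk' (hy _ hh) (hy _ hk')
        ((hy0 _).trans (hy0 _).symm)
      rw [hy0, add_sub_cancel] at this
      rw [e, ContinuousLinearMap.flip_apply, Real.norm_of_nonneg (by positivity)]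
      exact this
    refine hO.trans_isLittleO ?_
    exact Asymptotics.isLittleO_norm_pow_id one_lt_two

/-- Solutions of a smooth linear system are smooth. -/
theorem contDiffOn_of_parallel {O : Set E} (hO : IsOpen O) (hA : ContDiffOn ℝ ∞ A O) {s : E → F}
    (hs : ∀ z ∈ O, HasFDerivAt s ((A z).flip (s z)) z) : ContDiffOn ℝ ∞ s O := by
  -- Bootstrapping: the equation writes the derivative of `s` in terms of `A` and `s`, so each order
  -- of differentiability gives the next.
  have hn : ∀ n : ℕ, ContDiffOn ℝ n s O := by
    intro n
    induction n with
    | zero => exact contDiffOn_zero.2 fun z hz ↦ (hs z hz).continuousAt.continuousWithinAt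
    | succ n ih =>
      push_cast
      rw [contDiffOn_succ_iff_fderiv_of_isOpen hO]
      refine ⟨fun z hz ↦ (hs z hz).differentiableAt.differentiableWithinAt, by simp, ?_⟩
      have hA' : ContDiffOn ℝ n (fun z ↦ (A z).flip) O :=
        (ContinuousLinearMap.flipₗᵢ ℝ E F F).contDiff.comp_contDiffOn
          (hA.of_le (by exact_mod_cast le_top (a := (n : ℕ∞))))
      exact (hA'.clm_apply ih).congr fun z hz ↦ (hs z hz).fderiv
  exact contDiffOn_infty.2 hn

end FlatSystem

end

section

/-! ### Locally constant cocycles on simply connected spaces -/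

section Cocycle

open Set

/-- A locally constant cocycle on a simply connected space is a coboundary. -/
theorem exists_locallyConstant_splitting {A : Type*} [TopologicalSpace A] [SimplyConnectedSpace A]
    [LocallyPathConnectedSpace A] {J G : Type*} [Group G] (U : J → Set A)
    (hU : ∀ j, IsOpen (U j)) (idx : A → J) (hidx : ∀ x, x ∈ U (idx x)) (g : J → J → A → G)
    (g_self : ∀ j, ∀ x ∈ U j, g j j x = 1)
    (g_comp : ∀ i j k, ∀ x ∈ U i ∩ U j ∩ U k, g j k x * g i j x = g i k x)
    (g_loc : ∀ i j, ∀ x ∈ U i ∩ U j, ∀ᶠ y in 𝓝 x, g i j y = g i j x) :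
    ∃ h : J → A → G, (∀ i j, ∀ x ∈ U i ∩ U j, h j x = g i j x * h i x) ∧
      ∀ i, ∀ x ∈ U i, ∀ᶠ y in 𝓝 x, h i y = h i x := by
  -- With the discrete topology on `G`, local constancy of `g` is what makes the left
  -- multiplications continuous coordinate changes, and the resulting bundle is a covering.
  let _ : TopologicalSpace G := ⊥
  have : DiscreteTopology G := ⟨rfl⟩
  let Z : FiberBundleCore J A G :=
    { baseSet := U
      isOpen_baseSet := hU
      indexAt := idx
      mem_baseSet_at := hidx
      coordChange := fun i j x v ↦ g i j x * v
      coordChange_self := fun j x hx v ↦ by rw [g_self j x hx, one_mul]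
      continuousOn_coordChange := fun i j ↦ by
        rintro ⟨x, v⟩ ⟨hx, -⟩
        refine ContinuousAt.continuousWithinAt ?_
        refine continuousAt_const.congr (f := fun _ ↦ g i j x * v) ?_
        have h1 : ∀ᶠ p : A × G in 𝓝 (x, v), g i j p.1 = g i j x :=
          (continuous_fst.tendsto (x, v)).eventually (g_loc i j x hx)
        have h2 : ∀ᶠ p : A × G in 𝓝 (x, v), p.2 = v :=
          (continuous_snd.tendsto (x, v)).eventually (show ∀ᶠ w in 𝓝 v, w = v by simp [nhds_discrete])
        filter_upwards [h1, h2] with p hp1 hp2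
        rw [hp1, hp2]
      coordChange_comp := fun i j k x hx v ↦ by rw [← mul_assoc, g_comp i j k x hx] }
  have hcov : IsCoveringMap (Bundle.TotalSpace.proj : Z.TotalSpace → A) :=
    FiberBundle.isCoveringMap (F := G) (E := Z.Fiber)
  obtain ⟨a₀⟩ : Nonempty A := inferInstance
  -- Simple connectedness lifts the identity to a global section `σ`; its coordinate in the `i`-th
  -- trivialization is `h i`.
  obtain ⟨σ, ⟨-, hσ⟩, -⟩ := hcov.existsUnique_continuousMap_lifts (ContinuousMap.id A) a₀
    (⟨a₀, (1 : G)⟩ : Z.TotalSpace) rfl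
  have hproj : ∀ x, (σ x).1 = x := fun x ↦ congrFun hσ x
  refine ⟨fun i x ↦ (Z.localTriv i (σ x)).2, fun i j x hx ↦ ?_, fun i x hx ↦ ?_⟩
  · simp only [FiberBundleCore.localTriv_apply, hproj]
    exact (congrArg (fun c : G ↦ HMul.hMul (α := G) (β := G) c (σ x).2) (g_comp (idx x) i j x ⟨⟨hidx x, hx.1⟩, hx.2⟩)).symm.trans
      (mul_assoc _ _ _)
  · have hmem : σ x ∈ (Z.localTriv i).source := by
      rw [FiberBundleCore.mem_localTriv_source, hproj]
      exact hx
    have hc : ContinuousAt (fun y ↦ (Z.localTriv i (σ y)).2) x :=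
      continuousAt_snd.comp (((Z.localTriv i).continuousAt hmem).comp σ.continuous.continuousAt)
    exact hc.eventually (show ∀ᶠ w in 𝓝 (Z.localTriv i (σ x)).2, w = (Z.localTriv i (σ x)).2 by
      simp [nhds_discrete])

end Cocycle

end

local notation "conj" => starRingEnd ℂ

section

/-! ### Wirtinger derivatives -/


theorem fderiv_eq_dz_add_dzbar (f : ℂ → ℂ) (z h : ℂ) :
    fderiv ℝ f z h = dz f z * h + dzbar f z * conj h := by
  have hh : h = h.re • (1 : ℂ) + h.im • Complex.I := by
    simp [Complex.re_add_im]
  conv_lhs => rw [hh]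
  rw [map_add, map_smul, map_smul, dz, dzbar]
  set p := fderiv ℝ f z 1
  set q := fderiv ℝ f z Complex.I
  have h1 : conj h = h.re - h.im * Complex.I := by
    apply Complex.ext <;> simp
  have h2 : h = h.re + h.im * Complex.I := (Complex.re_add_im h).symm
  rw [h1]
  nth_rw 3 [h2]
  rw [Complex.real_smul, Complex.real_smul]
  linear_combination (q * h.im) * Complex.I_sq

theorem dzbar_conj {f : ℂ → ℂ} {z : ℂ} (hf : DifferentiableAt ℝ f z) :
    dzbar (fun u ↦ conj (f u)) z = conj (dz f z) := by
  have h := (Complex.conjCLE.toContinuousLinearMap.hasFDerivAt.comp z hf.hasFDerivAt).fderiv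
  have h' : fderiv ℝ (fun u ↦ conj (f u)) z = Complex.conjCLE.toContinuousLinearMap.comp
    (fderiv ℝ f z) := h
  rw [dz, dzbar, h']
  simp [map_ofNat]

theorem ofReal_re_eq (w : ℂ) : ((w.re : ℝ) : ℂ) = (w + conj w) / 2 := Complex.re_eq_add_conj w

/-! ### The Euclidean structure on `ℂ × ℝ` -/

/-- The Euclidean inner product on `ℂ × ℝ = ℝ³`. -/
def dot (p q : ℂ × ℝ) : ℝ := (conj p.1 * q.1).re + p.2 * q.2

/-- The cross product on `ℂ × ℝ = ℝ³`. -/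
def cross (p q : ℂ × ℝ) : ℂ × ℝ :=
  (Complex.I * (p.2 * q.1 - q.2 * p.1), (conj p.1 * q.1).im)

/-- Orthonormal triples in `ℂ × ℝ`. -/
def IsOrthonormalTriple (s : Fin 3 → ℂ × ℝ) : Prop := ∀ i j, dot (s i) (s j) = if i = j then 1 else 0

theorem dot_eq (p q : ℂ × ℝ) : dot p q = p.1.re * q.1.re + p.1.im * q.1.im + p.2 * q.2 := by
  simp [dot]

theorem dot_comm (p q : ℂ × ℝ) : dot p q = dot q p := by
  simp only [dot_eq]; ring

/-- The standard basis of `ℂ × ℝ`. -/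
def stdTriple : Fin 3 → ℂ × ℝ := ![(1, 0), (Complex.I, 0), (0, 1)]

theorem isOrthonormalTriple_stdTriple : IsOrthonormalTriple stdTriple := by
  intro i j
  fin_cases i <;> fin_cases j <;> simp [stdTriple, dot_eq]

/-- The coordinates of a vector of `ℂ × ℝ = ℝ³`. -/
def toVec (p : ℂ × ℝ) : Fin 3 → ℝ := ![p.1.re, p.1.im, p.2]

theorem toVec_injective : Function.Injective toVec := by
  intro p q h
  have h0 := congrFun h 0
  have h1 := congrFun h 1
  have h2 := congrFun h 2
  simp only [toVec] at h0 h1 h2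
  exact Prod.ext (Complex.ext h0 h1) h2

theorem dot_eq_dotProduct (p q : ℂ × ℝ) : dot p q = toVec p ⬝ᵥ toVec q := by
  simp [dot_eq, toVec, dotProduct, Fin.sum_univ_three]

/-- A square matrix with orthonormal rows has orthonormal columns. -/
theorem IsOrthonormalTriple.sum_dot_smul {s : Fin 3 → ℂ × ℝ} (hs : IsOrthonormalTriple s)
    (p : ℂ × ℝ) : ∑ i, dot p (s i) • s i = p := by
  let M : Matrix (Fin 3) (Fin 3) ℝ := Matrix.of fun i ↦ toVec (s i)
  have hM : M * M.transpose = 1 := by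
    ext i j
    rw [Matrix.mul_apply', Matrix.one_apply, ← hs i j, dot_eq_dotProduct]
    rfl
  have hM' : M.transpose * M = 1 := mul_eq_one_comm.1 hM
  apply toVec_injective
  have e : ∀ (q : ℂ × ℝ), toVec q = Matrix.vecMul (Matrix.mulVec M (toVec q)) M := by
    intro q
    rw [← Matrix.vecMul_transpose, Matrix.vecMul_vecMul, hM', Matrix.vecMul_one]
  rw [e p]
  ext k
  fin_cases k <;>
    simp [toVec, Matrix.vecMul, Matrix.mulVec, dotProduct, Fin.sum_univ_three, M, dot_eq] <;> ring

/-- The volume of a triple. -/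
def triple (s : Fin 3 → ℂ × ℝ) : ℝ := dot (cross (s 0) (s 1)) (s 2)

theorem dot_cross_rotate (p q r : ℂ × ℝ) : dot (cross p q) r = dot (cross q r) p := by
  simp [dot_eq, cross]; ring

theorem dot_cross_self_left (p q : ℂ × ℝ) : dot (cross p q) p = 0 := by
  simp [dot_eq, cross]; ring

theorem dot_cross_self_right (p q : ℂ × ℝ) : dot (cross p q) q = 0 := by
  simp [dot_eq, cross]; ring

/-- The cross product is orthogonal to both factors, hence a multiple of the third vector. The
factor is the same for all `i` by cyclic symmetry; it is kept because the orientation of the triple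
is not prescribed. -/
theorem IsOrthonormalTriple.cross_eq {s : Fin 3 → ℂ × ℝ} (hs : IsOrthonormalTriple s) (i : Fin 3) :
    cross (s i) (s (i + 1)) = triple s • s (i + 2) := by
  have h3 : dot (cross (s i) (s (i + 1))) (s (i + 2)) = triple s := by
    fin_cases i
    · rfl
    · exact (dot_cross_rotate _ _ _).symm
    · exact dot_cross_rotate _ _ _
  have hsum := hs.sum_dot_smul (cross (s i) (s (i + 1)))
  rw [← hsum]
  have huniv : ∀ f : Fin 3 → ℂ × ℝ, ∑ j, f j = f i + f (i + 1) + f (i + 2) := by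
    intro f
    rw [Fin.sum_univ_three]
    fin_cases i
    · rfl
    · change _ = f 1 + f 2 + f 0; abel
    · change _ = f 2 + f 0 + f 1; abel
  rw [huniv, dot_cross_self_left, dot_cross_self_right, h3]
  simp

end

section

/-! ### The flat connection of a spinor-vortex space with vanishing `C` -/

/-- The connection form on `W⁻¹ TN ⊕ ℝ` in a gauge, as a linear function of `(a, ψ)`:
`dx = (a dz̄ - ā dz) x + 2 ψ r dz`, `dr = -2 Re (ψ̄ x dz̄)`. -/
def connForm : ℂ × ℂ →L[ℝ] ℂ →L[ℝ] (ℂ × ℝ) →L[ℝ] (ℂ × ℝ) :=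
  LinearMap.toContinuousLinearMap
    { toFun := fun p ↦ LinearMap.toContinuousLinearMap
        { toFun := fun h ↦ LinearMap.toContinuousLinearMap
            { toFun := fun y ↦ ((p.1 * conj h - conj p.1 * h) * y.1 + 2 * p.2 * h * y.2,
                -2 * (conj (p.2 * h) * y.1).re)
              map_add' := fun y y' ↦ by ext <;> simp <;> ring
              map_smul' := fun c y ↦ by ext <;> simp <;> ring }
          map_add' := fun h h' ↦ by ext <;> simp <;> ring
          map_smul' := fun c h ↦ by ext <;> simp <;> ring }
      map_add' := fun p p' ↦ by ext <;> simp <;> ring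
      map_smul' := fun c p ↦ by ext <;> simp <;> ring }

theorem connForm_apply (a ψ h : ℂ) (y : ℂ × ℝ) :
    connForm (a, ψ) h y = ((a * conj h - conj a * h) * y.1 + 2 * ψ * h * y.2,
      -2 * (conj (ψ * h) * y.1).re) := rfl

/-- The connection form takes values in skew endomorphisms; this is why inner products of parallel
sections are locally constant. -/
theorem dot_connForm (p : ℂ × ℂ) (h : ℂ) (y y' : ℂ × ℝ) :
    dot (connForm p h y) y' + dot y (connForm p h y') = 0 := by
  obtain ⟨a, ψ⟩ := p
  simp only [connForm_apply, dot_eq]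
  simp
  ring

variable {ι N : Type*} [TopologicalSpace N] [ChartedSpace ℂ N] (S : SpinorVortexSpace ι N)

namespace SpinorVortexSpace

/-- The connection form of `S` in the gauge `i`. -/
def conn (i : ι) (z : ℂ) : ℂ →L[ℝ] (ℂ × ℝ) →L[ℝ] (ℂ × ℝ) := connForm (S.a i z, S.ψ i z)

/-- `s` is parallel at `z`. -/
def IsParallelAt (i : ι) (s : ℂ → ℂ × ℝ) (z : ℂ) : Prop :=
  HasFDerivAt s ((S.conn i z).flip (s z)) z

variable {S}

theorem contDiffOn_conn (i : ι) : ContDiffOn ℝ ∞ (S.conn i) (S.chart i).target :=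
  connForm.contDiff.comp_contDiffOn ((S.a_smooth i).prodMk (S.ψ_smooth i))

theorem a_diff {i : ι} {z : ℂ} (hz : z ∈ (S.chart i).target) : DifferentiableAt ℝ (S.a i) z :=
  ((S.a_smooth i).contDiffAt ((S.chart i).open_target.mem_nhds hz)).differentiableAt (by simp)

theorem ψ_diff {i : ι} {z : ℂ} (hz : z ∈ (S.chart i).target) : DifferentiableAt ℝ (S.ψ i) z :=
  ((S.ψ_smooth i).contDiffAt ((S.chart i).open_target.mem_nhds hz)).differentiableAt (by simp)

theorem fderiv_conn {i : ι} {z : ℂ} (hz : z ∈ (S.chart i).target) (u : ℂ) :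
    fderiv ℝ (S.conn i) z u = connForm (fderiv ℝ (S.a i) z u, fderiv ℝ (S.ψ i) z u) := by
  have h := connForm.hasFDerivAt.comp z
    ((a_diff hz).hasFDerivAt.prodMk (ψ_diff hz).hasFDerivAt)
  have h' : fderiv ℝ (S.conn i) z = _ := h.fderiv
  rw [h']
  rfl

/-- The section `C` vanishes. -/
def CVanishes (S : SpinorVortexSpace ι N) : Prop := ∀ i, ∀ z ∈ (S.chart i).target, S.C i z = 0

theorem CVanishes.dbar_ψ (hC : S.CVanishes) {i : ι} {z : ℂ} (hz : z ∈ (S.chart i).target) :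
    dzbar (S.ψ i) z = S.a i z * S.ψ i z := by
  have := S.dbar_ψ i z hz
  rw [hC i z hz] at this
  linear_combination this

theorem CVanishes.curvature (hC : S.CVanishes) {i : ι} {z : ℂ} (hz : z ∈ (S.chart i).target) :
    dz (S.a i) z + conj (dz (S.a i) z) = -2 * (S.ψ i z * conj (S.ψ i z)) := by
  have := S.curvature_eq i z hz
  rw [hC i z hz, dzbar_conj (a_diff hz)] at this
  linear_combination (-1 / 2 : ℂ) * this

/-- The curvature on `W⁻¹TN` is that of the Chern connection plus a term quadratic in `ψ`, and the
two cancel by `s = |ψ|²`. The components mixing `W⁻¹TN` with `ℝ` cancel by `∂̄ψ = a ψ`. -/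
theorem CVanishes.isFlatAt (hC : S.CVanishes) {i : ι} {z : ℂ} (hz : z ∈ (S.chart i).target) :
    IsFlatAt (S.conn i) z := by
  intro u v y
  obtain ⟨x, r⟩ := y
  have hcurv := hC.curvature hz
  rw [fderiv_conn hz, fderiv_conn hz, conn, fderiv_eq_dz_add_dzbar, fderiv_eq_dz_add_dzbar,
    fderiv_eq_dz_add_dzbar, fderiv_eq_dz_add_dzbar, hC.dbar_ψ hz]
  generalize dz (S.a i) z = p at *
  generalize dzbar (S.a i) z = q at *
  generalize dz (S.ψ i) z = ψ' at *
  generalize S.a i z = a at *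
  generalize S.ψ i z = ψ at *
  simp only [connForm_apply]
  ext1
  · simp only [Prod.fst_add, Complex.ofReal_mul, ofReal_re_eq, map_add, map_mul, Complex.conj_conj,
      Complex.ofReal_neg, Complex.ofReal_ofNat]
    linear_combination (u * conj v - v * conj u) * x * hcurv
  · apply Complex.ofReal_injective
    simp only [Prod.snd_add, Complex.ofReal_add, Complex.ofReal_mul, ofReal_re_eq, map_add, map_mul,
      Complex.conj_conj, Complex.ofReal_neg, Complex.ofReal_ofNat, map_sub, Complex.conj_ofReal,
      map_ofNat]
    ring

theorem IsParallelAt.hasFDerivAt_dot {i : ι} {s s' : ℂ → ℂ × ℝ} {z : ℂ}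
    (hs : S.IsParallelAt i s z) (hs' : S.IsParallelAt i s' z) :
    HasFDerivAt (fun z ↦ dot (s z) (s' z)) (0 : ℂ →L[ℝ] ℝ) z := by
  have h1 := Complex.reCLM.hasFDerivAt.comp z hs.fst
  have h2 := Complex.imCLM.hasFDerivAt.comp z hs.fst
  have h1' := Complex.reCLM.hasFDerivAt.comp z hs'.fst
  have h2' := Complex.imCLM.hasFDerivAt.comp z hs'.fst
  have key := ((h1.mul h1').add (h2.mul h2')).add (hs.snd.mul hs'.snd)
  have e : (fun z ↦ dot (s z) (s' z)) = fun z ↦ (s z).1.re * (s' z).1.re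
      + (s z).1.im * (s' z).1.im + (s z).2 * (s' z).2 := by
    funext z; exact dot_eq _ _
  rw [e]
  refine key.congr_fderiv ?_
  ext1 h
  have hd := dot_connForm (S.a i z, S.ψ i z) h (s z) (s' z)
  rw [dot_eq, dot_eq] at hd
  simp [conn]
  linarith

theorem IsParallelAt.add_smul {i : ι} {s : Fin 3 → ℂ → ℂ × ℝ} {z : ℂ}
    (hs : ∀ j, S.IsParallelAt i (s j) z) (c : Fin 3 → ℝ) :
    S.IsParallelAt i (fun z ↦ ∑ j, c j • s j z) z := by
  have h := HasFDerivAt.fun_sum (u := Finset.univ) fun j _ ↦ (hs j).const_smul (c j)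
  refine h.congr_fderiv ?_
  ext1 v
  simp [map_sum, map_smul]

/-- Local existence of parallel orthonormal frames. -/
theorem CVanishes.exists_parallel_frame (hC : S.CVanishes) {i : ι} {z₀ : ℂ}
    (hz₀ : z₀ ∈ (S.chart i).target) :
    ∃ r > 0, Metric.ball z₀ r ⊆ (S.chart i).target ∧ ∃ s : Fin 3 → ℂ → ℂ × ℝ,
      (∀ j, s j z₀ = stdTriple j) ∧ ∀ z ∈ Metric.ball z₀ r,
        (∀ j, S.IsParallelAt i (s j) z) ∧ IsOrthonormalTriple fun j ↦ s j z := by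
  obtain ⟨r, hr, hsub, hex⟩ := exists_parallel (S.chart i).open_target hz₀
    ((contDiffOn_conn i).of_le ENat.LEInfty.out)
    fun p hp ↦ hC.isFlatAt hp
  choose s hs0 hs using fun j ↦ hex (stdTriple j)
  refine ⟨r, hr, hsub, s, hs0, fun z hz ↦ ⟨fun j ↦ hs j z hz, fun j k ↦ ?_⟩⟩
  have hconst := (convex_ball z₀ r).is_const_of_fderivWithin_eq_zero (𝕜 := ℝ)
    (f := fun z ↦ dot (s j z) (s k z)) (fun z hz ↦ ((IsParallelAt.hasFDerivAt_dot (hs j z hz)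
      (hs k z hz)).differentiableAt).differentiableWithinAt)
    (fun z hz ↦ ((IsParallelAt.hasFDerivAt_dot (hs j z hz)
      (hs k z hz)).hasFDerivWithinAt).fderivWithin
        (Metric.isOpen_ball.uniqueDiffWithinAt hz)) hz (Metric.mem_ball_self hr)
  rw [hconst]
  simp only [hs0]
  exact isOrthonormalTriple_stdTriple j k

theorem contDiffOn_of_isParallelAt {i : ι} {O : Set ℂ} (hO : IsOpen O)
    (hsub : O ⊆ (S.chart i).target) {s : ℂ → ℂ × ℝ} (hs : ∀ z ∈ O, S.IsParallelAt i s z) :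
    ContDiffOn ℝ ∞ s O :=
  contDiffOn_of_parallel hO ((contDiffOn_conn i).mono hsub) hs

/-- The first component of a parallel section is a section in the kernel of `∂̄ - a`. -/
theorem IsParallelAt.dzbar_fst {i : ι} {s : ℂ → ℂ × ℝ} {z : ℂ} (hs : S.IsParallelAt i s z) :
    dzbar (fun z ↦ (s z).1) z = S.a i z * (s z).1 := by
  have h : fderiv ℝ (fun z ↦ (s z).1) z = _ := hs.fst.fderiv
  rw [dzbar, h]
  simp [conn, connForm_apply]
  linear_combination (S.ψ i z * (s z).2 - S.a i z * (s z).1 / 2 - conj (S.a i z) * (s z).1 / 2) * Complex.I_sq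

end SpinorVortexSpace

end

section

variable {ι N : Type*} [TopologicalSpace N] [ChartedSpace ℂ N]

namespace SpinorVortexSpace

/-! ### Change of gauge -/

variable (S : SpinorVortexSpace ι N)

/-- The coordinate of the gauge `j` as a function of the coordinate of the gauge `i`. -/
def coordChange (i j : ι) (z : ℂ) : ℂ := S.chart j ((S.chart i).symm z)

/-- The overlap of the gauges `i` and `j` in the coordinate of the gauge `i`. -/
def overlap (i j : ι) : Set ℂ := (S.chart i).target ∩ (S.chart i).symm ⁻¹' (S.chart j).source

/-- The derivative of the change of coordinate. -/
def dcoord (i j : ι) (z : ℂ) : ℂ := deriv (S.coordChange i j) z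

/-- The transition function of `W` in the coordinate of the gauge `i`. -/
def transC (i j : ι) (z : ℂ) : ℂ := S.trans i j ((S.chart i).symm z)

variable {S}

theorem isOpen_overlap (i j : ι) : IsOpen (S.overlap i j) :=
  (S.chart i).isOpen_inter_preimage_symm (S.chart j).open_source

theorem chart_mem_overlap {i j : ι} {p : N} (hi : p ∈ (S.chart i).source)
    (hj : p ∈ (S.chart j).source) : S.chart i p ∈ S.overlap i j :=
  ⟨(S.chart i).map_source hi, by simpa [(S.chart i).left_inv hi] using hj⟩

theorem contDiffOn_coordChange (i j : ι) : ContDiffOn ℂ ω (S.coordChange i j) (S.overlap i j) := by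
  have h := IsManifold.compatible_of_mem_maximalAtlas (S.chart_mem i) (S.chart_mem j)
  rw [contDiffGroupoid, mem_groupoid_of_pregroupoid, contDiffPregroupoid] at h
  have h1 := h.1
  simp only [modelWithCornersSelf_coe, modelWithCornersSelf_coe_symm, Function.comp_id,
    Function.id_comp, Set.preimage_id, Set.range_id, Set.inter_univ] at h1
  refine h1.congr_mono (fun z _ ↦ rfl) ?_
  rw [OpenPartialHomeomorph.trans_source, OpenPartialHomeomorph.symm_source]
  exact subset_rfl

theorem hasDerivAt_coordChange {i j : ι} {z : ℂ} (hz : z ∈ S.overlap i j) :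
    HasDerivAt (S.coordChange i j) (S.dcoord i j z) z :=
  (((contDiffOn_coordChange i j).contDiffAt ((isOpen_overlap i j).mem_nhds hz)).differentiableAt
    (by simp)).hasDerivAt

theorem differentiableAt_dcoord {i j : ι} {z : ℂ} (hz : z ∈ S.overlap i j) :
    DifferentiableAt ℂ (S.dcoord i j) z := by
  have hd : DifferentiableOn ℂ (S.coordChange i j) (S.overlap i j) :=
    fun z hz ↦ (hasDerivAt_coordChange hz).differentiableAt.differentiableWithinAt
  exact (hd.deriv (isOpen_overlap i j)).differentiableAt ((isOpen_overlap i j).mem_nhds hz)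

/-- The cocycle rule gives `trans i j * trans j i = trans i i`, and the normalization gives `trans i
i` norm one. -/
theorem trans_ne_zero {i j : ι} {p : N} (hi : p ∈ (S.chart i).source)
    (hj : p ∈ (S.chart j).source) : S.trans i j p ≠ 0 := by
  have hself : S.trans i i p ≠ 0 := by
    have h1 : deriv (fun z ↦ S.chart i ((S.chart i).symm z)) (S.chart i p) = 1 := by
      have : (fun z ↦ S.chart i ((S.chart i).symm z)) =ᶠ[𝓝 (S.chart i p)] id := by
        filter_upwards [(S.chart i).open_target.mem_nhds ((S.chart i).map_source hi)] with z hz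
        exact (S.chart i).right_inv hz
      rw [this.deriv_eq, deriv_id]
    have h2 := S.trans_norm i i p ⟨hi, hi⟩
    rw [h1] at h2
    intro h
    simp [h] at h2
  intro h
  apply hself
  rw [S.trans_mul i j i p ⟨⟨hi, hj⟩, hi⟩, h, zero_mul]

theorem norm_trans_eq {i j : ι} {z : ℂ} (hz : z ∈ S.overlap i j) :
    ‖S.transC i j z‖ = ‖S.dcoord i j z‖ := by
  have hi := (S.chart i).map_target hz.1
  have h := S.trans_norm i j _ ⟨hi, hz.2⟩
  rwa [(S.chart i).right_inv hz.1] at h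

theorem transC_ne_zero {i j : ι} {z : ℂ} (hz : z ∈ S.overlap i j) : S.transC i j z ≠ 0 :=
  trans_ne_zero ((S.chart i).map_target hz.1) hz.2

theorem dcoord_ne_zero {i j : ι} {z : ℂ} (hz : z ∈ S.overlap i j) : S.dcoord i j z ≠ 0 := by
  rw [← norm_ne_zero_iff, ← norm_trans_eq hz, norm_ne_zero_iff]
  exact transC_ne_zero hz

theorem differentiableAt_transC {i j : ι} {z : ℂ} (hz : z ∈ S.overlap i j) :
    DifferentiableAt ℝ (S.transC i j) z :=
  ((S.trans_smooth i j).contDiffAt ((isOpen_overlap i j).mem_nhds hz)).differentiableAt (by simp)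

theorem dzbar_transC {i j : ι} {z : ℂ} (hz : z ∈ S.overlap i j) :
    dzbar (S.transC i j) z = S.transC i j z *
      (S.a i z - S.a j (S.coordChange i j z) * conj (S.dcoord i j z)) := by
  have h := S.a_trans i j _ ⟨(S.chart i).map_target hz.1, hz.2⟩
  rw [(S.chart i).right_inv hz.1] at h
  change S.a i z * S.transC i j z = dzbar (S.transC i j) z
    + S.transC i j z * S.a j (S.coordChange i j z) * conj (S.dcoord i j z) at h
  linear_combination -h

theorem ψ_coordChange {i j : ι} {z : ℂ} (hz : z ∈ S.overlap i j) :
    S.ψ i z = S.transC i j z * S.ψ j (S.coordChange i j z) := by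
  have h := S.ψ_trans i j _ ⟨(S.chart i).map_target hz.1, hz.2⟩
  rwa [(S.chart i).right_inv hz.1] at h

variable (S) in
/-- The unit complex number relating the frames `(e i)⁻¹ ⊗ ∂_z` of the two gauges. -/
def phase (i j : ι) (z : ℂ) : ℂ := S.transC i j z / S.dcoord i j z

theorem norm_phase {i j : ι} {z : ℂ} (hz : z ∈ S.overlap i j) : ‖S.phase i j z‖ = 1 := by
  rw [phase, norm_div, norm_trans_eq hz, div_self (norm_ne_zero_iff.2 (dcoord_ne_zero hz))]

theorem phase_mul_conj {i j : ι} {z : ℂ} (hz : z ∈ S.overlap i j) :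
    S.phase i j z * conj (S.phase i j z) = 1 := by
  rw [Complex.mul_conj, Complex.normSq_eq_norm_sq, norm_phase hz]
  simp

theorem differentiableAt_phase {i j : ι} {z : ℂ} (hz : z ∈ S.overlap i j) :
    DifferentiableAt ℝ (S.phase i j) z :=
  (differentiableAt_transC hz).mul
    (((differentiableAt_dcoord hz).inv (dcoord_ne_zero hz)).restrictScalars ℝ)

/-- The derivative of the coordinate change is holomorphic, so dividing `transC` by it leaves the
logarithmic `∂̄`-derivative unchanged. -/
theorem dzbar_phase {i j : ι} {z : ℂ} (hz : z ∈ S.overlap i j) :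
    dzbar (S.phase i j) z = S.phase i j z *
      (S.a i z - S.a j (S.coordChange i j z) * conj (S.dcoord i j z)) := by
  have h1 := (differentiableAt_phase hz).hasFDerivAt
  have h2 := (differentiableAt_dcoord hz).hasFDerivAt.restrictScalars ℝ
  have h3 := h1.mul' h2
  have e : (fun y ↦ S.phase i j y * S.dcoord i j y) =ᶠ[𝓝 z] S.transC i j := by
    filter_upwards [(isOpen_overlap i j).mem_nhds hz] with y hy
    exact div_mul_cancel₀ _ (dcoord_ne_zero hy)
  have h4 : fderiv ℝ (S.transC i j) z = _ := (h3.congr_of_eventuallyEq e.symm).fderiv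
  have h5 := dzbar_transC hz
  rw [dzbar, h4] at h5
  have hI : fderiv ℂ (S.dcoord i j) z Complex.I = Complex.I * fderiv ℂ (S.dcoord i j) z 1 := by
    rw [← smul_eq_mul, ← map_smul, smul_eq_mul, mul_one]
  have ht : S.transC i j z = S.phase i j z * S.dcoord i j z :=
    (div_mul_cancel₀ _ (dcoord_ne_zero hz)).symm
  simp only [add_apply, smul_apply, ContinuousLinearMap.coe_restrictScalars', smul_eq_mul, hI,
    MulOpposite.smul_eq_mul_unop, MulOpposite.unop_op, ht] at h5
  apply mul_right_cancel₀ (dcoord_ne_zero hz)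
  rw [dzbar]
  linear_combination h5 - S.phase i j z * fderiv ℂ (S.dcoord i j) z 1 / 2 * Complex.I_sq

/-- Differentiating `|phase|² = 1` determines the `∂_z`-derivative from the conjugate of
`dzbar_phase`. -/
theorem dz_phase {i j : ι} {z : ℂ} (hz : z ∈ S.overlap i j) :
    dz (S.phase i j) z = -S.phase i j z *
      (conj (S.a i z) - conj (S.a j (S.coordChange i j z)) * S.dcoord i j z) := by
  have h1 := (differentiableAt_phase hz).hasFDerivAt
  have h2 := (Complex.conjCLE.toContinuousLinearMap.hasFDerivAt.comp z h1)
  have h3 := h1.mul' h2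
  have e : (fun y ↦ S.phase i j y * conj (S.phase i j y)) =ᶠ[𝓝 z] fun _ ↦ (1 : ℂ) := by
    filter_upwards [(isOpen_overlap i j).mem_nhds hz] with y hy
    exact phase_mul_conj hy
  have h4 := (h3.congr_of_eventuallyEq e.symm).unique (hasFDerivAt_const (1 : ℂ) z)
  have h5 : ∀ v, S.phase i j z * conj (fderiv ℝ (S.phase i j) z v)
      + conj (S.phase i j z) * fderiv ℝ (S.phase i j) z v = 0 := fun v ↦ by
    simpa using! congrArg (fun L : ℂ →L[ℝ] ℂ ↦ L v) h4
  have h6 : conj (S.phase i j z) * dz (S.phase i j) z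
      + S.phase i j z * conj (dzbar (S.phase i j) z) = 0 := by
    simp only [dz, dzbar, map_div₀, map_add, map_mul, Complex.conj_I, map_ofNat]
    linear_combination (h5 1 - Complex.I * h5 Complex.I) / 2
  rw [dzbar_phase hz] at h6
  simp only [map_mul, map_sub, Complex.conj_conj] at h6
  have hp := phase_mul_conj hz
  have hne : conj (S.phase i j z) ≠ 0 := fun h ↦ by simp [h] at hp
  apply mul_left_cancel₀ hne
  linear_combination h6

/-- The expression in the gauge `i` of a section given in the gauge `j`. -/
def pullSection (S : SpinorVortexSpace ι N) (i j : ι) (s : ℂ → ℂ × ℝ) (z : ℂ) : ℂ × ℝ :=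
  (S.phase i j z * (s (S.coordChange i j z)).1, (s (S.coordChange i j z)).2)

/-- Gauge invariance of the connection: the derivatives of the phase account for the change of `a`,
and `ψ` changes by the phase times the derivative of the coordinate. -/
theorem IsParallelAt.pullSection {i j : ι} {s : ℂ → ℂ × ℝ} {z : ℂ} (hz : z ∈ S.overlap i j)
    (hs : S.IsParallelAt j s (S.coordChange i j z)) :
    S.IsParallelAt i (S.pullSection i j s) z := by
  have h1 := hs.comp z ((hasDerivAt_coordChange hz).hasFDerivAt.restrictScalars ℝ)
  have h2 := ((differentiableAt_phase hz).hasFDerivAt.mul' h1.fst).prodMk h1.snd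
  refine HasFDerivAt.congr_fderiv h2 ?_
  have ht : S.transC i j z = S.phase i j z * S.dcoord i j z :=
    (div_mul_cancel₀ _ (dcoord_ne_zero hz)).symm
  have hψ := ψ_coordChange hz
  rw [ht] at hψ
  have hp := phase_mul_conj hz
  ext1 h
  have hph := fderiv_eq_dz_add_dzbar (S.phase i j) z h
  rw [dz_phase hz, dzbar_phase hz] at hph
  simp [conn, connForm_apply, SpinorVortexSpace.pullSection, hph, hψ]
  generalize S.phase i j z = p at *
  generalize S.dcoord i j z = d at *
  generalize S.coordChange i j z = w at *
  refine ⟨by ring, ?_⟩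
  have hp' : p.re * p.re + p.im * p.im = 1 := by
    simpa [Complex.mul_conj, Complex.normSq_apply] using congrArg Complex.re hp
  linear_combination
    (-(((S.ψ j w).re * (h.re * d.re - h.im * d.im)
        + (S.ψ j w).im * (-(h.re * d.im) + -(h.im * d.re))) * (s w).1.re
      - ((S.ψ j w).re * (-(h.re * d.im) + -(h.im * d.re))
        + -((S.ψ j w).im * (h.re * d.re - h.im * d.im))) * (s w).1.im)) * hp'

end SpinorVortexSpace

end

section

/-! ### The dichotomy for spinor-vortex spaces with vanishing `C` -/

theorem differentiableAt_complex_of_dzbar_eq_zero {f : ℂ → ℂ} {z : ℂ}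
    (hf : DifferentiableAt ℝ f z) (h : dzbar f z = 0) : DifferentiableAt ℂ f z := by
  refine differentiableAt_complex_iff_differentiableAt_real.2 ⟨hf, ?_⟩
  rw [dzbar] at h
  rw [smul_eq_mul]
  linear_combination (-2 * Complex.I) * h + fderiv ℝ f z Complex.I * Complex.I_sq

theorem eq_of_hasFDerivAt_zero_on_ball {E G : Type*} [NormedAddCommGroup E] [NormedSpace ℝ E]
    [NormedAddCommGroup G] [NormedSpace ℝ G] {f : E → G} {z₀ : E} {r : ℝ}
    (h : ∀ z ∈ Metric.ball z₀ r, HasFDerivAt f (0 : E →L[ℝ] G) z) {z : E}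
    (hz : z ∈ Metric.ball z₀ r) : f z = f z₀ :=
  (convex_ball z₀ r).is_const_of_fderivWithin_eq_zero (𝕜 := ℝ)
    (fun z hz ↦ (h z hz).differentiableAt.differentiableWithinAt)
    (fun z hz ↦ (h z hz).hasFDerivWithinAt.fderivWithin (Metric.isOpen_ball.uniqueDiffWithinAt hz))
    hz (Metric.mem_ball_self (Metric.pos_of_mem_ball hz))

/-- Two solutions of the same equation `∂̄f = a f` have a holomorphic quotient; this replaces a
local holomorphic frame of `W⁻¹`. -/
theorem dzbar_div {f g : ℂ → ℂ} {z a : ℂ} (hf : DifferentiableAt ℝ f z)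
    (hg : DifferentiableAt ℝ g z) (hg0 : g z ≠ 0) (hf' : dzbar f z = a * f z)
    (hg' : dzbar g z = a * g z) : dzbar (fun u ↦ f u / g u) z = 0 := by
  have hg1 : HasFDerivAt (fun u ↦ (g u)⁻¹) _ z := (hasDerivAt_inv hg0).hasFDerivAt.restrictScalars ℝ
    |>.comp z hg.hasFDerivAt
  have h := (hf.hasFDerivAt.mul' hg1).fderiv
  have h' : fderiv ℝ (fun u ↦ f u / g u) z = _ := h
  rw [dzbar] at hf' hg' ⊢
  rw [h']
  simp only [add_apply, smul_apply, smul_eq_mul, ContinuousLinearMap.comp_apply,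
    ContinuousLinearMap.coe_restrictScalars', ContinuousLinearMap.toSpanSingleton_apply,
    MulOpposite.smul_eq_mul_unop, MulOpposite.unop_op]
  field_simp
  linear_combination 2 * g z * hf' - 2 * f z * hg'

/-- If `∂̄ψ = a ψ` with `ψ ≠ 0`, then `Δ log |ψ| = 4 Re a_z`. -/
theorem laplacian_log_norm {ψ a : ℂ → ℂ} {z : ℂ} (hψ : ContDiffAt ℝ ∞ ψ z)
    (ha : DifferentiableAt ℝ a z) (h0 : ψ z ≠ 0) (h : ∀ᶠ u in 𝓝 z, dzbar ψ u = a u * ψ u) :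
    Laplacian.laplacian (fun u ↦ Real.log ‖ψ u‖) z = 4 * (dz a z).re := by
  -- Dividing by `ψ z` keeps the argument near `1`, where the principal branch is smooth; the added
  -- constant restores the real part `log |ψ|`.
  set ℓ : ℂ → ℂ := fun u ↦ Complex.log (ψ u / ψ z) + Real.log ‖ψ z‖ with hℓ
  have hd : ContDiffAt ℝ ∞ (fun u ↦ ψ u / ψ z) z := by
    simp only [div_eq_mul_inv]
    exact hψ.mul contDiffAt_const
  have hslit : ∀ᶠ u in 𝓝 z, ψ u / ψ z ∈ Complex.slitPlane :=
    hd.continuousAt.eventually_mem (Complex.isOpen_slitPlane.mem_nhds (by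
      simp only [div_self h0]; exact Complex.one_mem_slitPlane))
  have hψd : ∀ᶠ u in 𝓝 z, DifferentiableAt ℝ ψ u :=
    ((hψ.of_le ENat.LEInfty.out : ContDiffAt ℝ 1 ψ z).eventually (by simp)).mono
      fun u hu ↦ hu.differentiableAt (by simp)
  have hℓs : ContDiffAt ℝ 2 ℓ z := by
    refine ContDiffAt.add ?_ contDiffAt_const
    exact ((Complex.contDiffAt_log hslit.self_of_nhds).restrict_scalars ℝ).comp z
      (hd.of_le (ENat.LEInfty.out : (2 : ℕ∞ω) ≤ ∞))
  have hψ0 : ∀ᶠ u in 𝓝 z, ψ u ≠ 0 := hψ.continuousAt.eventually_ne h0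
  have hre : (fun u ↦ Real.log ‖ψ u‖) =ᶠ[𝓝 z] Complex.reCLM ∘ ℓ := by
    filter_upwards [hψ0] with u hu
    simp only [Function.comp, hℓ, Complex.reCLM_apply, Complex.add_re, Complex.log_re,
      Complex.ofReal_re, norm_div]
    rw [Real.log_div (norm_ne_zero_iff.2 hu) (norm_ne_zero_iff.2 h0)]
    ring
  -- This is `∂̄ log ψ = a`, multiplied by two.
  have hℓd : ∀ᶠ u in 𝓝 z, fderiv ℝ ℓ u 1 + Complex.I * fderiv ℝ ℓ u Complex.I = 2 * a u := by
    filter_upwards [hslit, hψd, h, hψ0] with u hu hdu hau hu0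
    have h1 : HasFDerivAt (fun u ↦ ψ u / ψ z) ((ψ z)⁻¹ • fderiv ℝ ψ u) u := by
      simp only [div_eq_inv_mul]
      exact hdu.hasFDerivAt.const_smul (ψ z)⁻¹
    have h2 := (((Complex.hasStrictDerivAt_log hu).hasDerivAt.hasFDerivAt.restrictScalars ℝ).comp u
      h1).add_const (c := ((Real.log ‖ψ z‖ : ℝ) : ℂ))
    have h3 : fderiv ℝ ℓ u = _ := h2.fderiv
    rw [dzbar] at hau
    rw [h3]
    simp
    field_simp
    linear_combination 2 * hau
  have hsymm : IsSymmSndFDerivAt ℝ ℓ z := hℓs.isSymmSndFDerivAt (by simp)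
  have hD : DifferentiableAt ℝ (fderiv ℝ ℓ) z :=
    (hℓs.fderiv_right (m := 1) (by norm_num)).differentiableAt (by simp)
  have hH : ∀ v, fderiv ℝ (fderiv ℝ ℓ) z v 1 + Complex.I * fderiv ℝ (fderiv ℝ ℓ) z v Complex.I =
      2 * fderiv ℝ a z v := by
    intro v
    have e1 := (hD.hasFDerivAt.clm_apply (hasFDerivAt_const (1 : ℂ) z)).add
      ((hD.hasFDerivAt.clm_apply (hasFDerivAt_const Complex.I z)).const_mul Complex.I)
    have e2 := (e1.congr_of_eventuallyEq (hℓd.mono fun u hu ↦ hu.symm)).unique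
      (ha.hasFDerivAt.const_mul (2 : ℂ))
    simpa using! congrArg (fun L : ℂ →L[ℝ] ℂ ↦ L v) e2
  have e1 : Laplacian.laplacian (fun u ↦ Real.log ‖ψ u‖) z =
      Complex.reCLM (Laplacian.laplacian ℓ z) := by
    rw [(InnerProductSpace.laplacian_congr_nhds hre).self_of_nhds]
    exact hℓs.laplacian_CLM_comp_left
  rw [e1, InnerProductSpace.laplacian_eq_iteratedFDeriv_complexPlane]
  simp only [iteratedFDeriv_two_apply, Matrix.cons_val_zero, Matrix.cons_val_one,
    Complex.reCLM_apply]
  -- Combining `hH` at `1` and at `I`, the mixed second derivatives cancel by symmetry: `Δ = 4 ∂_z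
  -- ∂_z̄`.
  have e2 : fderiv ℝ (fderiv ℝ ℓ) z 1 1 + fderiv ℝ (fderiv ℝ ℓ) z Complex.I Complex.I =
      4 * dz a z := by
    rw [dz]
    have hs := hsymm 1 Complex.I
    linear_combination hH 1 - Complex.I * hH Complex.I - Complex.I * hs
      + fderiv ℝ (fderiv ℝ ℓ) z Complex.I Complex.I * Complex.I_sq
  rw [e2]
  simp

variable {ι N : Type*} [TopologicalSpace N] [ChartedSpace ℂ N] {S : SpinorVortexSpace ι N}

namespace SpinorVortexSpace

theorem IsParallelAt.dz_fst {i : ι} {s : ℂ → ℂ × ℝ} {z : ℂ} (hs : S.IsParallelAt i s z) :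
    dz (fun z ↦ (s z).1) z = -conj (S.a i z) * (s z).1 + 2 * S.ψ i z * (s z).2 := by
  have h : fderiv ℝ (fun z ↦ (s z).1) z = _ := hs.fst.fderiv
  rw [dz, h]
  simp [conn, connForm_apply]
  linear_combination (-S.ψ i z * (s z).2 + S.a i z * (s z).1 / 2
    + conj (S.a i z) * (s z).1 / 2) * Complex.I_sq

/-- The parallel section with value `(1, 0)` at `z₀` has a nonvanishing first component near `z₀`.
That component satisfies the same `∂̄`-equation as `ψ`, so the quotient is holomorphic and the
identity theorem applies. -/
theorem CVanishes.eventually_eq_zero_or_ne_zero (hC : S.CVanishes) {i : ι} {z₀ : ℂ}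
    (hz₀ : z₀ ∈ (S.chart i).target) :
    (∀ᶠ z in 𝓝 z₀, S.ψ i z = 0) ∨ ∀ᶠ z in 𝓝[≠] z₀, S.ψ i z ≠ 0 := by
  obtain ⟨r, hr, hsub, s, hs0, hs⟩ := hC.exists_parallel_frame hz₀
  have hball := Metric.ball_mem_nhds z₀ hr
  have hx : ∀ z ∈ Metric.ball z₀ r, DifferentiableAt ℝ (fun z ↦ (s 0 z).1) z := fun z hz ↦
    ((hs z hz).1 0).fst.differentiableAt
  have hx0 : ∀ᶠ z in 𝓝 z₀, (s 0 z).1 ≠ 0 :=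
    (hx z₀ (Metric.mem_ball_self hr)).continuousAt.eventually_ne (by simp [hs0, stdTriple])
  have hhol : ∀ᶠ z in 𝓝 z₀, DifferentiableAt ℂ (fun z ↦ S.ψ i z / (s 0 z).1) z := by
    filter_upwards [hball, hx0] with z hz hz0
    refine differentiableAt_complex_of_dzbar_eq_zero ?_ ?_
    · have h1 : DifferentiableAt ℝ (fun z ↦ (s 0 z).1⁻¹) z :=
        ((hasDerivAt_inv hz0).differentiableAt.restrictScalars ℝ).comp z (hx z hz)
      exact (ψ_diff (hsub hz)).mul h1
    · exact dzbar_div (ψ_diff (hsub hz)) (hx z hz) hz0 (hC.dbar_ψ (hsub hz)) ((hs z hz).1 0).dzbar_fst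
  have han : AnalyticAt ℂ (fun z ↦ S.ψ i z / (s 0 z).1) z₀ :=
    Complex.analyticAt_iff_eventually_differentiableAt.2 hhol
  refine han.eventually_eq_zero_or_eventually_ne_zero.imp (fun h ↦ ?_) (fun h ↦ ?_)
  · filter_upwards [h, hx0] with z hz hz0
    simpa [hz0] using hz
  · filter_upwards [h] with z hz hz0
    simp [hz0] at hz

theorem ψ_eq_zero_iff {i j : ι} {p : N} (hi : p ∈ (S.chart i).source)
    (hj : p ∈ (S.chart j).source) : S.ψ i (S.chart i p) = 0 ↔ S.ψ j (S.chart j p) = 0 := by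
  rw [S.ψ_trans i j p ⟨hi, hj⟩, mul_eq_zero, or_iff_right (trans_ne_zero hi hj)]

/-- The interior of the zero set of `ψ` is also closed: a point outside it has a punctured
neighbourhood free of zeros. Connectedness of `N` then leaves only two cases. -/
theorem CVanishes.ψ_eq_zero_or_dense [ConnectedSpace N] (hC : S.CVanishes) :
    (∀ i, ∀ z ∈ (S.chart i).target, S.ψ i z = 0) ∨
      Dense {p : N | ∀ i, p ∈ (S.chart i).source → S.ψ i (S.chart i p) ≠ 0} := by
  set D := {p : N | ∀ i, p ∈ (S.chart i).source → S.ψ i (S.chart i p) ≠ 0} with hD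
  have hmem : ∀ {p : N} {i : ι}, p ∈ (S.chart i).source →
      (p ∈ D ↔ S.ψ i (S.chart i p) ≠ 0) := fun {p i} hi ↦
    ⟨fun h ↦ h i hi, fun h j hj h' ↦ h ((ψ_eq_zero_iff hi hj).2 h')⟩
  have hclopen : IsClopen (interior Dᶜ) := by
    refine ⟨⟨isOpen_iff_mem_nhds.2 fun p hp ↦ ?_⟩, isOpen_interior⟩
    obtain ⟨i, hi⟩ := S.cover p
    have hc := (S.chart i).continuousAt hi
    rcases hC.eventually_eq_zero_or_ne_zero ((S.chart i).map_source hi) with h | h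
    · refine absurd (mem_interior_iff_mem_nhds.2 ?_) hp
      filter_upwards [hc.eventually h, (S.chart i).open_source.mem_nhds hi] with q hq hqs
      exact fun hqD ↦ (hmem hqs).1 hqD hq
    · rw [eventually_nhdsWithin_iff] at h
      filter_upwards [hc.eventually h, (S.chart i).open_source.mem_nhds hi] with q hq hqs hqD
      by_cases hqp : q = p
      · exact hp (hqp ▸ hqD)
      · refine interior_subset hqD ((hmem hqs).2 (hq ?_))
        exact fun h' ↦ hqp ((S.chart i).injOn hqs hi h')
  rcases isClopen_iff.1 hclopen with h | h
  · right
    rwa [interior_compl, Set.compl_empty_iff, ← dense_iff_closure_eq] at h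
  · left
    intro i z hz
    have hp := interior_subset (h ▸ Set.mem_univ ((S.chart i).symm z))
    have hs := (S.chart i).map_target hz
    by_contra h0
    refine hp ((hmem hs).2 ?_)
    rwa [(S.chart i).right_inv hz]

/-- A spinor-vortex space with `C = 0` is trivial or spherical. -/
theorem CVanishes.isTrivial_or_isSpherical [ConnectedSpace N] (hC : S.CVanishes) :
    S.IsTrivial ∨ S.IsSpherical := by
  refine hC.ψ_eq_zero_or_dense.imp (fun hψ i z₀ hz₀ ↦ ?_) (fun hD ↦ ?_)
  · obtain ⟨r, hr, hsub, s, hs0, hs⟩ := hC.exists_parallel_frame hz₀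
    -- When `ψ = 0` the real component of a parallel section is constant, so the section starting at
    -- `(1, 0)` stays in `W⁻¹TN` with unit length. Its conjugate `u` satisfies `∂̄u = -a u`.
    refine ⟨hC i z₀ hz₀, hψ i z₀ hz₀, Metric.ball z₀ r, Metric.isOpen_ball, Metric.mem_ball_self hr,
      hsub, fun z ↦ conj (s 0 z).1, ?_, fun z hz ↦ ⟨?_, ?_⟩⟩
    · exact Complex.conjCLE.contDiff.comp_contDiffOn (contDiffOn_of_isParallelAt Metric.isOpen_ball
        hsub fun z hz ↦ (hs z hz).1 0).fst
    · have hr0 : (s 0 z).2 = 0 := by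
        rw [eq_of_hasFDerivAt_zero_on_ball (f := fun z ↦ (s 0 z).2) (fun z hz ↦ ?_) hz, hs0]
        · rfl
        · refine ((hs z hz).1 0).snd.congr_fderiv ?_
          ext1 h
          simp [conn, connForm_apply, hψ i z (hsub hz)]
      have h1 := (hs z hz).2 0 0
      simp only [dot, hr0] at h1
      rw [← Complex.normSq_eq_conj_mul_self, Complex.ofReal_re, Complex.normSq_eq_norm_sq] at h1
      rw [RCLike.norm_conj]
      have : ‖(s 0 z).1‖ ^ 2 = 1 := by simpa using h1
      exact (pow_eq_one_iff_of_nonneg (norm_nonneg _) two_ne_zero).1 this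
    · have hp := (hs z hz).1 0
      rw [dzbar_conj hp.fst.differentiableAt, hp.dz_fst, hψ i z (hsub hz)]
      simp
      ring
  · refine ⟨fun i z hz ↦ ⟨hC i z hz, ?_⟩, hD, fun i z hz h0 ↦ ?_⟩
    · rw [hC.dbar_ψ hz, sub_self]
    · have hn := (S.chart i).open_target.mem_nhds hz
      rw [laplacian_log_norm ((S.ψ_smooth i).contDiffAt hn) (a_diff hz) h0
        (Filter.eventually_of_mem hn fun u hu ↦ hC.dbar_ψ hu)]
      have h := hC.curvature hz
      rw [Complex.add_conj, Complex.mul_conj, Complex.normSq_eq_norm_sq] at h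
      have h' : 2 * (dz (S.a i) z).re = -2 * ‖S.ψ i z‖ ^ 2 := by exact_mod_cast h
      linarith

end SpinorVortexSpace

end

section

/-! ### The coframe of a Hitchin field on `ℝ³` -/

/-- `zOf` as a linear map. -/
def zOfL : E3 →L[ℝ] ℂ := LinearMap.toContinuousLinearMap
  { toFun := zOf
    map_add' := fun u v ↦ by apply Complex.ext <;> simp [zOf]
    map_smul' := fun c u ↦ by apply Complex.ext <;> simp [zOf] }

theorem zOfL_apply (v : E3) : zOfL v = zOf v := rfl

theorem fderiv_eq_dz3 (f : E3 → ℂ) (y u : E3) :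
    fderiv ℝ f y u = dz3 f y * zOf u + dzbar3 f y * conj (zOf u) + dt3 f y * u 2 := by
  have hu : u = u 0 • EuclideanSpace.single (0 : Fin 3) (1 : ℝ)
      + u 1 • EuclideanSpace.single (1 : Fin 3) (1 : ℝ)
      + u 2 • EuclideanSpace.single (2 : Fin 3) (1 : ℝ) := by
    ext k
    fin_cases k <;> simp
  have hz : zOf u = u 0 + u 1 * Complex.I := by apply Complex.ext <;> simp [zOf]
  have hz' : conj (zOf u) = u 0 - u 1 * Complex.I := by apply Complex.ext <;> simp [zOf]
  conv_lhs => rw [hu]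
  rw [hz', hz, map_add, map_add, map_smul, map_smul, map_smul, dz3, dzbar3, dt3]
  simp only [Complex.real_smul]
  linear_combination (fderiv ℝ f y (EuclideanSpace.single 1 1) * u 1) * Complex.I_sq

/-- The part of `coframe` that is linear in `(Φ, α)`. -/
def coframeLin : ℂ × ℂ →L[ℝ] E3 →L[ℝ] ℂ × ℝ :=
  LinearMap.toContinuousLinearMap
    { toFun := fun p ↦ LinearMap.toContinuousLinearMap
        { toFun := fun v ↦ (2 * p.1 * zOfL v, 2 * (p.2 * zOfL v).re)
          map_add' := fun u v ↦ by ext <;> simp <;> ring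
          map_smul' := fun c v ↦ by ext <;> simp <;> ring }
      map_add' := fun p p' ↦ by ext <;> simp <;> ring
      map_smul' := fun c p ↦ by ext <;> simp <;> ring }

theorem coframeLin_apply (p q : ℂ) (v : E3) :
    coframeLin (p, q) v = (2 * p * zOf v, 2 * (q * zOf v).re) := rfl

/-- The vertical form `dt`, with values in `ℂ × ℝ`. -/
def dtL : E3 →L[ℝ] ℂ × ℝ := LinearMap.toContinuousLinearMap
  { toFun := fun v ↦ (0, v 2)
    map_add' := fun u v ↦ by ext <;> simp
    map_smul' := fun c v ↦ by ext <;> simp }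

theorem dtL_apply (v : E3) : dtL v = (0, v 2) := rfl

/-- The orthonormal coframe `(2 Φ dz, θ)` of `hitchinMetric`. -/
def coframe (Φ α : E3 → ℂ) (y : E3) : E3 →L[ℝ] ℂ × ℝ := dtL + coframeLin (Φ y, α y)

theorem coframe_apply (Φ α : E3 → ℂ) (y v : E3) :
    coframe Φ α y v = (2 * Φ y * zOf v, thetaForm α y v) := by
  simp [coframe, dtL_apply, coframeLin_apply, thetaForm]

theorem dot_coframe_self (Φ α : E3 → ℂ) (y v : E3) :
    dot (coframe Φ α y v) (coframe Φ α y v) = hitchinMetric Φ α y v := by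
  rw [coframe_apply, hitchinMetric, dot, ← Complex.normSq_eq_conj_mul_self, Complex.ofReal_re,
    Complex.normSq_eq_norm_sq]
  simp only [norm_mul, mul_pow]
  norm_num
  ring

theorem coframe_injective {Φ α : E3 → ℂ} {y : E3} (hΦ : Φ y ≠ 0) :
    Function.Injective (coframe Φ α y) := by
  rw [injective_iff_map_eq_zero]
  intro v hv
  rw [coframe_apply] at hv
  have h1 : zOf v = 0 := by simpa [hΦ] using congrArg Prod.fst hv
  have h2 : v 2 = 0 := by simpa [thetaForm, h1] using congrArg Prod.snd hv
  have h3 : v 0 = 0 := congrArg Complex.re h1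
  have h4 : v 1 = 0 := congrArg Complex.im h1
  ext k
  fin_cases k <;> simp [h2, h3, h4]

theorem hasFDerivAt_coframe {Φ α : E3 → ℂ} {y : E3} (hΦ : DifferentiableAt ℝ Φ y)
    (hα : DifferentiableAt ℝ α y) : HasFDerivAt (coframe Φ α)
      (coframeLin ∘L (fderiv ℝ Φ y).prod (fderiv ℝ α y)) y :=
  (coframeLin.hasFDerivAt.comp y (hΦ.hasFDerivAt.prodMk hα.hasFDerivAt)).const_add dtL

theorem conjFun_fderiv {f : E3 → ℂ} {y : E3} (hf : DifferentiableAt ℝ f y) :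
    fderiv ℝ (conjFun f) y = Complex.conjCLE.toContinuousLinearMap.comp (fderiv ℝ f y) :=
  (Complex.conjCLE.toContinuousLinearMap.hasFDerivAt.comp y hf.hasFDerivAt).fderiv

theorem dt3_conjFun {f : E3 → ℂ} {y : E3} (hf : DifferentiableAt ℝ f y) :
    dt3 (conjFun f) y = conj (dt3 f y) := by
  rw [dt3, conjFun_fderiv hf]; rfl

theorem dz3_conjFun {f : E3 → ℂ} {y : E3} (hf : DifferentiableAt ℝ f y) :
    dz3 (conjFun f) y = conj (dzbar3 f y) := by
  rw [dz3, dzbar3, conjFun_fderiv hf]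
  simp [map_ofNat, sub_eq_add_neg]

variable {ι N : Type*} [TopologicalSpace N] [ChartedSpace ℂ N] {S : SpinorVortexSpace ι N}

/-- The structure equations of the coframe `(2 Φ dz, θ)`. -/
theorem coframe_structure {i : ι} {Φ α : E3 → ℂ} {y : E3} (hΦ : DifferentiableAt ℝ Φ y)
    (hα : DifferentiableAt ℝ α y) (hΦ0 : Φ y ≠ 0) (hC : S.C i (zOf y) = 0)
    (h1 : (dzbar3 α y - dz3 (conjFun α) y + α y * dt3 (conjFun α) y - conjFun α y * dt3 α y)
          - (Φ y * dt3 (conjFun Φ) y - conjFun Φ y * dt3 Φ y) =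
        S.ψ i (zOf y) * conjFun Φ y - (starRingEnd ℂ) (S.ψ i (zOf y)) * Φ y)
    (h2 : dzbar3 Φ y - (conjFun α y * dt3 Φ y - Φ y * dt3 (conjFun α) y) - S.a i (zOf y) * Φ y =
        S.C i (zOf y) * conjFun Φ y) (u v : E3) :
    S.conn i (zOf y) (zOf u) (coframe Φ α y v) - S.conn i (zOf y) (zOf v) (coframe Φ α y u)
      - (coframeLin (fderiv ℝ Φ y u, fderiv ℝ α y u) v
        - coframeLin (fderiv ℝ Φ y v, fderiv ℝ α y v) u) =
      hitchinForm S i Φ α y u • coframe Φ α y v - hitchinForm S i Φ α y v • coframe Φ α y u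
        - ((S.ψ i (zOf y) + dt3 Φ y) / Φ y).im •
          cross (coframe Φ α y u) (coframe Φ α y v) := by
  rw [dz3_conjFun hα, dt3_conjFun hα, dt3_conjFun hΦ] at h1
  rw [dt3_conjFun hα, hC] at h2
  simp only [conjFun] at h1 h2
  have hu : (u 2 : ℝ) = thetaForm α y u - 2 * (α y * zOf u).re := by simp [thetaForm]
  have hv : (v 2 : ℝ) = thetaForm α y v - 2 * (α y * zOf v).re := by simp [thetaForm]
  -- The real part of `m` is the vertical coefficient of the Weyl form, up to sign; the imaginary
  -- part becomes the coefficient of the cross product and later gives `κ`.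
  set m := (S.ψ i (zOf y) + dt3 Φ y) / Φ y with hm
  have hψ : S.ψ i (zOf y) = m * Φ y - dt3 Φ y := by rw [hm]; field_simp; ring
  have hfu : hitchinForm S i Φ α y u = 2 * (dt3 α y * zOf u).re - m.re * thetaForm α y u := by
    simp [hitchinForm, hC, hm]
  have hfv : hitchinForm S i Φ α y v = 2 * (dt3 α y * zOf v).re - m.re * thetaForm α y v := by
    simp [hitchinForm, hC, hm]
  rw [hfu, hfv, SpinorVortexSpace.conn, fderiv_eq_dz3, fderiv_eq_dz3, fderiv_eq_dz3, fderiv_eq_dz3,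
    hu, hv, hψ]
  rw [hψ] at h1
  simp only [map_sub, map_mul] at h1
  simp only [coframe_apply, connForm_apply, coframeLin_apply, cross]
  clear_value m
  clear hfu hfv hψ hm hu hv
  generalize thetaForm α y u = τ at *
  generalize thetaForm α y v = τ' at *
  generalize zOf u = ζ at *
  generalize zOf v = ζ' at *
  generalize S.a i (zOf y) = a at *
  generalize dt3 Φ y = Φt at *
  generalize dt3 α y = αt at *
  generalize dz3 Φ y = Φz at *
  generalize dzbar3 Φ y = Φb at *
  generalize dz3 α y = αz at *
  generalize dzbar3 α y = αb at *
  generalize α y = A at *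
  generalize Φ y = P at *
  have him : ∀ w : ℂ, ((w.im : ℝ) : ℂ) = (w - conj w) / (2 * Complex.I) := Complex.im_eq_sub_conj
  ext1
  · simp only [Prod.fst_sub, Prod.smul_fst, Complex.real_smul, Complex.ofReal_mul,
      Complex.ofReal_sub, Complex.ofReal_ofNat, ofReal_re_eq, him, map_mul]
    field_simp
    -- The `ℂ`-component is the equation for `∂̄Φ`; the `ℝ`-component below is the equation for the
    -- curvature of `α`.
    linear_combination -2 * (conj ζ * ζ' - ζ * conj ζ') * h2
  · apply Complex.ofReal_injective
    simp only [Prod.snd_sub, Prod.smul_snd, smul_eq_mul, Complex.ofReal_mul,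
      Complex.ofReal_sub, Complex.ofReal_neg, Complex.ofReal_ofNat, ofReal_re_eq, him, map_mul,
      map_add, map_sub, map_div₀, Complex.conj_conj, Complex.conj_ofReal, map_ofNat]
    field_simp
    linear_combination -2 * Complex.I ^ 2 * (conj ζ * ζ' - ζ * conj ζ') * h1
      + 2 * (m - conj m) * P * conj P * (conj ζ * ζ' - ζ * conj ζ') * Complex.I_sq

end

/-! ### Brackets of lifted parallel sections -/

section

variable {ι N : Type*} [TopologicalSpace N] [ChartedSpace ℂ N] {S : SpinorVortexSpace ι N}

theorem cross_smul_smul (c c' : ℝ) (p q : ℂ × ℝ) :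
    cross (c • p) (c' • q) = (c * c') • cross p q := by
  simp only [cross]
  ext <;> simp <;> ring

/-- Two vector fields that correspond to parallel sections under the coframe `exp F • coframe Φ α`
satisfy the bracket relations of a hyperCR structure. -/
theorem coframe_lieBracket {i : ι} {Φ α : E3 → ℂ} {F : E3 → ℝ} {Y Y' : E3 → E3}
    {s s' : ℂ → ℂ × ℝ} {Ω : Set E3} (hH : IsHitchinField S i Φ α Ω) (hΩ : IsOpen Ω) {y : E3}
    (hy : y ∈ Ω) (hΦ0 : Φ y ≠ 0) (hC : S.C i (zOf y) = 0)
    (hF : DifferentiableAt ℝ F y) (hY : DifferentiableAt ℝ Y y) (hY' : DifferentiableAt ℝ Y' y)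
    (hs : S.IsParallelAt i s (zOf y)) (hs' : S.IsParallelAt i s' (zOf y))
    (h : ∀ᶠ p in 𝓝 y, Real.exp (F p) • coframe Φ α p (Y p) = s (zOf p))
    (h' : ∀ᶠ p in 𝓝 y, Real.exp (F p) • coframe Φ α p (Y' p) = s' (zOf p)) :
    Real.exp (F y) • coframe Φ α y (VectorField.lieBracket ℝ Y Y' y) =
      (hitchinForm S i Φ α y (Y y) - fderiv ℝ F y (Y y)) • s' (zOf y)
        - (hitchinForm S i Φ α y (Y' y) - fderiv ℝ F y (Y' y)) • s (zOf y)
        - (Real.exp (-F y) * ((S.ψ i (zOf y) + dt3 Φ y) / Φ y).im) •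
          cross (s (zOf y)) (s' (zOf y)) := by
  have hΦ : DifferentiableAt ℝ Φ y :=
    (hH.1.contDiffAt (hΩ.mem_nhds hy)).differentiableAt (by simp)
  have hα : DifferentiableAt ℝ α y :=
    (hH.2.1.contDiffAt (hΩ.mem_nhds hy)).differentiableAt (by simp)
  have hc := hasFDerivAt_coframe hΦ hα
  -- Differentiating `exp F • coframe Φ α (Y) = s ∘ zOf` and using that `s` is parallel gives the
  -- derivative of `Y` without derivatives of `s`.
  have key : ∀ {Y : E3 → E3} {s : ℂ → ℂ × ℝ}, DifferentiableAt ℝ Y y →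
      S.IsParallelAt i s (zOf y) →
      (∀ᶠ p in 𝓝 y, Real.exp (F p) • coframe Φ α p (Y p) = s (zOf p)) → ∀ u : E3,
      Real.exp (F y) • coframe Φ α y (fderiv ℝ Y y u) =
        S.conn i (zOf y) (zOf u) (s (zOf y)) - fderiv ℝ F y u • s (zOf y)
          - Real.exp (F y) • coframeLin (fderiv ℝ Φ y u, fderiv ℝ α y u) (Y y) := by
    intro Y s hY hs h u
    have h1 := hF.hasFDerivAt.exp.smul (hc.clm_apply hY.hasFDerivAt)
    have h2 : HasFDerivAt (fun p ↦ s (zOf p)) _ y := HasFDerivAt.comp y hs zOfL.hasFDerivAt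
    have h3 := congrArg (fun L ↦ L u) ((h1.congr_of_eventuallyEq
      (Filter.EventuallyEq.symm h)).unique h2)
    simp [zOfL_apply] at h3
    rw [← h3, ← h.self_of_nhds, smul_smul, mul_comm (fderiv ℝ F y u)]
    abel
  have k1 := key hY hs h (Y' y)
  have k2 := key hY' hs' h' (Y y)
  have hstr := coframe_structure hΦ hα hΦ0 hC (hH.2.2 y hy).1 (hH.2.2 y hy).2 (Y y) (Y' y)
  have e1 := h.self_of_nhds
  have e2 := h'.self_of_nhds
  have hexp : Real.exp (-F y) * Real.exp (F y) = 1 := by rw [← Real.exp_add]; simp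
  have hx : Real.exp (-F y) • cross (s (zOf y)) (s' (zOf y)) = Real.exp (F y) •
      cross (coframe Φ α y (Y y)) (coframe Φ α y (Y' y)) := by
    rw [← e1, ← e2, cross_smul_smul, smul_smul, ← mul_assoc, hexp, one_mul]
  rw [VectorField.lieBracket, map_sub, smul_sub, k1, k2, mul_comm, mul_smul, hx]
  have m1 : Real.exp (F y) • S.conn i (zOf y) (zOf (Y y)) (coframe Φ α y (Y' y)) =
      S.conn i (zOf y) (zOf (Y y)) (s' (zOf y)) := by rw [← e2, map_smul]
  have m2 : Real.exp (F y) • S.conn i (zOf y) (zOf (Y' y)) (coframe Φ α y (Y y)) =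
      S.conn i (zOf y) (zOf (Y' y)) (s (zOf y)) := by rw [← e1, map_smul]
  have hstr' := congrArg (fun p ↦ Real.exp (F y) • p) hstr
  simp only [smul_sub] at hstr'
  rw [m1, m2, smul_comm _ (hitchinForm S i Φ α y (Y y)),
    smul_comm _ (hitchinForm S i Φ α y (Y' y)), e1, e2,
    smul_comm _ ((S.ψ i (zOf y) + dt3 Φ y) / Φ y).im] at hstr'
  rw [sub_smul, sub_smul]
  linear_combination (exp := 1) hstr'

/-- A right inverse of the coframe. -/
def horLift (Φ α : E3 → ℂ) (y : E3) (p : ℂ × ℝ) : E3 :=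
  !₂[(p.1 / (2 * Φ y)).re, (p.1 / (2 * Φ y)).im, p.2 - 2 * (α y * (p.1 / (2 * Φ y))).re]

theorem coframe_horLift {Φ α : E3 → ℂ} {y : E3} (hΦ : Φ y ≠ 0) (p : ℂ × ℝ) :
    coframe Φ α y (horLift Φ α y p) = p := by
  have hz : zOf (horLift Φ α y p) = p.1 / (2 * Φ y) := by
    apply Complex.ext <;> simp [zOf, horLift]
  rw [coframe_apply, thetaForm, hz]
  ext1
  · simp only; field_simp
  · simp [horLift]

theorem contDiffAt_horLift {Φ α : E3 → ℂ} {p : E3 → ℂ × ℝ} {y : E3} (hΦ0 : Φ y ≠ 0)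
    (hΦ : ContDiffAt ℝ ∞ Φ y) (hα : ContDiffAt ℝ ∞ α y) (hp : ContDiffAt ℝ ∞ p y) :
    ContDiffAt ℝ ∞ (fun y ↦ horLift Φ α y (p y)) y := by
  have h1 : ContDiffAt ℝ ∞ (fun y ↦ (p y).1 / (2 * Φ y)) y := by
    simp only [div_eq_mul_inv]
    exact hp.fst.mul ((contDiffAt_const.mul hΦ).inv (by simpa using hΦ0))
  have h2 := hα.mul h1
  have re := fun {f : E3 → ℂ} (hf : ContDiffAt ℝ ∞ f y) ↦
    Complex.reCLM.contDiff.contDiffAt.comp y hf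
  have im := fun {f : E3 → ℂ} (hf : ContDiffAt ℝ ∞ f y) ↦
    Complex.imCLM.contDiff.contDiffAt.comp y hf
  rw [contDiffAt_euclidean]
  intro k
  fin_cases k
  · exact re h1
  · exact im h1
  · exact hp.snd.sub (contDiffAt_const.mul (re h2))

end

section

/-! ### Orthonormal frames with hyperCR brackets -/

theorem eq_sum_of_orthonormal {T : Type*} [AddCommGroup T] [Module ℝ T]
    (hT : Module.finrank ℝ T = 3) (g : T →ₗ[ℝ] T →ₗ[ℝ] ℝ) {X : Fin 3 → T}
    (hX : ∀ i j, g (X i) (X j) = if i = j then 1 else 0) (v : T) :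
    v = ∑ i, g v (X i) • X i := by
  have hli : LinearIndependent ℝ X := by
    rw [Fintype.linearIndependent_iff]
    intro c hc j
    have := congrArg (fun u ↦ g u (X j)) hc
    simpa [hX] using this
  have : FiniteDimensional ℝ T := Module.finite_of_finrank_pos (by omega)
  have hspan := hli.span_eq_top_of_card_eq_finrank (by simp [hT])
  have hv : v ∈ Submodule.span ℝ (Set.range X) := by rw [hspan]; trivial
  obtain ⟨c, rfl⟩ := (Submodule.mem_span_range_iff_exists_fun ℝ).1 hv
  simp [hX]

/-- Koszul's argument: an array skew in its last two indices is determined by its antisymmetrization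
in the first two. Here the latter is totally skew, and `A` is half of it. -/
theorem koszul_numbers {A : Fin 3 → Fin 3 → Fin 3 → ℝ} {κ : ℝ} (hA : ∀ j i k, A j i k = -A j k i)
    (hb : ∀ i k, A i (i + 1) k - A (i + 1) i k = -(2 * κ * if i + 2 = k then 1 else 0))
    (i j k : Fin 3) :
    A j i k = κ * ((if j = i + 1 then 1 else 0) * (if i + 2 = k then 1 else 0)
      - (if j = i + 2 then 1 else 0) * (if i + 1 = k then 1 else 0)) := by
  have e : (1 : Fin 3) + 1 = 2 ∧ (1 : Fin 3) + 2 = 0 ∧ (2 : Fin 3) + 1 = 0 ∧ (2 : Fin 3) + 2 = 1 :=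
    by decide
  have A0 := hA 0
  have A1 := hA 1
  have A2 := hA 2
  have B0 := hb 0
  have B1 := hb 1
  have B2 := hb 2
  clear hA hb
  simp only [Fin.forall_fin_succ, Fin.isValue, e, zero_add, Fin.succ_zero_eq_one,
    Fin.succ_one_eq_two, IsEmpty.forall_iff, and_true, Fin.reduceEq, if_true, if_false, mul_one,
    mul_zero, neg_zero] at A0 A1 A2 B0 B1 B2
  obtain ⟨⟨_, _, _⟩, ⟨_, _, _⟩, ⟨_, _, _⟩⟩ := A0
  obtain ⟨⟨_, _, _⟩, ⟨_, _, _⟩, ⟨_, _, _⟩⟩ := A1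
  obtain ⟨⟨_, _, _⟩, ⟨_, _, _⟩, ⟨_, _, _⟩⟩ := A2
  obtain ⟨_, _, _⟩ := B0
  obtain ⟨_, _, _⟩ := B1
  obtain ⟨_, _, _⟩ := B2
  fin_cases i <;> fin_cases j <;> fin_cases k <;>
    simp only [Fin.zero_eta, Fin.mk_one, Fin.reduceFinMk, Fin.isValue, e, zero_add, Fin.reduceEq,
      if_true, if_false, mul_one, mul_zero, sub_zero, sub_self, zero_sub] <;>
    linarith

/-- The Koszul formula in an orthonormal frame with constant, totally skew structure functions,
up to the conformal terms. -/
theorem koszul_frame {T : Type*} [AddCommGroup T] [Module ℝ T]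
    (hT : Module.finrank ℝ T = 3) (g : T →ₗ[ℝ] T →ₗ[ℝ] ℝ) (hg : ∀ u v, g u v = g v u)
    {X : Fin 3 → T} (hX : ∀ i j, g (X i) (X j) = if i = j then 1 else 0)
    (η : T →ₗ[ℝ] ℝ) (D : Fin 3 → T →ₗ[ℝ] T) (κ : ℝ)
    (hD : ∀ i j v, g (D i v) (X j) + g (X i) (D j v) = 2 * η v * if i = j then 1 else 0)
    (hb : ∀ i, D (i + 1) (X i) - D i (X (i + 1)) =
      η (X i) • X (i + 1) - η (X (i + 1)) • X i - (2 * κ) • X (i + 2)) (i : Fin 3) (v : T) :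
    D i v - η v • X i = κ • (g v (X (i + 1)) • X (i + 2) - g v (X (i + 2)) • X (i + 1)) := by
  have hΓ : ∀ i j k, g (D i (X j)) (X k) + g (D k (X j)) (X i) =
      2 * η (X j) * if i = k then 1 else 0 := fun i j k ↦ by
    rw [← hD i k (X j), hg (X i)]
  have hb' : ∀ i k, g (D (i + 1) (X i)) (X k) - g (D i (X (i + 1))) (X k) =
      η (X i) * (if i + 1 = k then 1 else 0) - η (X (i + 1)) * (if i = k then 1 else 0)
        - 2 * κ * (if i + 2 = k then 1 else 0) := fun i k ↦ by
    have := congrArg (fun u ↦ g u (X k)) (hb i)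
    simpa [hX] using this
  have hext : ∀ u u' : T, (∀ k, g u (X k) = g u' (X k)) → u = u' := fun u u' h ↦ by
    rw [eq_sum_of_orthonormal hT g hX u, eq_sum_of_orthonormal hT g hX u']
    simp [h]
  have hmain : ∀ j, D i (X j) - η (X j) • X i =
      κ • (g (X j) (X (i + 1)) • X (i + 2) - g (X j) (X (i + 2)) • X (i + 1)) := by
    intro j
    refine hext _ _ fun k ↦ ?_
    -- Subtracting `η` differentiates the weightless frame instead of `X`. This makes the
    -- coefficients skew and absorbs the `η`-terms of the brackets.
    have key := koszul_numbers (A := fun j i k ↦ g (D i (X j)) (X k) - η (X j) * if i = k then 1 else 0)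
      (κ := κ) (fun j i k ↦ by have := hΓ i j k; simp only [eq_comm (a := k)]; linarith)
      (fun i k ↦ by have := hb' i k; linarith) i j k
    simp only [map_sub, map_smul, LinearMap.sub_apply, LinearMap.smul_apply, smul_eq_mul, hX]
    exact key
  conv_lhs => rw [eq_sum_of_orthonormal hT g hX v]
  simp only [map_sum, map_smul, Finset.sum_smul]
  rw [← Finset.sum_sub_distrib]
  have hv : ∀ k, g v (X k) = ∑ j, g v (X j) * g (X j) (X k) := by intro k; simp [hX]
  rw [hv (i + 1), hv (i + 2), Finset.sum_smul, Finset.sum_smul, ← Finset.sum_sub_distrib,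
    Finset.smul_sum]
  refine Finset.sum_congr rfl fun j _ ↦ ?_
  rw [smul_eq_mul, mul_smul, ← smul_sub, hmain j]
  module

end

section

variable {B : Type*} [TopologicalSpace B] [ChartedSpace E3 B]

theorem finrank_tangentSpace (x : B) : Module.finrank ℝ (TangentSpace 𝓘(ℝ, E3) x) = 3 := by
  change Module.finrank ℝ E3 = 3
  simp

theorem deriv1_eq_zero_of_eventually_eq {f : B → ℝ} {x : B} {c : ℝ} (h : ∀ᶠ y in 𝓝 x, f y = c)
    (v : TangentSpace 𝓘(ℝ, E3) x) : deriv1 f x v = 0 := by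
  have : f =ᶠ[𝓝 x] fun _ ↦ c := h
  rw [deriv1, this.mfderiv_eq, mfderiv_const]
  rfl

/-! ### Vector fields in a chart -/

variable {φ : OpenPartialHomeomorph B E3}

theorem mdifferentiable_of_mem_maximalAtlas (hφ : φ ∈ IsManifold.maximalAtlas 𝓘(ℝ, E3) ∞ B) :
    φ.MDifferentiable 𝓘(ℝ, E3) 𝓘(ℝ, E3) :=
  ⟨(contMDiffOn_of_mem_maximalAtlas hφ).mdifferentiableOn (by simp),
    (contMDiffOn_symm_of_mem_maximalAtlas hφ).mdifferentiableOn (by simp)⟩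

theorem isInvertible_mfderiv_chart (hφ : φ ∈ IsManifold.maximalAtlas 𝓘(ℝ, E3) ∞ B) {x : B}
    (hx : x ∈ φ.source) : (mfderiv 𝓘(ℝ, E3) 𝓘(ℝ, E3) φ x).IsInvertible :=
  ⟨(mdifferentiable_of_mem_maximalAtlas hφ).mfderiv hx, rfl⟩

/-- The vector field on the domain of a chart with given components. -/
def chartField (φ : OpenPartialHomeomorph B E3) (Y : E3 → E3) (x : B) : TangentSpace 𝓘(ℝ, E3) x :=
  VectorField.mpullback 𝓘(ℝ, E3) 𝓘(ℝ, E3) φ Y x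

theorem chartDeriv_chartField (hφ : φ ∈ IsManifold.maximalAtlas 𝓘(ℝ, E3) ∞ B) {x : B}
    (hx : x ∈ φ.source) (Y : E3 → E3) : chartDeriv φ x (chartField φ Y x) = Y (φ x) :=
  (isInvertible_mfderiv_chart hφ hx).self_apply_inverse _

theorem chartDeriv_injective (hφ : φ ∈ IsManifold.maximalAtlas 𝓘(ℝ, E3) ∞ B) {x : B}
    (hx : x ∈ φ.source) : Function.Injective (chartDeriv φ x) :=
  (isInvertible_mfderiv_chart hφ hx).injective

variable [IsManifold 𝓘(ℝ, E3) ∞ B]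

namespace WeylStructure

variable (w : WeylStructure B)

/-- The inner product at a point as a bilinear form. -/
def bilin (x : B) : TangentSpace 𝓘(ℝ, E3) x →ₗ[ℝ] TangentSpace 𝓘(ℝ, E3) x →ₗ[ℝ] ℝ :=
  LinearMap.mk₂ ℝ (fun u v ↦ w.metric.inner x u v) (by simp) (by simp) (by simp) (by simp)

/-- A locally orthonormal frame whose brackets are of hyperCR type satisfies the hyperCR
equation. -/
theorem hyperCR_of_bracket {X : Fin 3 → ∀ x : B, TangentSpace 𝓘(ℝ, E3) x} {x : B} {κ : ℝ}
    (hd : ∀ i, DiffFieldAt (X i) x)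
    (ho : ∀ᶠ y in 𝓝 x, ∀ i j, w.metric.inner y (X i y) (X j y) = if i = j then 1 else 0)
    (hb : ∀ i, VectorField.mlieBracket 𝓘(ℝ, E3) (X i) (X (i + 1)) x =
      w.form x (X i x) • X (i + 1) x - w.form x (X (i + 1) x) • X i x - (2 * κ) • X (i + 2) x)
    (i : Fin 3) (v : TangentSpace 𝓘(ℝ, E3) x) :
    w.conn (X i) x v - w.form x v • X i x =
      κ • (w.metric.inner x v (X (i + 1) x) • X (i + 2) x
        - w.metric.inner x v (X (i + 2) x) • X (i + 1) x) := by
  have hto := w.torsion_free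
  rw [CovariantDerivative.torsion_eq_zero_iff] at hto
  refine koszul_frame (finrank_tangentSpace x) (w.bilin x) (fun u v ↦ w.metric.symm x u v)
    (X := fun i ↦ X i x) (fun i j ↦ ho.self_of_nhds i j) (w.form x).toLinearMap
    (fun i ↦ (w.conn (X i) x).toLinearMap) κ (fun i j v ↦ ?_) (fun i ↦ ?_) i v
  · have h := w.conformal x (X i) (X j) (hd i) (hd j) v
    rw [deriv1_eq_zero_of_eventually_eq (ho.mono fun y hy ↦ hy i j), ho.self_of_nhds i j] at h
    simp only [bilin, LinearMap.mk₂_apply, ContinuousLinearMap.coe_coe]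
    linarith
  · have h := hto (hd i) (hd (i + 1))
    exact h.trans (hb i)

end WeylStructure

theorem contMDiffAt_chartField (hφ : φ ∈ IsManifold.maximalAtlas 𝓘(ℝ, E3) ∞ B) {x : B}
    (hx : x ∈ φ.source) {Y : E3 → E3} (hY : ContDiffAt ℝ ∞ Y (φ x)) :
    ContMDiffAt 𝓘(ℝ, E3) (𝓘(ℝ, E3).prod 𝓘(ℝ, E3)) ∞
      (fun y ↦ (⟨y, chartField φ Y y⟩ : TangentBundle 𝓘(ℝ, E3) B)) x :=
  ContMDiffAt.mpullback_vectorField_preimage (m := ∞) (n := ∞)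
    (contMDiffAt_vectorSpace_iff_contDiffAt.2 hY) (contMDiffAt_of_mem_maximalAtlas hφ hx)
    (isInvertible_mfderiv_chart hφ hx) (by simp)

theorem chartDeriv_mlieBracket (hφ : φ ∈ IsManifold.maximalAtlas 𝓘(ℝ, E3) ∞ B) {x : B}
    (hx : x ∈ φ.source) {Y Y' : E3 → E3} (hY : ContDiffAt ℝ ∞ Y (φ x))
    (hY' : ContDiffAt ℝ ∞ Y' (φ x)) :
    chartDeriv φ x (VectorField.mlieBracket 𝓘(ℝ, E3) (chartField φ Y) (chartField φ Y') x) =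
      VectorField.lieBracket ℝ Y Y' (φ x) := by
  have h2 : (2 : ℕ∞ω) ≤ ∞ := ENat.LEInfty.out
  have := IsManifold.of_le (I := 𝓘(ℝ, E3)) (M := B) (m := minSmoothness ℝ 2) (n := ∞) (by simpa)
  have hd : ∀ {Y : E3 → E3}, ContDiffAt ℝ ∞ Y (φ x) →
      MDifferentiableAt 𝓘(ℝ, E3) (𝓘(ℝ, E3).prod 𝓘(ℝ, E3))
        (fun y ↦ (⟨y, Y y⟩ : TangentBundle 𝓘(ℝ, E3) E3)) (φ x) := fun hY ↦
    (contMDiffAt_vectorSpace_iff_contDiffAt.2 hY).mdifferentiableAt (by simp)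
  have h := VectorField.mpullback_mlieBracket (I := 𝓘(ℝ, E3)) (I' := 𝓘(ℝ, E3)) (hd hY) (hd hY')
    (contMDiffAt_of_mem_maximalAtlas hφ hx) (by simpa)
  have e := VectorField.mlieBracketWithin_eq_lieBracketWithin (𝕜 := ℝ) (E := E3) (V := Y) (W := Y') (s := Set.univ)
  rw [VectorField.lieBracketWithin_univ] at e
  change VectorField.mpullback 𝓘(ℝ, E3) 𝓘(ℝ, E3) φ (VectorField.mlieBracketWithin 𝓘(ℝ, E3) Y Y' Set.univ) x = _ at h
  rw [e] at h
  exact (congrArg (chartDeriv φ x) h).symm.trans (chartDeriv_chartField hφ hx _)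

end

/-! ### Generalized symmetries in charts -/

section

variable {ι N : Type*} [TopologicalSpace N] [ChartedSpace ℂ N]

/-- A complex differentiable map into a Riemann surface is real differentiable. -/
theorem mdifferentiableAt_restrictScalars {g : ℂ → N} {z : ℂ}
    (hg : MDifferentiableAt 𝓘(ℂ) 𝓘(ℂ) g z) : MDifferentiableAt 𝓘(ℝ, ℂ) 𝓘(ℝ, ℂ) g z := by
  rw [mdifferentiableAt_iff] at hg ⊢
  exact ⟨hg.1, hg.2.restrictScalars ℝ⟩

theorem deriv1_of_eventually_eq_comp {B : Type*} [TopologicalSpace B] [ChartedSpace E3 B]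
    {φ : OpenPartialHomeomorph B E3}
    (hφ : φ ∈ IsManifold.maximalAtlas 𝓘(ℝ, E3) ∞ B) {x : B} (hx : x ∈ φ.source) {f : B → ℝ}
    {G : E3 → ℝ} {G' : E3 →L[ℝ] ℝ} (hf : ∀ᶠ y in 𝓝 x, f y = G (φ y))
    (hG : HasFDerivAt G G' (φ x)) (v : TangentSpace 𝓘(ℝ, E3) x) :
    deriv1 f x v = G' (chartDeriv φ x v) := by
  have hm := mdifferentiable_of_mem_maximalAtlas hφ
  have h1 : f =ᶠ[𝓝 x] G ∘ φ := hf
  rw [deriv1, h1.mfderiv_eq, mfderiv_comp x hG.differentiableAt.mdifferentiableAt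
    (hm.mdifferentiableAt hx), mfderiv_eq_fderiv, hG.fderiv]
  rfl

variable {B : Type*} [TopologicalSpace B] [ChartedSpace E3 B] [IsManifold 𝓘(ℝ, E3) ∞ B]
  {K : Type*} {w : WeylStructure B} {S : SpinorVortexSpace ι N}

theorem dot_add_left (p p' q : ℂ × ℝ) : dot (p + p') q = dot p q + dot p' q := by
  simp [dot_eq]; ring

namespace GeneralizedSymmetry

variable (R : GeneralizedSymmetry K w S) {k l : K} {x : B}

/-- The conformal factor in a chart. -/
def scaleFun (k : K) (y : E3) : ℝ := R.scale k ((R.chart k).symm y)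

/-- The orthonormal coframe, with values in `ℂ × ℝ`, of a gauge of a generalized symmetry. -/
def cof (k : K) (x : B) : TangentSpace 𝓘(ℝ, E3) x →L[ℝ] ℂ × ℝ :=
  Real.exp (R.scale k x) • ((coframe (R.Φ k) (R.α k) (R.chart k x)).comp
    (mfderiv 𝓘(ℝ, E3) 𝓘(ℝ, E3) (R.chart k) x) : E3 →L[ℝ] ℂ × ℝ)

variable {R}

theorem cof_apply (v : TangentSpace 𝓘(ℝ, E3) x) : R.cof k x v =
    Real.exp (R.scale k x) • coframe (R.Φ k) (R.α k) (R.chart k x)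
      (chartDeriv (R.chart k) x v) := rfl

theorem scaleFun_chart (hx : x ∈ (R.chart k).source) :
    R.scaleFun k (R.chart k x) = R.scale k x := by
  rw [scaleFun, (R.chart k).left_inv hx]

theorem contDiffAt_scaleFun (hx : x ∈ (R.chart k).source) :
    ContDiffAt ℝ ∞ (R.scaleFun k) (R.chart k x) := by
  have h1 := (R.scale_smooth k).comp (contMDiffOn_symm_of_mem_maximalAtlas (R.chart_mem k))
    (fun y hy ↦ (R.chart k).map_target hy)
  exact (contMDiffOn_iff_contDiffOn.1 h1).contDiffAt
    ((R.chart k).open_target.mem_nhds ((R.chart k).map_source hx))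

theorem contDiffAt_Φ (hx : x ∈ (R.chart k).source) : ContDiffAt ℝ ∞ (R.Φ k) (R.chart k x) :=
  (R.hitchin k).1.contDiffAt ((R.chart k).open_target.mem_nhds ((R.chart k).map_source hx))

theorem contDiffAt_α (hx : x ∈ (R.chart k).source) : ContDiffAt ℝ ∞ (R.α k) (R.chart k x) :=
  (R.hitchin k).2.1.contDiffAt ((R.chart k).open_target.mem_nhds ((R.chart k).map_source hx))

theorem Φ_chart_ne_zero (hx : x ∈ (R.chart k).source) : R.Φ k (R.chart k x) ≠ 0 :=
  R.Φ_ne_zero k _ ((R.chart k).map_source hx)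

theorem deriv1_scale (hx : x ∈ (R.chart k).source) (v : TangentSpace 𝓘(ℝ, E3) x) :
    deriv1 (R.scale k) x v =
      fderiv ℝ (R.scaleFun k) (R.chart k x) (chartDeriv (R.chart k) x v) :=
  deriv1_of_eventually_eq_comp (R.chart_mem k) hx
    (by filter_upwards [(R.chart k).open_source.mem_nhds hx] with y hy
        using (scaleFun_chart hy).symm)
    ((contDiffAt_scaleFun hx).differentiableAt (by simp)).hasFDerivAt v

theorem form_eq_fderiv (hx : x ∈ (R.chart k).source) (v : TangentSpace 𝓘(ℝ, E3) x) :
    w.form x v = hitchinForm S (R.gauge k) (R.Φ k) (R.α k) (R.chart k x)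
      (chartDeriv (R.chart k) x v)
        - fderiv ℝ (R.scaleFun k) (R.chart k x) (chartDeriv (R.chart k) x v) := by
  rw [R.form_eq k x hx, deriv1_scale hx]

/-- Polarization: `metric_eq` prescribes only the quadratic form. -/
theorem inner_eq_dot (hx : x ∈ (R.chart k).source) (u v : TangentSpace 𝓘(ℝ, E3) x) :
    w.metric.inner x u v = dot (R.cof k x u) (R.cof k x v) := by
  have hq : ∀ v, w.metric.inner x v v = dot (R.cof k x v) (R.cof k x v) := by
    intro v
    rw [R.metric_eq k x hx, ← dot_coframe_self, cof_apply, two_mul, Real.exp_add]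
    simp only [dot_eq, Prod.smul_fst, Prod.smul_snd, Complex.smul_re, Complex.smul_im, smul_eq_mul]
    ring
  have h := hq (u + v)
  have hs := w.metric.symm x u v
  rw [map_add (R.cof k x), dot_add_left, dot_comm, dot_add_left, dot_comm _ (_ + _),
    dot_add_left, dot_comm (R.cof k x v) (R.cof k x u)] at h
  simp only [map_add, add_apply] at h
  linarith [hq u, hq v]

theorem cof_injective (hx : x ∈ (R.chart k).source) : Function.Injective (R.cof k x) := by
  intro u v h
  rw [cof_apply, cof_apply] at h
  exact chartDeriv_injective (R.chart_mem k) hx (coframe_injective (Φ_chart_ne_zero hx)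
    (smul_right_injective _ (Real.exp_ne_zero _) h))

theorem zOf_chart_mem (hx : x ∈ (R.chart k).source) :
    zOf (R.chart k x) ∈ (S.chart (R.gauge k)).target := by
  rw [← R.proj_eq k x hx]
  exact (S.chart _).map_source (R.proj_mem k x hx)

/-- Needed to apply the geodesic hypothesis to the coordinate field `∂_t`: near `x` the projection
factors through `zOf`. -/
theorem mfderiv_proj_eq_zero [IsManifold 𝓘(ℂ) ω N] (hx : x ∈ (R.chart k).source)
    {v : TangentSpace 𝓘(ℝ, E3) x} (hv : zOf (chartDeriv (R.chart k) x v) = 0) :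
    mfderiv 𝓘(ℝ, E3) 𝓘(ℝ, ℂ) R.proj x v = 0 := by
  have hm := mdifferentiable_of_mem_maximalAtlas (R.chart_mem k)
  have hg : MDifferentiableAt 𝓘(ℝ, ℂ) 𝓘(ℝ, ℂ) (S.chart (R.gauge k)).symm (zOf (R.chart k x)) :=
    mdifferentiableAt_restrictScalars ((contMDiffOn_symm_of_mem_maximalAtlas
      (S.chart_mem (R.gauge k))).contMDiffAt ((S.chart (R.gauge k)).open_target.mem_nhds
        (zOf_chart_mem hx))|>.mdifferentiableAt (by simp))
  have hz : MDifferentiableAt 𝓘(ℝ, E3) 𝓘(ℝ, ℂ) zOfL (R.chart k x) :=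
    zOfL.differentiableAt.mdifferentiableAt
  have h1 : R.proj =ᶠ[𝓝 x] ((S.chart (R.gauge k)).symm ∘ zOfL) ∘ R.chart k := by
    filter_upwards [(R.chart k).open_source.mem_nhds hx] with y hy
    simp only [Function.comp_apply, zOfL_apply]
    rw [← R.proj_eq k y hy, (S.chart _).left_inv (R.proj_mem k y hy)]
  have hg' : MDifferentiableAt 𝓘(ℝ, ℂ) 𝓘(ℝ, ℂ) (S.chart (R.gauge k)).symm
    (zOfL (R.chart k x)) := hg
  have hh := ((hg'.hasMFDerivAt.comp _ hz.hasMFDerivAt).comp x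
    (hm.mdifferentiableAt hx).hasMFDerivAt).congr_of_eventuallyEq h1
  rw [hh.mfderiv, mfderiv_eq_fderiv, ContinuousLinearMap.fderiv]
  change mfderiv 𝓘(ℝ, ℂ) 𝓘(ℝ, ℂ) (S.chart (R.gauge k)).symm (zOf (R.chart k x))
    (zOf (chartDeriv (R.chart k) x v)) = 0
  rw [hv]
  exact map_zero _

end GeneralizedSymmetry

end

/-! ### Geodesic fibres force `C = 0` -/

section

variable {ι N : Type*} [TopologicalSpace N] [ChartedSpace ℂ N]
  {B : Type*} [TopologicalSpace B] [ChartedSpace E3 B] [IsManifold 𝓘(ℝ, E3) ∞ B]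
  {K : Type*} {w : WeylStructure B} {S : SpinorVortexSpace ι N}

/-- The normal component of `D_V V` for a geodesic field `V` commuting with `H`. -/
theorem WeylStructure.geodesic_identity {V H : ∀ x : B, TangentSpace 𝓘(ℝ, E3) x} {x : B}
    (hV : DiffFieldAt V x) (hH : DiffFieldAt H x)
    (hVH : VectorField.mlieBracket 𝓘(ℝ, E3) V H x = 0) {c : ℝ} (hc : w.conn V x (V x) = c • V x) :
    2 * c * w.metric.inner x (V x) (H x) =
      2 * deriv1 (fun y ↦ w.metric.inner y (V y) (H y)) x (V x)
        + 4 * w.form x (V x) * w.metric.inner x (V x) (H x)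
        - deriv1 (fun y ↦ w.metric.inner y (V y) (V y)) x (H x)
        - 2 * w.form x (H x) * w.metric.inner x (V x) (V x) ∧
    2 * c * w.metric.inner x (V x) (V x) =
      deriv1 (fun y ↦ w.metric.inner y (V y) (V y)) x (V x)
        + 2 * w.form x (V x) * w.metric.inner x (V x) (V x) := by
  have hto := w.torsion_free
  rw [CovariantDerivative.torsion_eq_zero_iff] at hto
  -- Vanishing torsion and bracket give `D_V H = D_H V`, so the term `g(V, D_V H)` is governed by
  -- the derivative of `g(V, V)` along `H`.
  have ht := hto hV hH
  rw [hVH, sub_eq_zero] at ht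
  have h1 := w.conformal x V H hV hH (V x)
  have h2 := w.conformal x V V hV hV (H x)
  have h3 := w.conformal x V V hV hV (V x)
  rw [ht] at h1
  rw [hc] at h1 h3
  have hs := w.metric.symm x (V x) (w.conn V x (H x))
  simp only [map_smul, smul_apply, smul_eq_mul] at h1 h3
  constructor <;> linarith

namespace GeneralizedSymmetry

variable {R : GeneralizedSymmetry K w S} {k l : K} {x : B}

/-- `geodesic_identity` is applied to `∂_t` and the constant coordinate field `e`. The derivatives
of `α` and of the conformal scale, and the vertical part of the Weyl form, cancel; only the `C`-term
of that form survives. -/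
theorem IsGeodesic.re_eq_zero [IsManifold 𝓘(ℂ) ω N] (hR : R.IsGeodesic)
    (hx : x ∈ (R.chart k).source) {e : E3} (he : e 2 = 0) :
    (conj (S.C (R.gauge k) (zOf (R.chart k x))) * R.Φ k (R.chart k x)
      / conj (R.Φ k (R.chart k x)) * zOf e).re = 0 := by
  have hφ := R.chart_mem k
  set v : E3 := EuclideanSpace.single 2 1 with hv
  have hv2 : v 2 = 1 := by simp [hv]
  have hvz : zOf v = 0 := by apply Complex.ext <;> simp [zOf, hv]
  set V := chartField (R.chart k) fun _ ↦ v
  set H := chartField (R.chart k) fun _ ↦ e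
  have dV : ∀ y ∈ (R.chart k).source, chartDeriv (R.chart k) y (V y) = v := fun y hy ↦
    chartDeriv_chartField hφ hy _
  have dH : ∀ y ∈ (R.chart k).source, chartDeriv (R.chart k) y (H y) = e := fun y hy ↦
    chartDeriv_chartField hφ hy _
  have sV : ∀ y ∈ (R.chart k).source, _ := fun y hy ↦
    contMDiffAt_chartField hφ hy (Y := fun _ ↦ v) contDiffAt_const
  have sH := contMDiffAt_chartField hφ hx (Y := fun _ ↦ e) contDiffAt_const
  obtain ⟨c, hc⟩ := hR (R.chart k).source V (R.chart k).open_source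
    (fun y hy ↦ (sV y hy).contMDiffWithinAt)
    (fun y hy ↦ mfderiv_proj_eq_zero hy (by rw [dV y hy, hvz])) x hx
  have hbr : VectorField.mlieBracket 𝓘(ℝ, E3) V H x = 0 := by
    refine chartDeriv_injective hφ hx ?_
    rw [chartDeriv_mlieBracket hφ hx contDiffAt_const contDiffAt_const]
    simp [VectorField.lieBracket, chartDeriv]
    rfl
  obtain ⟨g1, g2⟩ := WeylStructure.geodesic_identity ((sV x hx).mdifferentiableAt (by simp))
    (sH.mdifferentiableAt (by simp)) hbr hc
  have hexp : ∀ t : ℝ, Real.exp (2 * t) = Real.exp t * Real.exp t := fun t ↦ by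
    rw [← Real.exp_add, two_mul]
  have iVH : ∀ y ∈ (R.chart k).source, w.metric.inner y (V y) (H y) =
      Real.exp (2 * R.scaleFun k (R.chart k y)) * (2 * (R.α k (R.chart k y) * zOf e).re) := by
    intro y hy
    rw [inner_eq_dot hy, cof_apply, cof_apply, dV y hy, dH y hy, coframe_apply, coframe_apply,
      scaleFun_chart hy, hexp]
    simp [dot_eq, thetaForm, hv2, hvz, he]
    ring
  have iVV : ∀ y ∈ (R.chart k).source, w.metric.inner y (V y) (V y) =
      Real.exp (2 * R.scaleFun k (R.chart k y)) := by
    intro y hy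
    rw [inner_eq_dot hy, cof_apply, dV y hy, coframe_apply,
      scaleFun_chart hy, hexp]
    simp [dot_eq, thetaForm, hv2, hvz]
  have hnhd := (R.chart k).open_source.mem_nhds hx
  have hF := ((contDiffAt_scaleFun hx).differentiableAt (by simp)).hasFDerivAt
  have hE := (hF.const_mul 2).exp
  have hα := ((contDiffAt_α hx).differentiableAt (by simp)).hasFDerivAt
  have hA := ((Complex.reCLM.hasFDerivAt.comp _ (hα.mul_const (zOf e))).const_mul 2)
  have d1 := deriv1_of_eventually_eq_comp hφ hx (Filter.eventually_of_mem hnhd iVV) hE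
  have d2 := deriv1_of_eventually_eq_comp hφ hx (Filter.eventually_of_mem hnhd iVH) (hE.mul hA)
  rw [d1, d2, iVV x hx, iVH x hx, form_eq_fderiv hx, form_eq_fderiv hx, dV x hx, dH x hx] at g1
  rw [d1, iVV x hx, form_eq_fderiv hx, dV x hx] at g2
  have hdt : fderiv ℝ (R.α k) (R.chart k x) v = dt3 (R.α k) (R.chart k x) := rfl
  have hE0 := Real.exp_ne_zero (2 * R.scaleFun k (R.chart k x))
  simp [hitchinForm, hvz, thetaForm, hv2, he, conjFun, hdt] at g1 g2
  have h2Q : 2 * conj (S.C (R.gauge k) (zOf (R.chart k x))) * R.Φ k (R.chart k x)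
      / conj (R.Φ k (R.chart k x)) = 2 * (conj (S.C (R.gauge k) (zOf (R.chart k x))) *
        R.Φ k (R.chart k x) / conj (R.Φ k (R.chart k x))) := by ring
  rw [h2Q] at g1
  clear h2Q
  generalize conj (S.C (R.gauge k) (zOf (R.chart k x))) *
        R.Φ k (R.chart k x) / conj (R.Φ k (R.chart k x)) = Q at *
  refine mul_left_cancel₀ hE0 ?_
  simp only [Complex.mul_re, Complex.mul_im, Complex.re_ofNat, Complex.im_ofNat] at g1 ⊢
  -- The multiple of `g2` removes the unknown factor `c`; `2 Re(α dz(e))` is `θ(e)`.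
  linear_combination (-1 / 8 : ℝ) * (g1 - 2 * ((R.α k (R.chart k x)).re * (zOf e).re
    - (R.α k (R.chart k x)).im * (zOf e).im) * g2)

/-- The directions `∂_x` and `∂_y` give the real and imaginary parts of `C̄ Φ / Φ̄`. Surjectivity of
the projection reaches every point of `N`, and `C_trans` reaches every gauge. -/
theorem IsGeodesic.cVanishes [IsManifold 𝓘(ℂ) ω N] (hR : R.IsGeodesic) : S.CVanishes := by
  intro i z hz
  obtain ⟨x, hx⟩ := R.proj_surjective ((S.chart i).symm z)
  obtain ⟨k, hk⟩ := R.cover x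
  have hC : S.C (R.gauge k) (zOf (R.chart k x)) = 0 := by
    have h0 := hR.re_eq_zero hk (e := EuclideanSpace.single 0 1) (by simp)
    have h1 := hR.re_eq_zero hk (e := EuclideanSpace.single 1 1) (by simp)
    have z0 : zOf (EuclideanSpace.single 0 1) = 1 := by apply Complex.ext <;> simp [zOf]
    have z1 : zOf (EuclideanSpace.single 1 1) = Complex.I := by apply Complex.ext <;> simp [zOf]
    rw [z0, mul_one] at h0
    rw [z1, Complex.mul_I_re, neg_eq_zero] at h1
    have h2 : conj (S.C (R.gauge k) (zOf (R.chart k x))) * R.Φ k (R.chart k x)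
      / conj (R.Φ k (R.chart k x)) = 0 := Complex.ext h0 h1
    simpa [Φ_chart_ne_zero hk] using h2
  have hi : R.proj x ∈ (S.chart i).source := by
    rw [hx]; exact (S.chart i).map_target hz
  have hC' := S.C_trans i (R.gauge k) (R.proj x) ⟨hi, R.proj_mem k x hk⟩
  rw [R.proj_eq k x hk, hC, mul_zero, hx, (S.chart i).right_inv hz] at hC'
  have hov : z ∈ S.overlap i (R.gauge k) :=
    ⟨hz, by rw [Set.mem_preimage, ← hx]; exact R.proj_mem k x hk⟩
  exact (mul_eq_zero.1 hC').resolve_right (SpinorVortexSpace.dcoord_ne_zero hov)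

end GeneralizedSymmetry

end

/-! ### Lifting parallel triples to hyperCR frames -/

section

variable {ι N : Type*} [TopologicalSpace N] [ChartedSpace ℂ N]
  {B : Type*} [TopologicalSpace B] [ChartedSpace E3 B] [IsManifold 𝓘(ℝ, E3) ∞ B]
  {K : Type*} {w : WeylStructure B} {S : SpinorVortexSpace ι N}

/-- `s` is an orthonormal triple of parallel sections on the open set `O`. -/
structure SpinorVortexSpace.IsParallelTriple (S : SpinorVortexSpace ι N) (i : ι)
    (s : Fin 3 → ℂ → ℂ × ℝ) (O : Set ℂ) : Prop where
  isOpen : IsOpen O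
  subset : O ⊆ (S.chart i).target
  parallel : ∀ j, ∀ z ∈ O, S.IsParallelAt i (s j) z
  orthonormal : ∀ z ∈ O, IsOrthonormalTriple fun j ↦ s j z

theorem SpinorVortexSpace.IsParallelTriple.contDiffAt {i : ι}
    {s : Fin 3 → ℂ → ℂ × ℝ} {O : Set ℂ} (hs : S.IsParallelTriple i s O) (j : Fin 3) {z : ℂ}
    (hz : z ∈ O) : ContDiffAt ℝ ∞ (s j) z :=
  (contDiffOn_of_isParallelAt hs.isOpen hs.subset (hs.parallel j)).contDiffAt
    (hs.isOpen.mem_nhds hz)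

theorem contDiff_triple {E : Type*} [NormedAddCommGroup E] [NormedSpace ℝ E]
    {s : Fin 3 → E → ℂ × ℝ} {z : E} (hs : ∀ j, ContDiffAt ℝ ∞ (s j) z) :
    ContDiffAt ℝ ∞ (fun z ↦ triple fun j ↦ s j z) z := by
  have re : ∀ j, ContDiffAt ℝ ∞ (fun z ↦ (s j z).1.re) z := fun j ↦
    Complex.reCLM.contDiff.contDiffAt.comp z (hs j).fst
  have im : ∀ j, ContDiffAt ℝ ∞ (fun z ↦ (s j z).1.im) z := fun j ↦
    Complex.imCLM.contDiff.contDiffAt.comp z (hs j).fst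
  have sn : ∀ j, ContDiffAt ℝ ∞ (fun z ↦ (s j z).2) z := fun j ↦ (hs j).snd
  simp only [triple, cross, dot_eq, Complex.mul_re, Complex.mul_im, Complex.I_re, Complex.I_im,
    Complex.sub_re, Complex.sub_im, Complex.ofReal_re, Complex.ofReal_im, Complex.conj_re,
    Complex.conj_im]
  fun_prop

namespace GeneralizedSymmetry

variable (R : GeneralizedSymmetry K w S) {k l : K} {x : B}

/-- The frame `X` is near `x` the lift of the parallel triple `s` in the gauge `k`. -/
structure IsLiftAt (k : K) (s : Fin 3 → ℂ → ℂ × ℝ) (O : Set ℂ)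
    (X : Fin 3 → ∀ x : B, TangentSpace 𝓘(ℝ, E3) x) (x : B) : Prop where
  mem_source : x ∈ (R.chart k).source
  triple : S.IsParallelTriple (R.gauge k) s O
  mem : zOf (R.chart k x) ∈ O
  cof_eq : ∀ᶠ y in 𝓝 x, ∀ i, R.cof k y (X i y) = s i (zOf (R.chart k y))

/-- The frame `X` is near `x` the lift of a parallel orthonormal triple. -/
def IsParallelFrameAt (X : Fin 3 → ∀ x : B, TangentSpace 𝓘(ℝ, E3) x) (x : B) : Prop :=
  ∃ k s O, R.IsLiftAt k s O X x

/-- The vector field with given value of the coframe. -/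
def liftField (k : K) (s : ℂ → ℂ × ℝ) : ∀ x : B, TangentSpace 𝓘(ℝ, E3) x :=
  chartField (R.chart k) fun y ↦
    horLift (R.Φ k) (R.α k) y (Real.exp (-R.scaleFun k y) • s (zOf y))

variable {R} {s : Fin 3 → ℂ → ℂ × ℝ} {O : Set ℂ} {X : Fin 3 → ∀ x : B, TangentSpace 𝓘(ℝ, E3) x}

theorem continuousAt_zOf_chart (hx : x ∈ (R.chart k).source) :
    ContinuousAt (fun y ↦ zOf (R.chart k y)) x :=
  zOfL.continuous.continuousAt.comp ((R.chart k).continuousAt hx)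

theorem cof_liftField (hx : x ∈ (R.chart k).source) (s : ℂ → ℂ × ℝ) :
    R.cof k x (R.liftField k s x) = s (zOf (R.chart k x)) := by
  rw [cof_apply, liftField, chartDeriv_chartField (R.chart_mem k) hx,
    coframe_horLift (Φ_chart_ne_zero hx), scaleFun_chart hx, smul_smul, ← Real.exp_add]
  simp

theorem contDiffAt_horLift_section (hx : x ∈ (R.chart k).source) {s : ℂ → ℂ × ℝ}
    (hs : ContDiffAt ℝ ∞ s (zOf (R.chart k x))) :
    ContDiffAt ℝ ∞ (fun y ↦ horLift (R.Φ k) (R.α k) y (Real.exp (-R.scaleFun k y) • s (zOf y)))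
      (R.chart k x) :=
  contDiffAt_horLift (Φ_chart_ne_zero hx) (contDiffAt_Φ hx) (contDiffAt_α hx)
    ((contDiffAt_scaleFun hx).neg.exp.smul (ContDiffAt.comp _ hs zOfL.contDiff.contDiffAt))

namespace IsLiftAt

theorem eventually (h : R.IsLiftAt k s O X x) : ∀ᶠ y in 𝓝 x, R.IsLiftAt k s O X y := by
  filter_upwards [(R.chart k).open_source.mem_nhds h.mem_source,
    (continuousAt_zOf_chart h.mem_source).preimage_mem_nhds (h.triple.isOpen.mem_nhds h.mem),
    h.cof_eq.eventually_nhds] with y h1 h2 h3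
  exact ⟨h1, h.triple, h2, h3⟩

/-- Injectivity of the coframe determines the frame from `s`, so smoothness and brackets can be
computed for the explicit fields `liftField`. -/
theorem eq_liftField (h : R.IsLiftAt k s O X x) (i : Fin 3) :
    ∀ᶠ y in 𝓝 x, X i y = R.liftField k (s i) y := by
  filter_upwards [h.eventually] with y hy
  refine cof_injective hy.mem_source ?_
  rw [hy.cof_eq.self_of_nhds i, cof_liftField hy.mem_source]

theorem contMDiffAt (h : R.IsLiftAt k s O X x) (i : Fin 3) :
    ContMDiffAt 𝓘(ℝ, E3) (𝓘(ℝ, E3).prod 𝓘(ℝ, E3)) ∞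
      (fun y ↦ (⟨y, X i y⟩ : TangentBundle 𝓘(ℝ, E3) B)) x := by
  refine (contMDiffAt_chartField (R.chart_mem k) h.mem_source
    (contDiffAt_horLift_section h.mem_source (h.triple.contDiffAt i h.mem))).congr_of_eventuallyEq ?_
  filter_upwards [h.eq_liftField i] with y hy
  rw [hy]
  rfl

theorem inner_eq (h : R.IsLiftAt k s O X x) (i j : Fin 3) :
    w.metric.inner x (X i x) (X j x) = if i = j then 1 else 0 := by
  rw [inner_eq_dot h.mem_source, h.cof_eq.self_of_nhds, h.cof_eq.self_of_nhds]
  exact h.triple.orthonormal _ h.mem i j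

end IsLiftAt

variable (R) in
/-- The function `κ` of the hyperCR structure of a lifted frame. -/
def kappa (k : K) (s : Fin 3 → ℂ → ℂ × ℝ) (y : E3) : ℝ :=
  Real.exp (-R.scaleFun k y) * ((S.ψ (R.gauge k) (zOf y) + dt3 (R.Φ k) y) / R.Φ k y).im
    * triple (fun j ↦ s j (zOf y)) / 2

namespace IsLiftAt

theorem contMDiffAt_kappa (h : R.IsLiftAt k s O X x) :
    ContMDiffAt 𝓘(ℝ, E3) 𝓘(ℝ) ∞ (fun y ↦ R.kappa k s (R.chart k y)) x := by
  have hx := h.mem_source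
  have hψ : ContDiffAt ℝ ∞ (fun y ↦ S.ψ (R.gauge k) (zOf y)) (R.chart k x) :=
    ContDiffAt.comp _ ((S.ψ_smooth _).contDiffAt ((S.chart _).open_target.mem_nhds
      (zOf_chart_mem hx))) zOfL.contDiff.contDiffAt
  have hdt : ContDiffAt ℝ ∞ (dt3 (R.Φ k)) (R.chart k x) :=
    ((contDiffAt_Φ hx).fderiv_right (m := ∞) (by simp)).clm_apply contDiffAt_const
  have hq : ContDiffAt ℝ ∞ (fun y ↦ (S.ψ (R.gauge k) (zOf y) + dt3 (R.Φ k) y) / R.Φ k y)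
      (R.chart k x) := by
    simp only [div_eq_mul_inv]
    exact (hψ.add hdt).mul ((contDiffAt_Φ hx).inv (Φ_chart_ne_zero hx))
  have him := Complex.imCLM.contDiff.contDiffAt.comp _ hq
  have htr : ContDiffAt ℝ ∞ (fun y ↦ EinsteinWeyl.triple fun j ↦ s j (zOf y)) (R.chart k x) :=
    contDiff_triple fun j ↦ ContDiffAt.comp (R.chart k x) (h.triple.contDiffAt j h.mem)
      zOfL.contDiff.contDiffAt
  have hk : ContDiffAt ℝ ∞ (R.kappa k s) (R.chart k x) :=
    (((contDiffAt_scaleFun hx).neg.exp.mul him).mul htr).div_const 2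
  exact hk.contMDiffAt.comp x (contMDiffAt_of_mem_maximalAtlas (R.chart_mem k) hx)

/-- `hitchinForm` minus the derivative of the scale is the Weyl form, and the cross product of two
members of the triple is `triple` times the third. The half in `kappa` yields the factor `2κ`. -/
theorem mlieBracket_eq (hC : S.CVanishes) (h : R.IsLiftAt k s O X x) (i : Fin 3) :
    VectorField.mlieBracket 𝓘(ℝ, E3) (X i) (X (i + 1)) x =
      w.form x (X i x) • X (i + 1) x - w.form x (X (i + 1) x) • X i x
        - (2 * R.kappa k s (R.chart k x)) • X (i + 2) x := by
  have hx := h.mem_source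
  have hφ := R.chart_mem k
  have sm : ∀ i, _ := fun i ↦ contDiffAt_horLift_section hx (h.triple.contDiffAt i h.mem)
  have hcof : ∀ i, ∀ᶠ p in 𝓝 (R.chart k x), Real.exp (R.scaleFun k p) • coframe (R.Φ k) (R.α k) p
      (horLift (R.Φ k) (R.α k) p (Real.exp (-R.scaleFun k p) • s i (zOf p))) = s i (zOf p) := by
    intro i
    filter_upwards [(R.chart k).open_target.mem_nhds ((R.chart k).map_source hx)] with p hp
    rw [coframe_horLift (R.Φ_ne_zero k p hp), smul_smul, ← Real.exp_add]
    simp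
  have hb := coframe_lieBracket (R.hitchin k) (R.chart k).open_target ((R.chart k).map_source hx)
    (Φ_chart_ne_zero hx) (hC _ _ (zOf_chart_mem hx))
    ((contDiffAt_scaleFun hx).differentiableAt (by simp))
    ((sm i).differentiableAt (by simp)) ((sm (i + 1)).differentiableAt (by simp))
    (h.triple.parallel i _ h.mem) (h.triple.parallel (i + 1) _ h.mem) (hcof i) (hcof (i + 1))
  rw [Filter.EventuallyEq.mlieBracket_vectorField_eq (h.eq_liftField i) (h.eq_liftField (i + 1))]
  refine cof_injective hx ?_
  have hX : ∀ i, chartDeriv (R.chart k) x (X i x) = horLift (R.Φ k) (R.α k) (R.chart k x)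
      (Real.exp (-R.scaleFun k (R.chart k x)) • s i (zOf (R.chart k x))) := fun i ↦ by
    rw [(h.eq_liftField i).self_of_nhds, liftField, chartDeriv_chartField hφ hx]
  rw [← hX, ← hX, ← form_eq_fderiv hx, ← form_eq_fderiv hx,
    (h.triple.orthonormal _ h.mem).cross_eq i] at hb
  rw [map_sub, map_sub, map_smul, map_smul, map_smul, h.cof_eq.self_of_nhds,
    h.cof_eq.self_of_nhds, h.cof_eq.self_of_nhds, cof_apply, liftField, liftField,
    chartDeriv_mlieBracket hφ hx (sm i) (sm (i + 1)), ← scaleFun_chart hx, hb, smul_smul, kappa]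
  congr 2
  ring

/-- The hyperCR equation for a lifted frame. -/
theorem hyperCR (hC : S.CVanishes) (h : R.IsLiftAt k s O X x) (i : Fin 3)
    (v : TangentSpace 𝓘(ℝ, E3) x) :
    w.conn (X i) x v - w.form x v • X i x =
      R.kappa k s (R.chart k x) • (w.metric.inner x v (X (i + 1) x) • X (i + 2) x
        - w.metric.inner x v (X (i + 2) x) • X (i + 1) x) :=
  w.hyperCR_of_bracket (fun i ↦ (h.contMDiffAt i).mdifferentiableAt (by simp))
    (h.eventually.mono fun _ hy ↦ hy.inner_eq) (h.mlieBracket_eq hC) i v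

end IsLiftAt

/-- Parallel frames exist locally. -/
theorem exists_isParallelFrameAt (hC : S.CVanishes) (x : B) : ∃ X, R.IsParallelFrameAt X x := by
  obtain ⟨k, hk⟩ := R.cover x
  obtain ⟨r, hr, hsub, s, -, hs⟩ := hC.exists_parallel_frame (zOf_chart_mem hk)
  refine ⟨fun i ↦ R.liftField k (s i), k, s, Metric.ball (zOf (R.chart k x)) r, hk,
    ⟨Metric.isOpen_ball, hsub, fun j z hz ↦ (hs z hz).1 j, fun z hz ↦ (hs z hz).2⟩,
    Metric.mem_ball_self hr, ?_⟩
  filter_upwards [(R.chart k).open_source.mem_nhds hk] with y hy i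
  exact cof_liftField hy _

theorem IsParallelFrameAt.eventually (h : R.IsParallelFrameAt X x) :
    ∀ᶠ y in 𝓝 x, R.IsParallelFrameAt X y := by
  obtain ⟨k, s, O, h⟩ := h
  exact h.eventually.mono fun y hy ↦ ⟨k, s, O, hy⟩

/-- A frame that is everywhere parallel is a hyperCR frame. -/
theorem isHyperCROn_of_isParallelFrameAt (hC : S.CVanishes) {V : Set B}
    (h : ∀ x ∈ V, R.IsParallelFrameAt X x) : w.IsHyperCROn V := by
  -- Reading `κ` off the component of `D χ₀` along `X 1` and `X 2` makes it visibly independent of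
  -- the chart.
  set κ : B → ℝ := fun x ↦
    w.metric.inner x (w.conn (X 0) x (X 1 x) - w.form x (X 1 x) • X 0 x) (X 2 x) with hκ
  have key : ∀ {k s O x}, R.IsLiftAt k s O X x → κ x = R.kappa k s (R.chart k x) := by
    intro k s O x h
    rw [hκ]
    beta_reduce
    rw [h.hyperCR hC, zero_add, zero_add, h.inner_eq, h.inner_eq]
    simp [h.inner_eq]
  refine ⟨X, κ, ⟨fun i x hx ↦ ?_, fun x hx ↦ ?_⟩, fun x hx ↦ ?_, fun x hx i v ↦ ?_⟩
  · obtain ⟨k, s, O, h⟩ := h x hx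
    exact (h.contMDiffAt i).contMDiffWithinAt
  · obtain ⟨k, s, O, h⟩ := h x hx
    exact h.inner_eq
  · obtain ⟨k, s, O, h⟩ := h x hx
    exact (h.contMDiffAt_kappa.congr_of_eventuallyEq
      (h.eventually.mono fun y hy ↦ key hy)).contMDiffWithinAt
  · obtain ⟨k, s, O, h⟩ := h x hx
    rw [key h]
    exact h.hyperCR hC i v

end GeneralizedSymmetry

end

/-! ### Change of chart -/

section

variable {ι N : Type*} [TopologicalSpace N] [ChartedSpace ℂ N]
  {B : Type*} [TopologicalSpace B] [ChartedSpace E3 B] [IsManifold 𝓘(ℝ, E3) ∞ B]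
  {K : Type*} {w : WeylStructure B} {S : SpinorVortexSpace ι N}

namespace GeneralizedSymmetry

variable {R : GeneralizedSymmetry K w S} {k l : K} {x : B}

theorem coordChange_zOf (hk : x ∈ (R.chart k).source) (hl : x ∈ (R.chart l).source) :
    S.coordChange (R.gauge k) (R.gauge l) (zOf (R.chart k x)) = zOf (R.chart l x) := by
  rw [← R.proj_eq k x hk, ← R.proj_eq l x hl, SpinorVortexSpace.coordChange,
    (S.chart _).left_inv (R.proj_mem k x hk)]

theorem transC_zOf (hk : x ∈ (R.chart k).source) :
    S.transC (R.gauge k) (R.gauge l) (zOf (R.chart k x)) =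
      S.trans (R.gauge k) (R.gauge l) (R.proj x) := by
  rw [← R.proj_eq k x hk, SpinorVortexSpace.transC, (S.chart _).left_inv (R.proj_mem k x hk)]

theorem zOf_mem_overlap (hk : x ∈ (R.chart k).source) (hl : x ∈ (R.chart l).source) :
    zOf (R.chart k x) ∈ S.overlap (R.gauge k) (R.gauge l) := by
  rw [← R.proj_eq k x hk]
  exact SpinorVortexSpace.chart_mem_overlap (R.proj_mem k x hk) (R.proj_mem l x hl)

theorem zOf_chartDeriv_change (hk : x ∈ (R.chart k).source) (hl : x ∈ (R.chart l).source)
    (v : TangentSpace 𝓘(ℝ, E3) x) : zOf (chartDeriv (R.chart l) x v) =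
      S.dcoord (R.gauge k) (R.gauge l) (zOf (R.chart k x)) * zOf (chartDeriv (R.chart k) x v) := by
  have h1 : ∀ {k : K}, x ∈ (R.chart k).source → HasMFDerivAt 𝓘(ℝ, E3) 𝓘(ℝ, ℂ)
      (fun y ↦ zOfL (R.chart k y)) x _ := fun {k} hk ↦
    (zOfL.hasFDerivAt.hasMFDerivAt).comp x
      ((mdifferentiable_of_mem_maximalAtlas (R.chart_mem k)).mdifferentiableAt hk).hasMFDerivAt
  have hc := ((SpinorVortexSpace.hasDerivAt_coordChange
    (zOf_mem_overlap hk hl)).hasFDerivAt.restrictScalars ℝ).hasMFDerivAt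
  have h2 := HasMFDerivAt.comp (g := S.coordChange (R.gauge k) (R.gauge l)) x hc (h1 hk)
  have e : (fun y ↦ zOfL (R.chart l y)) =ᶠ[𝓝 x]
      S.coordChange (R.gauge k) (R.gauge l) ∘ fun y ↦ zOfL (R.chart k y) := by
    filter_upwards [(R.chart k).open_source.mem_nhds hk, (R.chart l).open_source.mem_nhds hl]
      with y hy hy'
    exact (coordChange_zOf hy hy').symm
  have h3 := hasMFDerivAt_unique (h1 hl) (h2.congr_of_eventuallyEq e)
  have h4 := congrArg (fun L ↦ L v) h3
  refine h4.trans ?_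
  change zOf (chartDeriv (R.chart k) x v) * S.dcoord (R.gauge k) (R.gauge l) (zOf (R.chart k x)) = _
  ring

/-- The ratio of the lengths of the vertical coordinate fields of two charts. -/
theorem exists_vertical_ratio (hk : x ∈ (R.chart k).source) (hl : x ∈ (R.chart l).source) :
    ∃ σ : ℝ, R.Φ k (R.chart k x) * σ =
        S.trans (R.gauge k) (R.gauge l) (R.proj x) * R.Φ l (R.chart l x) ∧
      Real.exp (R.scale k x) ^ 2 = (Real.exp (R.scale l x) * σ) ^ 2 ∧
      ∀ v : TangentSpace 𝓘(ℝ, E3) x, Real.exp (R.scale k x) * (R.cof k x v).2 =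
        Real.exp (R.scale l x) * σ * (R.cof l x v).2 := by
  set e : E3 := EuclideanSpace.single 2 1 with he
  have he2 : e 2 = 1 := by simp [he]
  have hez : zOf e = 0 := by apply Complex.ext <;> simp [zOf, he]
  set v₀ : TangentSpace 𝓘(ℝ, E3) x := chartField (R.chart k) (fun _ ↦ e) x
  have hv : chartDeriv (R.chart k) x v₀ = e := chartDeriv_chartField (R.chart_mem k) hk _
  have hvz : zOf (chartDeriv (R.chart l) x v₀) = 0 := by
    rw [zOf_chartDeriv_change hk hl, hv, hez, mul_zero]
  have h1 := R.Φ_trans k l x ⟨hk, hl⟩ v₀ (by rw [hv, hez])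
  rw [hv, he2] at h1
  have ck : R.cof k x v₀ = (0, Real.exp (R.scale k x)) := by
    rw [cof_apply, hv, coframe_apply, thetaForm, hez, he2]
    ext <;> simp
  have cl : R.cof l x v₀ = (0, Real.exp (R.scale l x) * chartDeriv (R.chart l) x v₀ 2) := by
    rw [cof_apply, coframe_apply, thetaForm, hvz]
    ext <;> simp
  -- Both coframes compute the same metric; pairing with the vertical vector `v₀` isolates the
  -- `θ`-components.
  have hi : ∀ v, dot (R.cof k x v₀) (R.cof k x v) = dot (R.cof l x v₀) (R.cof l x v) := fun v ↦ by
    rw [← inner_eq_dot hk, ← inner_eq_dot hl]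
  have h2 := hi v₀
  rw [ck, cl] at hi
  rw [ck, cl] at h2
  refine ⟨chartDeriv (R.chart l) x v₀ 2, by simpa using h1, ?_, fun v ↦ ?_⟩
  · simpa [dot_eq, sq] using h2
  · simpa [dot_eq] using hi v

/-- The coframes of two charts are related by the change of gauge and a locally constant sign. -/
theorem exists_cof_change (hk : x ∈ (R.chart k).source) (hl : x ∈ (R.chart l).source) :
    ∃ ε : ℝ, ε * ε = 1 ∧ ∀ᶠ y in 𝓝 x, ∀ v : TangentSpace 𝓘(ℝ, E3) y, R.cof k y v =
      ε • (S.phase (R.gauge k) (R.gauge l) (zOf (R.chart k y)) * (R.cof l y v).1,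
        (R.cof l y v).2) := by
  -- By `Φ_trans` this quotient is the real number `exp(scale l - scale k) * σ`, with `σ` the
  -- vertical ratio. Writing it through `Φ` makes continuity evident, and it ties the sign on the
  -- `dz`-component to the one on `θ`.
  set ε : B → ℝ := fun y ↦ (Real.exp (R.scale l y) * S.transC (R.gauge k) (R.gauge l)
    (zOf (R.chart k y)) * R.Φ l (R.chart l y) /
      (Real.exp (R.scale k y) * R.Φ k (R.chart k y))).re with hε
  have hcont : ContinuousAt ε x := by
    have e1 : ∀ k, x ∈ (R.chart k).source →
        ContinuousAt (fun y ↦ ((Real.exp (R.scale k y) : ℝ) : ℂ)) x := fun k hk ↦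
      Complex.continuous_ofReal.continuousAt.comp (Real.continuous_exp.continuousAt.comp
        ((R.scale_smooth k).contMDiffAt ((R.chart k).open_source.mem_nhds hk)).continuousAt)
    have e2 : ∀ k, x ∈ (R.chart k).source → ContinuousAt (fun y ↦ R.Φ k (R.chart k y)) x :=
      fun k hk ↦ ContinuousAt.comp (contDiffAt_Φ hk).continuousAt ((R.chart k).continuousAt hk)
    have e3 : ContinuousAt (fun y ↦ S.transC (R.gauge k) (R.gauge l) (zOf (R.chart k y))) x :=
      ContinuousAt.comp (g := S.transC (R.gauge k) (R.gauge l))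
        (SpinorVortexSpace.differentiableAt_transC (zOf_mem_overlap hk hl)).continuousAt
        (continuousAt_zOf_chart hk)
    exact Complex.continuous_re.continuousAt.comp ((((e1 l hl).mul e3).mul (e2 l hl)).div
      ((e1 k hk).mul (e2 k hk)) (mul_ne_zero (by simp) (Φ_chart_ne_zero hk)))
  have key : ∀ y, y ∈ (R.chart k).source → y ∈ (R.chart l).source → ε y * ε y = 1 ∧
      ∀ v : TangentSpace 𝓘(ℝ, E3) y, R.cof k y v =
      ε y • (S.phase (R.gauge k) (R.gauge l) (zOf (R.chart k y)) * (R.cof l y v).1,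
        (R.cof l y v).2) := by
    intro y hk hl
    obtain ⟨σ, h1, h2, h3⟩ := exists_vertical_ratio hk hl
    have hΦ := Φ_chart_ne_zero hk
    have hε' : ε y * Real.exp (R.scale k y) = Real.exp (R.scale l y) * σ := by
      have : ε y = Real.exp (R.scale l y) * σ / Real.exp (R.scale k y) := by
        rw [hε]
        beta_reduce
        rw [transC_zOf hk, mul_assoc, ← h1, mul_comm (R.Φ k _), ← mul_assoc,
          mul_div_mul_right _ _ hΦ, ← Complex.ofReal_mul, ← Complex.ofReal_div, Complex.ofReal_re]
      rw [this, div_mul_cancel₀ _ (Real.exp_ne_zero _)]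
    have hE := Real.exp_ne_zero (R.scale k y)
    have hεε : ε y * ε y = 1 := by
      refine mul_left_cancel₀ (pow_ne_zero 2 hE) ?_
      rw [← hε'] at h2
      linear_combination -h2
    refine ⟨hεε, fun v ↦ ?_⟩
    ext1
    · have hd := SpinorVortexSpace.dcoord_ne_zero (zOf_mem_overlap hk hl)
      rw [cof_apply, cof_apply, coframe_apply, coframe_apply, zOf_chartDeriv_change hk hl,
        SpinorVortexSpace.phase, transC_zOf hk]
      simp only [Prod.smul_fst, Complex.real_smul]
      field_simp
      have hc : (ε y : ℂ) * Real.exp (R.scale k y) = Real.exp (R.scale l y) * σ := by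
        exact_mod_cast hε'
      have hc2 : (ε y : ℂ) * ε y = 1 := by exact_mod_cast hεε
      linear_combination zOf (chartDeriv (R.chart k) y v) * (ε y * Real.exp (R.scale l y) * h1
        + ε y * R.Φ k (R.chart k y) * hc - Real.exp (R.scale k y) * R.Φ k (R.chart k y) * hc2)
    · refine mul_left_cancel₀ hE ?_
      rw [h3 v, ← hε']
      simp only [Prod.smul_snd, smul_eq_mul]
      ring
  refine ⟨ε x, (key x hk hl).1, ?_⟩
  -- A continuous function with square one is locally constant.
  have hpos : ∀ᶠ y in 𝓝 x, 0 < ε x * ε y := by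
    have : ContinuousAt (fun y ↦ ε x * ε y) x := continuousAt_const.mul hcont
    refine this.eventually (lt_mem_nhds ?_)
    exact one_pos.trans_eq (key x hk hl).1.symm
  filter_upwards [(R.chart k).open_source.mem_nhds hk, (R.chart l).open_source.mem_nhds hl, hpos]
    with y hy hy' hp
  have hεy : ε x = ε y := by
    have h1 := (key x hk hl).1
    have h2 := (key y hy hy').1
    rcases mul_self_eq_mul_self_iff.1 (h1.trans h2.symm) with h | h
    · exact h
    · rw [h] at hp
      linarith [mul_self_nonneg (ε y)]
  rw [hεy]
  exact (key y hy hy').2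

end GeneralizedSymmetry

end

section

variable {ι N : Type*} [TopologicalSpace N] [ChartedSpace ℂ N]
  {B : Type*} [TopologicalSpace B] [ChartedSpace E3 B] [IsManifold 𝓘(ℝ, E3) ∞ B]
  {K : Type*} {w : WeylStructure B} {S : SpinorVortexSpace ι N}

/-! ### Transition matrices of frames -/

namespace WeylStructure

variable (w) in
/-- The matrix of inner products of two frames. -/
def transition (X Y : Fin 3 → ∀ x : B, TangentSpace 𝓘(ℝ, E3) x) (x : B) :
    Matrix (Fin 3) (Fin 3) ℝ :=
  Matrix.of fun i j ↦ w.metric.inner x (Y i x) (X j x)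

variable (w) in
/-- The frame `X` is orthonormal at `x`. -/
def IsOrthonormalAt (X : Fin 3 → ∀ x : B, TangentSpace 𝓘(ℝ, E3) x) (x : B) : Prop :=
  ∀ i j, w.metric.inner x (X i x) (X j x) = if i = j then 1 else 0

variable {X Y Z : Fin 3 → ∀ x : B, TangentSpace 𝓘(ℝ, E3) x} {x : B}

theorem IsOrthonormalAt.transition_self (hX : w.IsOrthonormalAt X x) : w.transition X X x = 1 := by
  ext i j
  simp [transition, hX i j, Matrix.one_apply]

theorem IsOrthonormalAt.eq_sum (hX : w.IsOrthonormalAt X x) (v : TangentSpace 𝓘(ℝ, E3) x) :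
    v = ∑ j, w.metric.inner x v (X j x) • X j x :=
  eq_sum_of_orthonormal (finrank_tangentSpace x) (w.bilin x) (X := fun i ↦ X i x) hX v

theorem IsOrthonormalAt.transition_mul (hY : w.IsOrthonormalAt Y x) :
    w.transition Y Z x * w.transition X Y x = w.transition X Z x := by
  ext i k
  rw [Matrix.mul_apply]
  simp only [transition, Matrix.of_apply]
  conv_rhs => rw [hY.eq_sum (Z i x)]
  simp

theorem transition_transpose : (w.transition X Y x).transpose = w.transition Y X x := by
  ext i j
  exact w.metric.symm x _ _

theorem IsOrthonormalAt.transition_mem (hX : w.IsOrthonormalAt X x) (hY : w.IsOrthonormalAt Y x) :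
    w.transition X Y x ∈ Matrix.orthogonalGroup (Fin 3) ℝ := by
  rw [Matrix.mem_orthogonalGroup_iff, transition_transpose, hX.transition_mul,
    hY.transition_self]

end WeylStructure

namespace SpinorVortexSpace

theorem IsParallelAt.const_smul {i : ι} {s : ℂ → ℂ × ℝ} {z : ℂ} (hs : S.IsParallelAt i s z)
    (c : ℝ) : S.IsParallelAt i (fun z ↦ c • s z) z := by
  refine (HasFDerivAt.const_smul hs c).congr_fderiv ?_
  ext1 v
  simp

/-- The phase has modulus one and `ε` is a constant sign, so the change of gauge is a fibrewise
isometry preserving parallelism. -/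
theorem IsParallelTriple.pullSection {i j : ι} {s : Fin 3 → ℂ → ℂ × ℝ} {O : Set ℂ}
    (hs : S.IsParallelTriple j s O) {ε : ℝ} (hε : ε * ε = 1) :
    S.IsParallelTriple i (fun a z ↦ ε • S.pullSection i j (s a) z)
      (S.overlap i j ∩ S.coordChange i j ⁻¹' O) where
  isOpen := (contDiffOn_coordChange i j).continuousOn.isOpen_inter_preimage (isOpen_overlap i j)
    hs.isOpen
  subset z hz := hz.1.1
  parallel a z hz := ((hs.parallel a _ hz.2).pullSection hz.1).const_smul ε
  orthonormal z hz a b := by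
    rw [← hs.orthonormal _ hz.2 a b]
    have hp := congrArg Complex.re (phase_mul_conj hz.1)
    simp only [Complex.mul_conj, Complex.ofReal_re, Complex.normSq_apply, Complex.one_re] at hp
    simp only [dot_eq, SpinorVortexSpace.pullSection, Prod.smul_fst, Prod.smul_snd,
      Complex.smul_re, Complex.smul_im, Complex.mul_re, Complex.mul_im, smul_eq_mul]
    generalize S.phase i j z = p at *
    linear_combination (((s a (S.coordChange i j z)).1.re * (s b (S.coordChange i j z)).1.re
      + (s a (S.coordChange i j z)).1.im * (s b (S.coordChange i j z)).1.im) * (p.re * p.re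
        + p.im * p.im) + (s a (S.coordChange i j z)).2 * (s b (S.coordChange i j z)).2) * hε
      + ((s a (S.coordChange i j z)).1.re * (s b (S.coordChange i j z)).1.re
      + (s a (S.coordChange i j z)).1.im * (s b (S.coordChange i j z)).1.im) * hp

theorem IsParallelTriple.combination {i : ι} {s : Fin 3 → ℂ → ℂ × ℝ} {O : Set ℂ}
    (hs : S.IsParallelTriple i s O) {A : Matrix (Fin 3) (Fin 3) ℝ}
    (hA : A ∈ Matrix.orthogonalGroup (Fin 3) ℝ) :
    S.IsParallelTriple i (fun a z ↦ ∑ b, A a b • s b z) O where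
  isOpen := hs.isOpen
  subset := hs.subset
  parallel a z hz := IsParallelAt.add_smul (fun b ↦ hs.parallel b z hz) (A a)
  orthonormal z hz a b := by
    rw [Matrix.mem_orthogonalGroup_iff] at hA
    have h := congrFun (congrFun hA a) b
    rw [Matrix.mul_apply, Matrix.one_apply] at h
    rw [← h]
    have ho : ∀ c d, dot (s c z) (s d z) = if c = d then 1 else 0 := hs.orthonormal z hz
    have hadd : ∀ p q r : ℂ × ℝ, dot p (q + r) = dot p q + dot p r := fun p q r ↦ by
      rw [dot_comm, dot_add_left, dot_comm q, dot_comm r]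
    have hsm : ∀ (c : ℝ) (p q : ℂ × ℝ), dot (c • p) q = c * dot p q := fun c p q ↦ by
      simp [dot_eq]; ring
    have hsm' : ∀ (c : ℝ) (p q : ℂ × ℝ), dot p (c • q) = c * dot p q := fun c p q ↦ by
      rw [dot_comm, hsm, dot_comm]
    simp only [Fin.sum_univ_three, dot_add_left, hadd, hsm, hsm', ho, Matrix.transpose_apply]
    simp
    ring

end SpinorVortexSpace

/-! ### Patching parallel frames on simply connected open sets -/

namespace GeneralizedSymmetry

variable {R : GeneralizedSymmetry K w S} {k l : K} {x : B} {s : Fin 3 → ℂ → ℂ × ℝ} {O : Set ℂ}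
  {X Y : Fin 3 → ∀ x : B, TangentSpace 𝓘(ℝ, E3) x}

/-- Being a parallel frame does not depend on the chart, by `exists_cof_change` and gauge
invariance; two frames can thus be compared in a single chart. -/
theorem IsLiftAt.change_chart (h : R.IsLiftAt l s O X x) (hk : x ∈ (R.chart k).source) :
    ∃ s' O', R.IsLiftAt k s' O' X x := by
  obtain ⟨ε, hε, hcof⟩ := exists_cof_change hk h.mem_source
  refine ⟨_, _, hk, h.triple.pullSection hε, ⟨zOf_mem_overlap hk h.mem_source, ?_⟩, ?_⟩
  · rw [Set.mem_preimage, coordChange_zOf hk h.mem_source]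
    exact h.mem
  · filter_upwards [hcof, h.cof_eq, (R.chart k).open_source.mem_nhds hk,
      (R.chart l).open_source.mem_nhds h.mem_source] with y h1 h2 hy hy' i
    rw [h1, h2, SpinorVortexSpace.pullSection, coordChange_zOf hy hy']

theorem IsParallelFrameAt.isOrthonormalAt (h : R.IsParallelFrameAt X x) :
    w.IsOrthonormalAt X x := by
  obtain ⟨k, s, O, h⟩ := h
  exact h.inner_eq

/-- In a common chart the entries are inner products of parallel sections, hence constant on a ball
in the base. -/
theorem IsParallelFrameAt.transition_eventuallyEq (hX : R.IsParallelFrameAt X x)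
    (hY : R.IsParallelFrameAt Y x) :
    ∀ᶠ y in 𝓝 x, w.transition X Y y = w.transition X Y x := by
  obtain ⟨k, s, O, hX⟩ := hX
  obtain ⟨l, s₁, O₁, hY⟩ := hY
  obtain ⟨s', O', hY⟩ := hY.change_chart hX.mem_source
  obtain ⟨r, hr, hsub⟩ := Metric.isOpen_iff.1 (hX.triple.isOpen.inter hY.triple.isOpen) _
    ⟨hX.mem, hY.mem⟩
  filter_upwards [hX.eventually, hY.eventually, (continuousAt_zOf_chart hX.mem_source)
    |>.preimage_mem_nhds (Metric.ball_mem_nhds _ hr)] with y hXy hYy hy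
  have key : ∀ {y}, R.IsLiftAt k s O X y → R.IsLiftAt k s' O' Y y → ∀ i j,
      w.transition X Y y i j = dot (s' i (zOf (R.chart k y))) (s j (zOf (R.chart k y))) := by
    intro y hX hY i j
    rw [WeylStructure.transition, Matrix.of_apply, inner_eq_dot hX.mem_source,
      hX.cof_eq.self_of_nhds, hY.cof_eq.self_of_nhds]
  ext i j
  rw [key hXy hYy, key hX hY]
  exact eq_of_hasFDerivAt_zero_on_ball (f := fun z ↦ dot (s' i z) (s j z)) (fun z hz ↦
    (hY.triple.parallel i z (hsub hz).2).hasFDerivAt_dot (hX.triple.parallel j z (hsub hz).1)) hy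

theorem IsParallelFrameAt.combination (hX : R.IsParallelFrameAt X x)
    {A : Matrix (Fin 3) (Fin 3) ℝ} (hA : A ∈ Matrix.orthogonalGroup (Fin 3) ℝ)
    (hY : ∀ᶠ y in 𝓝 x, ∀ i, Y i y = ∑ j, A i j • X j y) : R.IsParallelFrameAt Y x := by
  obtain ⟨k, s, O, h⟩ := hX
  refine ⟨k, _, O, h.mem_source, h.triple.combination hA, h.mem, ?_⟩
  filter_upwards [hY, h.cof_eq] with y h1 h2 i
  simp only [h1, map_sum, map_smul, h2]

/-- Parallel frames exist on simply connected open sets. -/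
theorem exists_isParallelFrameAt_of_simplyConnected (hC : S.CVanishes) {V : Set B} (hV : IsOpen V)
    (hs : SimplyConnectedSpace V) : ∃ X, ∀ x ∈ V, R.IsParallelFrameAt X x := by
  classical
  have : LocallyPathConnectedSpace B := ChartedSpace.locallyPathConnectedSpace E3 B
  have : LocallyPathConnectedSpace V := hV.locallyPathConnectedSpace
  choose F hF using exists_isParallelFrameAt (R := R) hC
  set U : V → Set V := fun p ↦ {x | R.IsParallelFrameAt (F p) x} with hU
  -- The value `1` off the overlap is a default. The group is all of `O(3)`, since the sign changes
  -- between charts can reverse orientation.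
  set g : V → V → V → Matrix.orthogonalGroup (Fin 3) ℝ := fun p q x ↦
    if h : x ∈ U p ∩ U q then ⟨w.transition (F p) (F q) x,
      h.1.isOrthonormalAt.transition_mem h.2.isOrthonormalAt⟩ else 1 with hg
  have g_eq : ∀ {p q x}, x ∈ U p ∩ U q → (g p q x : Matrix (Fin 3) (Fin 3) ℝ) =
      w.transition (F p) (F q) x := fun h ↦ by rw [hg]; simp only [dif_pos h]
  have ev : ∀ {x : V} {P : B → Prop}, (∀ᶠ y in 𝓝 (x : B), P y) → ∀ᶠ y : V in 𝓝 x, P y :=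
    fun h ↦ continuous_subtype_val.continuousAt.eventually h
  obtain ⟨h, h_comp, h_loc⟩ := exists_locallyConstant_splitting U
    (fun p ↦ isOpen_iff_mem_nhds.2 fun x hx ↦ ev hx.eventually) id (fun x ↦ hF x) g
    (fun p x hx ↦ Subtype.ext <| by
      rw [g_eq ⟨hx, hx⟩]
      exact hx.isOrthonormalAt.transition_self)
    (fun p q r x hx ↦ Subtype.ext <| by
      rw [Submonoid.coe_mul, g_eq ⟨hx.1.2, hx.2⟩, g_eq hx.1, g_eq ⟨hx.1.1, hx.2⟩]
      exact hx.1.2.isOrthonormalAt.transition_mul)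
    (fun p q x hx ↦ by
      filter_upwards [ev hx.1.eventually, ev hx.2.eventually,
        ev (hx.1.transition_eventuallyEq hx.2)] with y h1 h2 h3
      refine Subtype.ext ?_
      rw [g_eq ⟨h1, h2⟩, g_eq hx, h3])
  -- From `F q = g p q • F p` and `h q = g p q * h p`, the frame `(h p)⁻¹ • F p` does not depend on
  -- `p`; at `x` the choice `p = x` is always available.
  refine ⟨fun i x ↦ if hx : x ∈ V then ∑ j, ((h ⟨x, hx⟩ ⟨x, hx⟩)⁻¹).1 i j • F x j x else 0,
    fun x hx ↦ ?_⟩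
  set x' : V := ⟨x, hx⟩ with hx'
  refine (hF x).combination ((h x' x')⁻¹).2 ?_
  -- Since `V` is open, a property holding near `x'` in `V` holds near `x` in `B`.
  have hn := (hV.isOpenEmbedding_subtypeVal.map_nhds_eq x')
  have hev : ∀ᶠ y : V in 𝓝 x', ∀ i,
      (if hy : (y : B) ∈ V then ∑ j, ((h ⟨y, hy⟩ ⟨y, hy⟩)⁻¹).1 i j • F y j y else 0)
        = ∑ j, ((h x' x')⁻¹).1 i j • F x j y := by
    filter_upwards [h_loc x' x' (hF x), ev (hF x).eventually] with y h1 h2 i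
    have hmem : y ∈ U x' ∩ U y := ⟨h2, hF y⟩
    rw [dif_pos y.2, Subtype.coe_eta, h_comp x' y y hmem, h1, mul_inv_rev]
    have hFF : ∀ j, F y j y = ∑ m, (g x' y y).1 j m • F x m y := fun j ↦ by
      rw [g_eq hmem]
      exact h2.isOrthonormalAt.eq_sum _
    have hmul : ((h x' x')⁻¹).1 = ((h x' x')⁻¹ * (g x' y y)⁻¹).1 * (g x' y y).1 := by
      rw [← Submonoid.coe_mul, inv_mul_cancel_right]
    rw [hmul]
    simp only [hFF, Matrix.mul_apply, Finset.smul_sum, Finset.sum_smul, smul_smul]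
    exact Finset.sum_comm
  rw [← hn]
  exact hev

end GeneralizedSymmetry

end

end EinsteinWeyl

end

theorem mainTheorem9
    {B : Type*} [TopologicalSpace B] [T2Space B] [ChartedSpace EinsteinWeyl.E3 B]
    [IsManifold 𝓘(ℝ, EinsteinWeyl.E3) ∞ B]
    {N : Type*} [TopologicalSpace N] [T2Space N] [ConnectedSpace N] [ChartedSpace ℂ N]
    [IsManifold 𝓘(ℂ) ω N]
    {ι K : Type*}
    (w : EinsteinWeyl.WeylStructure B) (hw : w.IsEinsteinWeyl)
    (S : EinsteinWeyl.SpinorVortexSpace ι N)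
    (R : EinsteinWeyl.GeneralizedSymmetry K w S) (hR : R.IsGeodesic) :
    (∀ V : Set B, IsOpen V → SimplyConnectedSpace V → w.IsHyperCROn V) ∧
      (S.IsTrivial ∨ S.IsSpherical) := by
  refine ⟨fun V hV hs ↦ ?_, hR.cVanishes.isTrivial_or_isSpherical⟩
  obtain ⟨X, hX⟩ := R.exists_isParallelFrameAt_of_simplyConnected hR.cVanishes hV hs
  exact R.isHyperCROn_of_isParallelFrameAt hR.cVanishes hX
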